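/- Theorem (symmetric trees). Infinite chess is played on the board $\mathbb{Z}\times\mathbb{Z}$ with the usual pieces and the usual moves, but without promotion, castling, en passant, two-step pawn moves, the fifty-move rule or the repetition rule; white pawns advance upward, black pawns downward. A player wins by checkmating the opponent; every other course of play, including stalemate and unending play, is a draw. A board position assigns to each square the piece standing on it, if any. A strategy for a player is a function that gives his next move from the finite sequence of moves already played. It must make a legal move in every play that follows it, whenever it is that player's turn and he has a legal move. It is computable if it is a total Turing computable function on finite sequences of moves, a move being a pair of squares. There is a board position $B$ in infinite chess, with at most one king on each side and neither king under attack, such that: 1. The board position $B$ is computable, i.e. $B$ is a Turing computable function on $\mathbb{Z}\times\mathbb{Z}$. 2. In the category of computable strategies, the position is a win for the first player, whether this is white or black: for each player $c$, when $c$ moves first from $B$, $c$ has a computable strategy $\tau$ that defeats every computable strategy $\sigma$ of the opponent (the play of $\tau$ against $\sigma$ reaches, after finitely many moves, a position in which the opponent is checkmated). Here it suffices that $\sigma$ is a computable function whose moves in this particular play are legal. 3. In the category of all strategies, the position is a draw, whichever player moves first: neither player has a winning strategy (a strategy that defeats all opposing strategies), and each player has a strategy that is not defeated by any opposing strategy.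 -/

import Mathlib

/-! Infinite chess, played on the integer plane.  There is no promotion, no castling, no
two-step pawn move, no *en passant*, no fifty-move rule and no repetition rule. -/

namespace InfiniteChess

/-- The two players. -/
inductive Color where
  | white
  | black

/-- The kinds of chess pieces. -/
inductive Kind where
  | king
  | queen
  | rook
  | bishop
  | knight
  | pawn

/-- The opponent. -/
def Color.other : Color → Color
  | .white => .black
  | .black => .white

/-- The vertical direction in which the pawns of a player advance: white pawns move upward,
black pawns move downward. -/
def Color.forward : Color → ℤ
  | .white => 1
  | .black => -1

/-- A numbering of the two colours, through which they are coded. -/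
def colorEquiv : Color ≃ Bool where
  toFun | .white => true | .black => false
  invFun | true => .white | false => .black
  left_inv := by intro c; cases c <;> rfl
  right_inv := by intro b; cases b <;> rfl

/-- A numbering of the six kinds of pieces, through which they are coded. -/
def kindEquiv : Kind ≃ Fin 6 where
  toFun | .king => 0 | .queen => 1 | .rook => 2 | .bishop => 3 | .knight => 4 | .pawn => 5
  invFun := ![.king, .queen, .rook, .bishop, .knight, .pawn]
  left_inv := by intro k; cases k <;> rfl
  right_inv := by intro i; fin_cases i <;> rfl

instance : Primcodable Color := Primcodable.ofEquiv Bool colorEquiv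

instance : Primcodable Kind := Primcodable.ofEquiv (Fin 6) kindEquiv

/-- A piece has a colour and a kind. -/
abbrev Piece := Color × Kind

/-- The squares of the board: (file, rank). -/
abbrev Square := ℤ × ℤ

/-- A board position assigns to each square the piece standing there, if any. -/
abbrev Board := Square → Option Piece

/-- A move is given by its square of departure and its square of arrival. -/
abbrev Move := Square × Square

/-- The four rook directions. -/
def rookDirections : Set Square := {(1, 0), (-1, 0), (0, 1), (0, -1)}

/-- The four bishop directions. -/
def bishopDirections : Set Square := {(1, 1), (1, -1), (-1, 1), (-1, -1)}

/-- The eight knight jumps. -/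
def knightJumps : Set Square :=
  {(1, 2), (1, -2), (-1, 2), (-1, -2), (2, 1), (2, -1), (-2, 1), (-2, -1)}

/-- The two capturing directions of a pawn. -/
def pawnCaptures (c : Color) : Set Square := {(1, c.forward), (-1, c.forward)}

/-- Square `t` is reached from square `s` by finitely many steps in one of the directions `D`,
all squares strictly between them being empty. -/
def Board.Slides (B : Board) (D : Set Square) (s t : Square) : Prop :=
  ∃ d ∈ D, ∃ n : ℕ, 0 < n ∧ t = s + n • d ∧ ∀ k : ℕ, 0 < k → k < n → B (s + k • d) = none

/-- The piece `P`, standing on `s`, attacks the square `t`. -/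
def Board.PieceAttacks (B : Board) (P : Piece) (s t : Square) : Prop :=
  match P.2 with
  | .king => t - s ∈ rookDirections ∪ bishopDirections
  | .queen => B.Slides (rookDirections ∪ bishopDirections) s t
  | .rook => B.Slides rookDirections s t
  | .bishop => B.Slides bishopDirections s t
  | .knight => t - s ∈ knightJumps
  | .pawn => t - s ∈ pawnCaptures P.1

/-- The king of player `c` is attacked by a piece of the opponent. -/
def Board.InCheck (B : Board) (c : Color) : Prop :=
  ∃ (s t : Square) (k : Kind),
    B t = some (c, .king) ∧ B s = some (c.other, k) ∧ B.PieceAttacks (c.other, k) s t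

/-- The board after the piece on `m.1` has been moved to `m.2`, any piece there being captured. -/
def Board.move (B : Board) (m : Move) : Board :=
  Function.update (Function.update B m.1 none) m.2 (B m.1)

/-- Player `c` may make the move `m` as far as the movement of the pieces is concerned, that is,
apart from the safety of his king.  The player moves one of his own pieces to a square not
occupied by another of them; a pawn either advances one step to an empty square or captures one
step diagonally forward; any other piece moves to a square that it attacks. -/
def Board.CanMove (B : Board) (c : Color) (m : Move) : Prop :=
  ∃ k : Kind, B m.1 = some (c, k) ∧ (∀ l : Kind, B m.2 ≠ some (c, l)) ∧
    match k with
    | .pawn => (B m.2 = none ∧ m.2 = m.1 + (0, c.forward)) ∨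
        (B m.2 ≠ none ∧ B.PieceAttacks (c, .pawn) m.1 m.2)
    | k => B.PieceAttacks (c, k) m.1 m.2

/-- An ordinary board position: each side has at most one king, and neither king is attacked
(so that it makes sense for either player to be on move). -/
def Board.Regular (B : Board) : Prop :=
  ∀ c : Color, (∀ s t : Square, B s = some (c, .king) → B t = some (c, .king) → s = t) ∧
    ¬ B.InCheck c

/-- A position is a board position together with the player whose turn it is. -/
structure Position where
  /-- the board position -/
  board : Board
  /-- the player to move -/
  turn : Color

namespace Position

/-- A legal move for the player to move: it must not leave his own king attacked. -/
def Legal (p : Position) (m : Move) : Prop :=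
  p.board.CanMove p.turn m ∧ ¬ (p.board.move m).InCheck p.turn

/-- The position after a move. -/
def move (p : Position) (m : Move) : Position :=
  ⟨p.board.move m, p.turn.other⟩

/-- The position after a finite sequence of moves (listed in chronological order). -/
def after (p : Position) (h : List Move) : Position :=
  h.foldl move p

/-- Player `c` is checkmated: it is his turn, his king is attacked, and he has no legal move. -/
def Checkmated (p : Position) (c : Color) : Prop :=
  p.turn = c ∧ p.board.InCheck c ∧ ∀ m : Move, ¬ p.Legal m

end Position

/-- A strategy tells a player what to play next, given the sequence of moves played so far. -/
abbrev Strategy := List Move → Move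

namespace Position

/-- The finite sequence of moves `h` can be legally played from `p`. -/
def IsPlay (p : Position) (h : List Move) : Prop :=
  ∀ (g : List Move) (m : Move), g ++ [m] <+: h → (p.after g).Legal m

/-- The finite sequence of moves `h` is a legal play from `p` in which all moves of player `c`
are made by the strategy `τ`. -/
def Follows (p : Position) (c : Color) (τ : Strategy) (h : List Move) : Prop :=
  p.IsPlay h ∧
    ∀ (g : List Move) (m : Move), g ++ [m] <+: h → (p.after g).turn = c → m = τ g

/-- `τ` is a strategy for player `c` from `p`: in every play that follows `τ`, whenever it is the
turn of `c` and `c` has a legal move, `τ` makes a legal move. -/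
def IsStrategy (p : Position) (c : Color) (τ : Strategy) : Prop :=
  ∀ h : List Move, p.Follows c τ h → (p.after h).turn = c →
    (∃ m, (p.after h).Legal m) → (p.after h).Legal (τ h)

/-- Playing from `p`, with player `c` following `τ` and the opponent following `σ`, player `c`
wins: the play of the two strategies against each other arrives at a position in which the
opponent is checkmated. -/
def Defeats (p : Position) (c : Color) (τ σ : Strategy) : Prop :=
  ∃ h : List Move, p.Follows c τ h ∧ p.Follows c.other σ h ∧ (p.after h).Checkmated c.other

/-- The opponent of `c`, following `σ` against the strategy `τ` of `c`, keeps to the rules: in the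
play of the two strategies against each other, whenever the opponent is to move and has a legal
move, `σ` makes a legal move. -/
def LegalAgainst (p : Position) (c : Color) (τ σ : Strategy) : Prop :=
  ∀ h : List Move, p.Follows c τ h → p.Follows c.other σ h → (p.after h).turn = c.other →
    (∃ m, (p.after h).Legal m) → (p.after h).Legal (σ h)

/-- In the category of computable play, `p` is a win for player `c`: he has a computable strategy
that defeats every computable strategy of the opponent.  The computable strategies `σ` of the
opponent need to observe the rules only in the play at hand; this covers every computable `σ`
with `p.IsStrategy c.other σ`, and a `σ` is not discarded because of plays that do not occur. -/
def ComputableWin (p : Position) (c : Color) : Prop :=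
  ∃ τ : Strategy, p.IsStrategy c τ ∧ Computable τ ∧
    ∀ σ : Strategy, Computable σ → p.LegalAgainst c τ σ → p.Defeats c τ σ

/-- `τ` is a winning strategy for `c`: it defeats all opposing strategies. -/
def IsWinning (p : Position) (c : Color) (τ : Strategy) : Prop :=
  p.IsStrategy c τ ∧ ∀ σ : Strategy, p.IsStrategy c.other σ → p.Defeats c τ σ

/-- `τ` forces (at least) a draw for `c`: no opposing strategy defeats it. -/
def IsDrawing (p : Position) (c : Color) (τ : Strategy) : Prop :=
  p.IsStrategy c τ ∧ ∀ σ : Strategy, p.IsStrategy c.other σ → ¬ p.Defeats c.other σ τ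

/-- In the category of all strategies, `p` is a draw: neither player has a winning strategy, and
either player can force a draw. -/
def IsDraw (p : Position) : Prop :=
  ∀ c : Color, (¬ ∃ τ : Strategy, p.IsWinning c τ) ∧ ∃ τ : Strategy, p.IsDrawing c τ

end Position

end InfiniteChess

/-! The black king stands at the surface of a half-plane filled with white pawns. Holes and a few
knights in this field let White drive him down by an unbroken series of checks. At each check every
neighbouring square except the next ones of a prescribed track is guarded (`Hunt.guarded`); without
sliding pieces nothing can be interposed, and the other black pieces are too far away to capture
(`Hunt.reply`). A pawn check leaves one flight square, a knight check at a fork leaves two, and at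
the end of a track the check is mate. The hunt is thus a walk down a binary tree in which Black
chooses at the forks.

The tree is a Kleene tree: a node `s` survives as long as no bit `s(n)` is seen, within `s.length`
steps, to be the output of program `n` on input `n` (`Avoids`). This is decidable, so the field and
the hunting strategy are computable. The tree has infinite branches (`exists_endless`) but no
computable one (`exists_not_avoids`). A computable defence that escaped mate would move the king
through a computable sequence of squares, and a computable branch could be read off from it
(`Endless.avoids`, `no_computable_track`).

For the draw, the board also contains the mirror image: a white king at the surface of a field of
black pawns. The hunter is never in danger, since the opponent only has forced king moves. The
hunted side, allowed any strategy, follows an infinite branch. White may deviate from the intended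
hunt, but all his checks can be listed (`Flight.checks`), and after each of them the king can safely
continue along the branch (`Flight.evade`). When White makes a move without check, the mirror field
is still intact and Black starts the hunt there (`Flight.counter`). Mirror symmetry settles the case
in which Black moves first.

To embed the tree, use the depth `t = -y` and the file `X = x - y`, in which left steps are
vertical. In a block of rows the track with base value `y` moves right from `y` to `13 * y`, runs
straight for a while and then splits towards `13 * y + 1` and `13 * y + 12`. Tracks of different
nodes thus stay far apart, and the local requirements (`sea_field`, `Endless.path`) reduce to
arithmetic with residues modulo 13. -/

namespace InfiniteChess

/-! ### Attacks and moves on boards without sliding pieces -/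

/-- The kinds of pieces that do not slide. -/
def Kind.Short : Kind → Prop
  | .king | .knight | .pawn => True
  | _ => False

/-- All pieces on the board are kings, knights and pawns. -/
def Board.Short (B : Board) : Prop := ∀ s P, B s = some P → P.2.Short

/-- The attack of a non-sliding piece, in coordinates. -/
def Hits (P : Piece) (s t : Square) : Prop :=
  match P.2 with
  | .king => (s.1 - 1 ≤ t.1 ∧ t.1 ≤ s.1 + 1) ∧ (s.2 - 1 ≤ t.2 ∧ t.2 ≤ s.2 + 1) ∧
      ¬ (t.1 = s.1 ∧ t.2 = s.2)
  | .knight => ((t.1 = s.1 + 1 ∨ t.1 = s.1 - 1) ∧ (t.2 = s.2 + 2 ∨ t.2 = s.2 - 2)) ∨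
      ((t.1 = s.1 + 2 ∨ t.1 = s.1 - 2) ∧ (t.2 = s.2 + 1 ∨ t.2 = s.2 - 1))
  | .pawn => t.2 = s.2 + P.1.forward ∧ (t.1 = s.1 + 1 ∨ t.1 = s.1 - 1)
  | _ => False

/-- Without sliding pieces an attack depends only on the two squares, not on the board between them,
and becomes linear arithmetic. -/
theorem pieceAttacks_iff_hits {B : Board} {P : Piece} (hP : P.2.Short) (s t : Square) :
    B.PieceAttacks P s t ↔ Hits P s t := by
  obtain ⟨c, k⟩ := P
  obtain ⟨a, b⟩ := s
  obtain ⟨x, y⟩ := t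
  cases k <;> simp only [Kind.Short] at hP <;>
  simp only [Board.PieceAttacks, Hits, rookDirections, bishopDirections, knightJumps, pawnCaptures,
    Set.mem_union, Set.mem_insert_iff, Set.mem_singleton_iff, Prod.mk_sub_mk, Prod.mk.injEq] <;>
  omega

theorem Board.Short.inCheck_iff {B : Board} (hB : B.Short) (c : Color) :
    B.InCheck c ↔ ∃ (s t : Square) (k : Kind),
      B t = some (c, .king) ∧ B s = some (c.other, k) ∧ Hits (c.other, k) s t := by
  unfold Board.InCheck
  refine exists_congr fun s => exists_congr fun t => exists_congr fun k => ?_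
  refine and_congr_right fun _ => and_congr_right fun h => ?_
  exact pieceAttacks_iff_hits (hB _ _ h) s t

theorem Board.move_apply (B : Board) (m : Move) (s : Square) :
    B.move m s = if s = m.2 then B m.1 else if s = m.1 then none else B s := by
  simp only [Board.move, Function.update_apply]

theorem Board.Short.move {B : Board} (hB : B.Short) (m : Move) : (B.move m).Short := by
  intro s P
  rw [Board.move_apply]
  split_ifs
  · exact hB _ _
  · simp
  · exact hB _ _

/-- Moves in coordinates. -/
theorem Board.Short.canMove_iff {B : Board} (hB : B.Short) (c : Color) (m : Move) :
    B.CanMove c m ↔ ∃ k : Kind, B m.1 = some (c, k) ∧ (∀ l : Kind, B m.2 ≠ some (c, l)) ∧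
      ((k = .pawn ∧ B m.2 = none ∧ m.2.1 = m.1.1 ∧ m.2.2 = m.1.2 + c.forward) ∨
        ((k = .pawn → B m.2 ≠ none) ∧ Hits (c, k) m.1 m.2)) := by
  unfold Board.CanMove
  refine exists_congr fun k => ?_
  refine and_congr_right fun h => and_congr_right fun _ => ?_
  have hk := hB _ _ h
  have := @pieceAttacks_iff_hits B (c, k) hk m.1 m.2
  obtain ⟨⟨a, b⟩, x, y⟩ := m
  cases k <;> simp_all [Kind.Short]

end InfiniteChess

/-! ### The hunt of the king through the field -/

namespace InfiniteChess

/-- The four ways in which the fleeing king can leave a square of its track. -/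
inductive Step where
  | left
  | right
  | drop
  | fork
  deriving DecidableEq

abbrev wPawn : Option Piece := some (.white, .pawn)
abbrev wKnight : Option Piece := some (.white, .knight)
abbrev bKing : Option Piece := some (.black, .king)

/-- What is needed of the squares of a field of white pawns around the track squares `T` of
the black king, where `kd` tells how the king is driven on from a square. -/
structure Sea (W : Board) (T : Square → Prop) (kd : Square → Step) : Prop where
  start : T (0, 0)
  kd_start : kd (0, 0) = .drop
  king : W (0, 0) = bKing
  content : ∀ x y, y ≤ 5 → (x, y) ≠ ((0, 0) : Square) →
    W (x, y) = none ∨ W (x, y) = wPawn ∨ W (x, y) = wKnight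
  surface : ∀ x y, 1 ≤ y → y ≤ 5 → W (x, y) = none
  hole_start : W (1, -1) = none
  knight_deep : ∀ x y, W (x, y) = wKnight → y ≤ -3
  pawn_start : ∀ x, -2 ≤ x → x ≤ 2 → x ≠ 0 → W (x, 0) = wPawn
  depth : ∀ x y, T (x, y) → y ≤ 0
  down : ∀ x y, T (x, y) → W (x, y - 1) = wPawn
  hole : ∀ x y, T (x, y) → W (x - 1, y - 1) = none
  -- In a left step `left₂` is the checking pawn; `left₃` and `left₄` guard the square below the
  -- king and the checking pawn; `left_end` closes a dead end. `left₁` guards a square above the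
  -- king after his step, and `left_next` is the hole to the right that his new square needs. Right
  -- steps are analogous.
  left₁ : ∀ x y, T (x, y) → kd (x, y) = .left → W (x - 3, y - 1) = wPawn
  left₂ : ∀ x y, T (x, y) → kd (x, y) = .left → W (x + 1, y - 2) = wPawn
  left₃ : ∀ x y, T (x, y) → kd (x, y) = .left → W (x - 1, y - 2) = wPawn
  left₄ : ∀ x y, T (x, y) → kd (x, y) = .left → W (x + 2, y - 2) = wPawn
  left_end : ∀ x y, T (x, y) → kd (x, y) = .left → ¬ T (x - 1, y - 1) → W (x - 2, y - 2) = wPawn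
  left_next : ∀ x y, T (x, y) → kd (x, y) = .left → T (x - 1, y - 1) → W (x, y - 2) = none
  right₁ : ∀ x y, T (x, y) → kd (x, y) = .right → W (x + 3, y - 1) = wPawn
  right₂ : ∀ x y, T (x, y) → kd (x, y) = .right → W (x - 2, y - 2) = wPawn
  right₃ : ∀ x y, T (x, y) → kd (x, y) = .right → W (x - 1, y - 2) = wPawn
  right₄ : ∀ x y, T (x, y) → kd (x, y) = .right → W (x + 1, y - 2) = wPawn
  right_end : ∀ x y, T (x, y) → kd (x, y) = .right → ¬ T (x + 1, y - 1) →
    W (x + 2, y - 2) = wPawn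
  right_next : ∀ x y, T (x, y) → kd (x, y) = .right → T (x + 1, y - 1) → W (x + 2, y - 2) = none
  -- In a drop the king captures the pawn below him. It has lost its guards: the one on its lower
  -- right (`drop₄`) has advanced to give check, and on its lower left there is a hole. `drop₁` and
  -- `drop₂` then guard squares above the new place of the king.
  drop₁ : ∀ x y, T (x, y) → kd (x, y) = .drop → W (x - 2, y - 1) = wPawn
  drop₂ : ∀ x y, T (x, y) → kd (x, y) = .drop → W (x + 2, y - 1) = wPawn
  drop₃ : ∀ x y, T (x, y) → kd (x, y) = .drop → W (x, y - 2) = wPawn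
  drop₄ : ∀ x y, T (x, y) → kd (x, y) = .drop → W (x + 1, y - 2) = wPawn
  drop_next : ∀ x y, T (x, y) → kd (x, y) = .drop → T (x, y - 1)
  -- The knight jumps into the hole `fork₂`, out of the king's reach, and leaves him both diagonal
  -- squares below.
  fork₁ : ∀ x y, T (x, y) → kd (x, y) = .fork → W (x - 4, y) = wKnight
  fork₂ : ∀ x y, T (x, y) → kd (x, y) = .fork → W (x - 2, y - 1) = none
  fork₃ : ∀ x y, T (x, y) → kd (x, y) = .fork → W (x - 3, y - 1) = wPawn
  fork₄ : ∀ x y, T (x, y) → kd (x, y) = .fork → W (x + 3, y - 1) = wPawn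
  fork₅ : ∀ x y, T (x, y) → kd (x, y) = .fork → W (x - 1, y - 2) = wPawn
  fork_left : ∀ x y, T (x, y) → kd (x, y) = .fork → T (x - 1, y - 1)
  fork_right : ∀ x y, T (x, y) → kd (x, y) = .fork → T (x + 1, y - 1)
  fork_left_next : ∀ x y, T (x, y) → kd (x, y) = .fork → W (x, y - 2) = none
  fork_right_next : ∀ x y, T (x, y) → kd (x, y) = .fork → W (x + 2, y - 2) = none
  -- The checking pawn of a left or right step has vacated one of the two squares `drop₁`, `drop₂`
  -- that a drop from the new square would need.
  kd_left : ∀ x y, T (x, y) → kd (x, y) = .left → T (x - 1, y - 1) →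
    kd (x - 1, y - 1) ≠ .drop
  kd_right : ∀ x y, T (x, y) → kd (x, y) = .right → T (x + 1, y - 1) →
    kd (x + 1, y - 1) ≠ .drop ∧ kd (x + 1, y - 1) ≠ .fork
  kd_drop : ∀ x y, T (x, y) → kd (x, y) = .drop → kd (x, y - 1) = .left
  kd_fork_left : ∀ x y, T (x, y) → kd (x, y) = .fork → kd (x - 1, y - 1) = .drop
  kd_fork_right : ∀ x y, T (x, y) → kd (x, y) = .fork → kd (x + 1, y - 1) = .right

/-- The checking move against a king on the square `k`. -/
def driveMove (kd : Square → Step) (k : Square) : Move :=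
  match kd k with
  | .left | .drop => ((k.1 + 1, k.2 - 2), (k.1 + 1, k.2 - 1))
  | .right => ((k.1 - 1, k.2 - 2), (k.1 - 1, k.2 - 1))
  | .fork => ((k.1 - 4, k.2), (k.1 - 2, k.2 - 1))

/-- The squares to which a king on the square `k` can be driven. -/
def Next (T : Square → Prop) (kd : Square → Step) (k u : Square) : Prop :=
  T u ∧ u.2 = k.2 - 1 ∧ match kd k with
  | .left => u.1 = k.1 - 1
  | .right => u.1 = k.1 + 1
  | .drop => u.1 = k.1
  | .fork => u.1 = k.1 - 1 ∨ u.1 = k.1 + 1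

/-- The requirements on the board `b₀` outside the field of white pawns, for the hunt of the
black king in that field. -/
structure HuntStart (W b₀ : Board) : Prop where
  short : b₀.Short
  low : ∀ x y, y ≤ 5 → b₀ (x, y) = W (x, y)
  high : ∀ x y, 6 ≤ y → b₀ (x, y) ≠ bKing
  safe : ¬ b₀.InCheck .white

/-- The state of the hunt, with white to move: the black king stands on the track square `(x, y)`
and is enclosed. -/
structure Hunt (W : Board) (T : Square → Prop) (kd : Square → Step) (b₀ b : Board) (x y : ℤ) :
    Prop where
  track : T (x, y)
  short : b.Short
  king : b (x, y) = bKing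
  high : ∀ u v, 6 ≤ v → b (u, v) = b₀ (u, v)
  content : ∀ u v, v ≤ 5 → ¬ (u = x ∧ v = y) →
    b (u, v) = none ∨ b (u, v) = wPawn ∨ b (u, v) = wKnight
  deep : ∀ u v, v ≤ y - 2 → b (u, v) = W (u, v)
  -- The exceptions are the squares that the previous checking pawn may have left, in a right step,
  -- a drop and a left step respectively.
  row : ∀ u, u ≠ x - 2 → u ≠ x + 1 → u ≠ x + 2 → b (u, y - 1) = W (u, y - 1)
  hole : b (x + 1, y - 1) = none
  drop₁ : kd (x, y) = .drop → b (x - 2, y - 1) = wPawn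
  drop₂ : kd (x, y) = .drop → b (x + 2, y - 1) = wPawn
  fork₁ : kd (x, y) = .fork → b (x - 2, y - 1) = none
  fork₂ : kd (x, y) = .fork → b (x - 4, y) = wKnight
  top : ∀ u, x - 1 ≤ u → u ≤ x + 1 →
    b (u - 1, y) = wPawn ∨ b (u + 1, y) = wPawn ∨ b (u - 2, y) = wKnight

variable {W b₀ b b' : Board} {T : Square → Prop} {kd : Square → Step} {x y : ℤ}

theorem Hunt.start (hS : Sea W T kd) (h : HuntStart W b₀) : Hunt W T kd b₀ b₀ 0 0 where
  track := hS.start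
  short := h.short
  king := by rw [h.low _ _ (by simp), hS.king]
  high _ _ _ := rfl
  content u v h1 h2 := by
    rw [h.low _ _ h1]
    exact hS.content u v h1 (by simpa using h2)
  deep u v hs := h.low u v (by omega)
  row u _ _ _ := h.low _ _ (by simp)
  hole := by
    rw [h.low _ _ (by simp)]
    exact hS.hole_start
  drop₁ _ := by
    rw [h.low _ _ (by simp)]
    exact hS.drop₁ 0 0 hS.start hS.kd_start
  drop₂ _ := by
    rw [h.low _ _ (by simp)]
    exact hS.drop₂ 0 0 hS.start hS.kd_start
  fork₁ h := by simp [hS.kd_start] at h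
  fork₂ h := by simp [hS.kd_start] at h
  top u h1 h2 := by
    have := fun v h1 h2 h3 => (h.low v 0 (by simp)).trans (hS.pawn_start v h1 h2 h3)
    obtain h3 | h3 | h3 : u = -1 ∨ u = 0 ∨ u = 1 := by omega
    · exact .inl (this _ (by omega) (by omega) (by omega))
    · exact .inl (this _ (by omega) (by omega) (by omega))
    · exact .inr (.inl (this _ (by omega) (by omega) (by omega)))

/-- White is not in check as long as black has only his king in the field. -/
theorem HuntStart.not_inCheck (h : HuntStart W b₀) (hs : b'.Short)
    (hx : y ≤ 0) (hh : ∀ u v, 6 ≤ v → b' (u, v) = b₀ (u, v))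
    (hk : b' (x, y) = bKing)
    (hl : ∀ u v, v ≤ 5 → ¬ (u = x ∧ v = y) →
      b' (u, v) = none ∨ b' (u, v) = wPawn ∨ b' (u, v) = wKnight) : ¬ b'.InCheck .white := by
  rw [hs.inCheck_iff]
  rintro ⟨⟨s, s'⟩, ⟨t, t'⟩, k, h1, h2, h3⟩
  have ht : 6 ≤ t' := by
    by_contra hc
    by_cases hxy : t = x ∧ t' = y
    · rw [hxy.1, hxy.2, hk] at h1; simp at h1
    · rcases hl t t' (by omega) hxy with h | h | h <;> rw [h] at h1 <;> simp at h1
  have hs' : 6 ≤ s' := by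
    by_contra hc
    by_cases hxy : s = x ∧ s' = y
    · rw [hxy.1, hxy.2, hk] at h2
      obtain rfl : Kind.king = k := by simpa [Color.other] using h2
      simp only [Hits] at h3
      omega
    · rcases hl s s' (by omega) hxy with h | h | h <;> rw [h] at h2 <;> simp [Color.other] at h2
  apply h.safe
  rw [h.short.inCheck_iff]
  exact ⟨_, _, k, by rw [← hh _ _ ht, h1], by rw [← hh _ _ hs', h2], h3⟩

theorem Hunt.not_inCheck (h : Hunt W T kd b₀ b x y) (hS : Sea W T kd) (h0 : HuntStart W b₀) :
    ¬ b.InCheck .white :=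
  h0.not_inCheck h.short (hS.depth _ _ h.track) h.high h.king h.content

/-- The board after white's checking move. -/
theorem Hunt.drive_apply (hS : Sea W T kd) (h : Hunt W T kd b₀ b x y) (u v : ℤ) :
    b.move (driveMove kd (x, y)) (u, v) =
      match kd (x, y) with
      | .left | .drop => if u = x + 1 ∧ v = y - 1 then wPawn else
          if u = x + 1 ∧ v = y - 2 then none else b (u, v)
      | .right => if u = x - 1 ∧ v = y - 1 then wPawn else
          if u = x - 1 ∧ v = y - 2 then none else b (u, v)
      | .fork => if u = x - 2 ∧ v = y - 1 then wKnight else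
          if u = x - 4 ∧ v = y then none else b (u, v) := by
  rw [Board.move_apply]
  rcases hk : kd (x, y) <;> simp only [driveMove, hk, Prod.mk.injEq]
  · rw [h.deep _ _ le_rfl, hS.left₂ _ _ h.track hk]
  · rw [h.deep _ _ le_rfl, hS.right₃ _ _ h.track hk]
  · rw [h.deep _ _ le_rfl, hS.drop₄ _ _ h.track hk]
  · rw [h.fork₂ hk]

theorem Hunt.drive_legal (hS : Sea W T kd) (h0 : HuntStart W b₀) (h : Hunt W T kd b₀ b x y) :
    (Position.mk b .white).Legal (driveMove kd (x, y)) := by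
  have hd := hS.depth _ _ h.track
  refine ⟨?_, ?_⟩
  · rw [h.short.canMove_iff]
    rcases hk : kd (x, y) <;> simp only [driveMove, hk]
    · have h1 : b (x + 1, y - 2) = wPawn := by rw [h.deep _ _ le_rfl, hS.left₂ _ _ h.track hk]
      refine ⟨.pawn, h1, ?_, .inl ⟨rfl, ?_⟩⟩ <;> simp [h.hole, Color.forward]
      omega
    · have h1 : b (x - 1, y - 2) = wPawn := by rw [h.deep _ _ le_rfl, hS.right₃ _ _ h.track hk]
      have h2 : b (x - 1, y - 1) = none := by
        rw [h.row _ (by omega) (by omega) (by omega), hS.hole _ _ h.track]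
      refine ⟨.pawn, h1, ?_, .inl ⟨rfl, ?_⟩⟩ <;> simp [h2, Color.forward]
      omega
    · have h1 : b (x + 1, y - 2) = wPawn := by rw [h.deep _ _ le_rfl, hS.drop₄ _ _ h.track hk]
      refine ⟨.pawn, h1, ?_, .inl ⟨rfl, ?_⟩⟩ <;> simp [h.hole, Color.forward]
      omega
    · refine ⟨.knight, h.fork₂ hk, ?_, .inr ⟨?_, ?_⟩⟩ <;> simp [h.fork₁ hk, Hits]
      omega
  · have hb := h.drive_apply hS
    refine h0.not_inCheck (h.short.move _) hd (x := x) ?_ ?_ ?_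
    · intro u v hv
      rw [hb, ← h.high u v hv]
      cases kd (x, y) <;> grind
    · have := h.king
      rw [hb]
      cases kd (x, y) <;> grind
    · intro u v hv huv
      have := h.content u v hv huv
      rw [hb]
      cases kd (x, y) <;> grind

theorem Hunt.drive_check (hS : Sea W T kd) (h : Hunt W T kd b₀ b x y) :
    ∃ k u v, v ≤ 0 ∧ b.move (driveMove kd (x, y)) (u, v) = some (.white, k) ∧
      Hits (.white, k) (u, v) (x, y) := by
  have hb := h.drive_apply hS
  have hd := hS.depth _ _ h.track
  rcases hk : kd (x, y) <;> rw [hk] at hb <;> simp only at hb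
  · refine ⟨.pawn, x + 1, y - 1, by omega, ?_, ?_⟩ <;> simp [hb, Hits, Color.forward]
  · refine ⟨.pawn, x - 1, y - 1, by omega, ?_, ?_⟩ <;> simp [hb, Hits, Color.forward]
  · refine ⟨.pawn, x + 1, y - 1, by omega, ?_, ?_⟩ <;> simp [hb, Hits, Color.forward]
  · refine ⟨.knight, x - 2, y - 1, by omega, ?_, ?_⟩ <;> simp [hb, Hits]

theorem Hunt.drive_king (hS : Sea W T kd) (h : Hunt W T kd b₀ b x y) :
    b.move (driveMove kd (x, y)) (x, y) = bKing := by
  have hK := h.king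
  rw [h.drive_apply hS]
  cases kd (x, y) <;> grind

theorem Hunt.drive_inCheck (hS : Sea W T kd) (h : Hunt W T kd b₀ b x y) :
    (b.move (driveMove kd (x, y))).InCheck .black := by
  obtain ⟨k, u, v, -, h1, h2⟩ := h.drive_check hS
  exact (h.short.move _).inCheck_iff _ |>.2 ⟨_, _, k, h.drive_king hS, h1, h2⟩

/-- A black piece other than the king stands far above the field. -/
theorem Hunt.drive_black (hS : Sea W T kd) (h : Hunt W T kd b₀ b x y) {u v : ℤ} {k : Kind}
    (hb : b.move (driveMove kd (x, y)) (u, v) = some (.black, k)) (huv : ¬ (u = x ∧ v = y)) :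
    6 ≤ v ∧ b₀ (u, v) = some (.black, k) := by
  have hd := hS.depth _ _ h.track
  have h1 := h.content u v
  have h2 := h.high u v
  rw [h.drive_apply hS] at hb
  by_cases hv : v ≤ 5
  · exfalso
    cases kd (x, y) <;> grind
  · refine ⟨by omega, ?_⟩
    cases kd (x, y) <;> grind

/-- The squares around the king that remain guarded after white's checking move. -/
theorem Hunt.guarded (hS : Sea W T kd) (h : Hunt W T kd b₀ b x y) {u v : ℤ}
    (h1 : Hits (.black, .king) (x, y) (u, v)) (h2 : ¬ Next T kd (x, y) (u, v)) :
    ∃ k s t, ¬ (s = u ∧ t = v) ∧ b.move (driveMove kd (x, y)) (s, t) = some (.white, k) ∧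
      Hits (.white, k) (s, t) (u, v) := by
  have hb := h.drive_apply hS
  obtain ⟨⟨h3, h4⟩, ⟨h5, h6⟩, h7⟩ := h1
  simp only at h3 h4 h5 h6 h7
  have hT := h.track
  have pawn : ∀ s t, b.move (driveMove kd (x, y)) (s, t) = wPawn → v = t + 1 →
      (u = s + 1 ∨ u = s - 1) → ∃ k s t, ¬ (s = u ∧ t = v) ∧
      b.move (driveMove kd (x, y)) (s, t) = some (.white, k) ∧ Hits (.white, k) (s, t) (u, v) := by
    intro s t e1 e2 e3
    exact ⟨.pawn, s, t, by omega, e1, e2, e3⟩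
  have knight : ∀ s t, b.move (driveMove kd (x, y)) (s, t) = wKnight → v = t + 1 →
      u = s + 2 → ∃ k s t, ¬ (s = u ∧ t = v) ∧
      b.move (driveMove kd (x, y)) (s, t) = some (.white, k) ∧ Hits (.white, k) (s, t) (u, v) := by
    intro s t e1 e2 e3
    exact ⟨.knight, s, t, by omega, e1, .inr ⟨.inl e3, .inl e2⟩⟩
  -- The row above is covered by `top`, the king's own row by the pawn directly below him, and the
  -- row beneath by pawns two rows down.
  obtain hv | hv | hv : v = y + 1 ∨ v = y ∨ v = y - 1 := by omega
  · rcases h.top u h3 h4 with e | e | e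
    · refine pawn (u - 1) y ?_ hv (by omega)
      rw [hb]
      cases kd (x, y) <;> grind
    · refine pawn (u + 1) y ?_ hv (by omega)
      rw [hb]
      cases kd (x, y) <;> grind
    · refine knight (u - 2) y ?_ hv (by omega)
      rw [hb]
      cases kd (x, y) <;> grind
  · refine pawn x (y - 1) ?_ (by omega) (by omega)
    have e := h.row x (by omega) (by omega) (by omega)
    rw [hS.down _ _ hT] at e
    rw [hb]
    cases kd (x, y) <;> grind
  · subst hv
    have deep := h.deep
    rcases hk : kd (x, y) <;> rw [hk] at hb <;> simp only at hb <;>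
      simp only [Next, hk, true_and, not_and] at h2
    · obtain rfl | hu | rfl : u = x - 1 ∨ u = x ∨ u = x + 1 := by omega
      · refine pawn (x - 2) (y - 2) ?_ (by omega) (by omega)
        rw [hb, deep _ _ le_rfl, hS.left_end x y hT hk (by tauto)]
        grind
      · refine pawn (x - 1) (y - 2) ?_ (by omega) (by omega)
        rw [hb, deep _ _ le_rfl, hS.left₃ x y hT hk]
        grind
      · refine pawn (x + 2) (y - 2) ?_ (by omega) (by omega)
        rw [hb, deep _ _ le_rfl, hS.left₄ x y hT hk]
        grind
    · obtain rfl | hu | rfl : u = x - 1 ∨ u = x ∨ u = x + 1 := by omega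
      · refine pawn (x - 2) (y - 2) ?_ (by omega) (by omega)
        rw [hb, deep _ _ le_rfl, hS.right₂ x y hT hk]
        grind
      · refine pawn (x + 1) (y - 2) ?_ (by omega) (by omega)
        rw [hb, deep _ _ le_rfl, hS.right₄ x y hT hk]
        grind
      · refine pawn (x + 2) (y - 2) ?_ (by omega) (by omega)
        rw [hb, deep _ _ le_rfl, hS.right_end x y hT hk (by tauto)]
        grind
    · have hn := hS.drop_next x y hT hk
      have : u ≠ x := by
        rintro rfl
        exact h2 hn rfl
      refine pawn x (y - 2) ?_ (by omega) (by omega)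
      rw [hb, deep _ _ le_rfl, hS.drop₃ x y hT hk]
      grind
    · obtain rfl | hu | rfl : u = x - 1 ∨ u = x ∨ u = x + 1 := by omega
      · exact absurd (Or.inl rfl) (h2 (hS.fork_left x y hT hk))
      · refine pawn (x - 1) (y - 2) ?_ (by omega) (by omega)
        rw [hb, deep _ _ le_rfl, hS.fork₅ x y hT hk]
        grind
      · exact absurd (Or.inr rfl) (h2 (hS.fork_right x y hT hk))

/-- The only legal replies are those of the king along the track. -/
theorem Hunt.reply (hS : Sea W T kd) (h : Hunt W T kd b₀ b x y) (m : Move)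
    (hm : (Position.mk (b.move (driveMove kd (x, y))) .black).Legal m) :
    m.1 = (x, y) ∧ Next T kd (x, y) m.2 := by
  have hd := hS.depth _ _ h.track
  have hs := h.short.move (driveMove kd (x, y))
  have hK := h.drive_king hS
  have hB := fun u v k => h.drive_black hS (u := u) (v := v) (k := k)
  have hG := fun u v => h.guarded hS (u := u) (v := v)
  obtain ⟨k, u, v, hv, hc1, hc2⟩ := h.drive_check hS
  generalize b.move (driveMove kd (x, y)) = b₁ at *
  obtain ⟨⟨m1, m1'⟩, m2, m2'⟩ := m
  obtain ⟨hm1, hm2⟩ := hm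
  simp only [hs.canMove_iff] at hm1 hm2
  rw [(hs.move _).inCheck_iff] at hm2
  obtain ⟨l, e1, e2, e3⟩ := hm1
  by_cases hmk : m1 = x ∧ m1' = y
  · obtain ⟨rfl, rfl⟩ := hmk
    obtain rfl : Kind.king = l := by simpa [hK] using e1
    refine ⟨rfl, ?_⟩
    by_contra hN
    have e4 : Hits (.black, .king) (m1, m1') (m2, m2') := by simpa using e3
    obtain ⟨k', s, t, e5, e6, e7⟩ := hG _ _ e4 hN
    refine hm2 ⟨(s, t), (m2, m2'), k', ?_, ?_, e7⟩
    · simp [Board.move_apply, hK]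
    · rw [Board.move_apply, if_neg (by simpa using e5), if_neg, e6, Color.other]
      rintro h
      simp [h, hK] at e6
  · exfalso
    obtain ⟨e5, e6⟩ := hB _ _ _ e1 hmk
    -- Any other black piece starts in row 6 or higher and descends at most two rows, so it cannot
    -- capture the checking piece, which stands in row 0 or lower.
    have e7 : 4 ≤ m2' := by
      rcases e3 with ⟨-, -, -, e3⟩ | ⟨-, e3⟩
      · simp only [Color.forward] at e3
        omega
      · rcases l <;> simp only [Hits, Color.forward] at e3 <;> omega
    refine hm2 ⟨(u, v), (x, y), k, ?_, ?_, hc2⟩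
    · rw [Board.move_apply, if_neg (by simp; omega), if_neg (by simp; omega), hK]
    · rw [Board.move_apply, if_neg (by simp; omega), if_neg (by simp; omega), hc1, Color.other]

/-- The checking piece and the pawns near it now stand in the king's row and guard the row above
him. Everything two rows below the new square is still as in `W`, so the remaining clauses come from
`Sea`. -/
theorem Hunt.next (hS : Sea W T kd) (h : Hunt W T kd b₀ b x y) {u v : ℤ}
    (hu : Next T kd (x, y) (u, v)) :
    Hunt W T kd b₀ ((b.move (driveMove kd (x, y))).move ((x, y), (u, v))) u v := by
  have hd := hS.depth _ _ h.track
  obtain ⟨hT, hv, hu⟩ := hu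
  simp only at hv hu
  subst hv
  have hT0 := h.track
  have hs := (h.short.move (driveMove kd (x, y))).move ((x, y), (u, y - 1))
  have hb := h.drive_apply hS
  have hb' : ∀ s t, ((b.move (driveMove kd (x, y))).move ((x, y), (u, y - 1))) (s, t) =
      if s = u ∧ t = y - 1 then bKing else if s = x ∧ t = y then none else
        b.move (driveMove kd (x, y)) (s, t) := by
    intro s t
    rw [Board.move_apply, h.drive_king hS]
    simp
  generalize b.move (driveMove kd (x, y)) = b₁ at *
  generalize b₁.move ((x, y), (u, y - 1)) = b₂ at *
  have high := h.high
  have content := h.content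
  have deep := h.deep
  have row := h.row
  have down := row x (by omega) (by omega) (by omega)
  rw [hS.down _ _ hT0] at down
  rcases hk : kd (x, y) <;> rw [hk] at hb <;> simp only [hk] at hu hb <;> simp only [hb] at hb'
  · subst hu
    have n1 := hS.left_next _ _ hT0 hk hT
    have n2 := row (x - 3) (by omega) (by omega) (by omega)
    rw [hS.left₁ _ _ hT0 hk] at n2
    have n3 := hS.kd_left _ _ hT0 hk hT
    have n4 := hS.fork₁ _ _ hT
    have n5 := hS.fork₂ _ _ hT
    clear hS h hb
    refine ⟨hT, hs, ?_, ?_, ?_, ?_, ?_, ?_, ?_, ?_, ?_, ?_, ?_⟩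
    · simp [hb']
    · intro s t hst
      rw [hb', ← high s t hst]
      grind only
    · intro s t h1 h2
      have := content s t h1
      rw [hb']
      clear high content deep row
      grind
    · intro s t hst
      rw [hb', ← deep s t (by omega)]
      clear high content deep row
      grind
    · intro s h1 h2 h3
      rw [hb', ← deep s _ (by omega)]
      clear high content deep row
      grind
    · have := deep (x - 1 + 1) (y - 1 - 1) (by omega)
      rw [hb']
      clear high content deep row
      grind
    · grind
    · grind
    · have := deep (x - 1 - 2) (y - 1 - 1) (by omega)
      rw [hb']
      clear high content deep row
      grind
    · have := row (x - 1 - 4) (by omega) (by omega) (by omega)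
      rw [hb']
      clear high content deep row
      grind
    · intro s h1 h2
      rw [hb', hb', hb']
      clear high content deep row
      obtain h3 | h3 | h3 : s = x - 2 ∨ s = x - 1 ∨ s = x := by omega
      · left; grind
      · right; left; grind
      · right; left; grind
  · subst hu
    have n1 := hS.right_next _ _ hT0 hk hT
    have n2 := row (x + 3) (by omega) (by omega) (by omega)
    rw [hS.right₁ _ _ hT0 hk] at n2
    have n3 := hS.kd_right _ _ hT0 hk hT
    clear hS h hb
    refine ⟨hT, hs, ?_, ?_, ?_, ?_, ?_, ?_, ?_, ?_, ?_, ?_, ?_⟩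
    · simp [hb']
    · intro s t hst
      rw [hb', ← high s t hst]
      grind only
    · intro s t h1 h2
      have := content s t h1
      rw [hb']
      clear high content deep row
      grind
    · intro s t hst
      rw [hb', ← deep s t (by omega)]
      clear high content deep row
      grind
    · intro s h1 h2 h3
      rw [hb', ← deep s _ (by omega)]
      clear high content deep row
      grind
    · have := deep (x + 1 + 1) (y - 1 - 1) (by omega)
      rw [hb']
      clear high content deep row
      grind
    · grind
    · grind
    · grind
    · grind
    · intro s h1 h2
      rw [hb', hb', hb']
      clear high content deep row
      obtain h3 | h3 | h3 : s = x + 1 - 1 ∨ s = x + 1 ∨ s = x + 1 + 1 := by omega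
      · left; grind
      · left; grind
      · right; left; grind
  · subst u
    have n1 := h.drop₁ hk
    have n2 := h.drop₂ hk
    have n3 := hS.kd_drop _ _ hT0 hk
    clear hS h hb
    refine ⟨hT, hs, ?_, ?_, ?_, ?_, ?_, ?_, ?_, ?_, ?_, ?_, ?_⟩
    · simp [hb']
    · intro s t hst
      rw [hb', ← high s t hst]
      grind only
    · intro s t h1 h2
      have := content s t h1
      rw [hb']
      clear high content deep row
      grind
    · intro s t hst
      rw [hb', ← deep s t (by omega)]
      clear high content deep row
      grind
    · intro s h1 h2 h3
      rw [hb', ← deep s _ (by omega)]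
      clear high content deep row
      grind
    · have := deep (x + 1) (y - 1 - 1) (by omega)
      rw [hb']
      clear high content deep row
      grind
    · grind
    · grind
    · grind
    · grind
    · intro s h1 h2
      rw [hb', hb', hb']
      clear high content deep row
      obtain h3 | h3 | h3 : s = x - 1 ∨ s = x ∨ s = x + 1 := by omega
      · left; grind
      · right; left; grind
      · right; left; grind
  · have n2 := row (x - 3) (by omega) (by omega) (by omega)
    rw [hS.fork₃ _ _ hT0 hk] at n2
    have n3 := row (x + 3) (by omega) (by omega) (by omega)
    rw [hS.fork₄ _ _ hT0 hk] at n3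
    have n1 := hS.fork_left_next _ _ hT0 hk
    have n4 := hS.fork_right_next _ _ hT0 hk
    have n5 := hS.kd_fork_left _ _ hT0 hk
    have n6 := hS.kd_fork_right _ _ hT0 hk
    have n7 := hS.drop₁ _ _ hT
    have n8 := hS.drop₂ _ _ hT
    clear hS h hb
    rcases hu with rfl | rfl
    · refine ⟨hT, hs, ?_, ?_, ?_, ?_, ?_, ?_, ?_, ?_, ?_, ?_, ?_⟩
      · simp [hb']
      · intro s t hst
        rw [hb', ← high s t hst]
        grind only
      · intro s t h1 h2
        have := content s t h1
        rw [hb']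
        clear high content deep row
        grind
      · intro s t hst
        rw [hb', ← deep s t (by omega)]
        clear high content deep row
        grind
      · intro s h1 h2 h3
        rw [hb', ← deep s _ (by omega)]
        clear high content deep row
        grind
      · have := deep (x - 1 + 1) (y - 1 - 1) (by omega)
        rw [hb']
        clear high content deep row
        grind
      · have := deep (x - 1 - 2) (y - 1 - 1) (by omega)
        rw [hb']
        clear high content deep row
        grind
      · have := deep (x - 1 + 2) (y - 1 - 1) (by omega)
        rw [hb']
        clear high content deep row
        grind
      · grind
      · grind
      · intro s h1 h2
        rw [hb', hb', hb']
        clear high content deep row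
        obtain h3 | h3 | h3 : s = x - 1 - 1 ∨ s = x - 1 ∨ s = x - 1 + 1 := by omega
        · left; grind
        · right; left; grind
        · right; right; grind
    · refine ⟨hT, hs, ?_, ?_, ?_, ?_, ?_, ?_, ?_, ?_, ?_, ?_, ?_⟩
      · simp [hb']
      · intro s t hst
        rw [hb', ← high s t hst]
        grind only
      · intro s t h1 h2
        have := content s t h1
        rw [hb']
        clear high content deep row
        grind
      · intro s t hst
        rw [hb', ← deep s t (by omega)]
        clear high content deep row
        grind
      · intro s h1 h2 h3
        rw [hb', ← deep s _ (by omega)]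
        clear high content deep row
        grind
      · have := deep (x + 1 + 1) (y - 1 - 1) (by omega)
        rw [hb']
        clear high content deep row
        grind
      · grind
      · grind
      · grind
      · grind
      · intro s h1 h2
        rw [hb', hb', hb']
        clear high content deep row
        obtain h3 | h3 | h3 : s = x + 1 - 1 ∨ s = x + 1 ∨ s = x + 1 + 1 := by omega
        · right; right; grind
        · left; grind
        · right; left; grind

end InfiniteChess

/-! ### The flight along an infinite path -/

namespace InfiniteChess

/-- An infinite path `p` of the black king through the field: at depth `n` he stands on the
file `p n`. -/
structure Path (W : Board) (T : Square → Prop) (kd : Square → Step) (p : ℕ → ℤ) : Prop where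
  zero : p 0 = 0
  next : ∀ n : ℕ, Next T kd (p n, -n) (p (n + 1), -n - 1)
  track : ∀ n : ℕ, T (p n, -n)
  knights : ∀ u v : ℤ, W (u, v) = wKnight → ∀ n : ℕ, u ≤ p n + 6 → p n ≤ u + 6 → v ≤ -n + 6 →
    -n ≤ v + 6 → ∃ s : ℕ, kd (p s, -s) = .fork ∧ u = p s - 4 ∧ v = -s
  before : ∀ s n : ℕ, kd (p s, -s) = .fork → n ≤ s → s ≤ n + 6 → p n = p s + s - n
  after_left : ∀ s n : ℕ, kd (p s, -s) = .fork → p (s + 1) = p s - 1 → s + 2 ≤ n → n ≤ s + 6 →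
    p n = p s + s - n + 1
  after_right : ∀ s n : ℕ, kd (p s, -s) = .fork → p (s + 1) = p s + 1 → s ≤ n → n ≤ s + 6 →
    p n = p s + n - s
  -- These pawns occupy squares from which the knight of a fork could otherwise give further checks.
  pawn₁ : ∀ s : ℕ, kd (p s, -s) = .fork → W (p s - 2, -s + 1) = wPawn
  pawn₂ : ∀ s : ℕ, kd (p s, -s) = .fork → W (p s - 3, -s - 2) = wPawn
  pawn₃ : ∀ s : ℕ, kd (p s, -s) = .fork → W (p s - 3, -s - 3) = wPawn
  pawn₄ : ∀ s : ℕ, kd (p s, -s) = .fork → W (p s - 4, -s - 2) = wPawn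
  pawn₅ : ∀ s : ℕ, kd (p s, -s) = .fork → W (p s - 1, -s - 3) = wPawn

/-- The state of the flight along the path `p`, with white to move. -/
structure Flight (W : Board) (kd : Square → Step) (p : ℕ → ℤ) (b₀ b : Board) (n : ℕ) :
    Prop where
  short : b.Short
  king : b (p n, -n) = bKing
  safe : ¬ b.InCheck .black
  high : ∀ u v : ℤ, 6 ≤ v → b (u, v) = b₀ (u, v)
  empty : ∀ u v : ℤ, 1 ≤ v → v ≤ 5 → b (u, v) = none
  content : ∀ u v : ℤ, v ≤ 5 → ¬ (u = p n ∧ v = -n) →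
    b (u, v) = none ∨ b (u, v) = wPawn ∨ b (u, v) = wKnight
  deep : ∀ u v : ℤ, v ≤ -n - 2 → b (u, v) = W (u, v)
  knights : ∀ u v : ℤ, b (u, v) = wKnight → v ≤ 5 → W (u, v) = wKnight ∨
    ∃ s : ℕ, kd (p s, -s) = .fork ∧ (s + 1 ≤ n ∧ u = p s - 2 ∧ v = -s - 1 ∨
      s + 3 ≤ n ∧ p (s + 1) = p s - 1 ∧ u = p s ∧ v = -s)
  pawn₁ : ∀ s : ℕ, kd (p s, -s) = .fork → n ≤ s + 1 → b (p s - 2, -s + 1) = wPawn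
  pawn₂ : ∀ s : ℕ, kd (p s, -s) = .fork → n ≤ s + 1 → b (p s - 3, -s - 2) = wPawn
  pawn₃ : ∀ s : ℕ, kd (p s, -s) = .fork → p (s + 1) = p s - 1 → n ≤ s + 5 →
    b (p s - 3, -s - 3) = wPawn
  pawn₄ : ∀ s : ℕ, kd (p s, -s) = .fork → p (s + 1) = p s - 1 → n ≤ s + 5 →
    b (p s - 4, -s - 2) = wPawn
  pawn₅ : ∀ s : ℕ, kd (p s, -s) = .fork → p (s + 1) = p s - 1 → n ≤ s + 5 →
    b (p s - 1, -s - 3) = wPawn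
  -- In `W` this square is a hole. The pawn arrives there by giving the only check that is possible
  -- at the drop after the fork.
  pawn₆ : ∀ s : ℕ, kd (p s, -s) = .fork → p (s + 1) = p s - 1 → s + 2 ≤ n → n ≤ s + 5 →
    b (p s, -s - 2) = wPawn

variable {W b₀ b : Board} {T : Square → Prop} {kd : Square → Step} {p : ℕ → ℤ} {n : ℕ}

theorem Path.step (hp : Path W T kd p) (s : ℕ) (h : kd (p s, -s) = .fork) :
    p (s + 1) = p s - 1 ∨ p (s + 1) = p s + 1 := by
  have := (hp.next s).2.2
  simpa [h] using this

/-- Only knights of forks on the path come near the king, and near a fork the path is known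
explicitly. Of all the squares from which such a knight could check after one jump, two remain; the
others hold white pawns or are out of range. -/
theorem Flight.knight_cases (hp : Path W T kd p) (h : Flight W kd p b₀ b n)
    {u v e f : ℤ} (hk : b (u, v) = wKnight) (hv : v ≤ 5) (he : ∀ k, b (e, f) ≠ some (.white, k))
    (h1 : Hits (.white, .knight) (u, v) (e, f)) (h2 : Hits (.white, .knight) (e, f) (p n, -n)) :
    kd (p n, -n) = .fork ∧ u = p n - 4 ∧ v = -n ∧ e = p n - 2 ∧ f = -n - 1 ∨
    ∃ s : ℕ, n = s + 2 ∧ kd (p s, -s) = .fork ∧ p (s + 1) = p s - 1 ∧ u = p s - 2 ∧ v = -s - 1 ∧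
      e = p s ∧ f = -s := by
  have hne : ∀ c d, b (c, d) = wPawn → ¬ (e = c ∧ f = d) := by
    rintro c d h3 ⟨rfl, rfl⟩
    exact he _ h3
  simp only [Hits] at h1 h2
  have main : ∃ s : ℕ, kd (p s, -s) = .fork ∧ (u = p s - 4 ∧ v = -s ∨
      (s + 1 ≤ n ∧ u = p s - 2 ∧ v = -s - 1 ∨
      s + 3 ≤ n ∧ p (s + 1) = p s - 1 ∧ u = p s ∧ v = -s)) := by
    rcases h.knights _ _ hk hv with h3 | ⟨s, h3, h4⟩
    · obtain ⟨s, h4, h5⟩ := hp.knights u v h3 n (by omega) (by omega) (by omega) (by omega)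
      exact ⟨s, h4, .inl h5⟩
    · exact ⟨s, h3, .inr h4⟩
  obtain ⟨s, hs, h3⟩ := main
  -- The knight stands on its original square, on its square after the fork check, or on the square
  -- to which it went back for a second check.
  rcases h3 with ⟨rfl, rfl⟩ | ⟨h3, rfl, rfl⟩ | ⟨h3, h4, rfl, rfl⟩
  · obtain h5 | rfl | rfl | h5 : n < s ∨ n = s ∨ n = s + 1 ∨ s + 2 ≤ n := by omega
    · exfalso
      have hb : s ≤ n + 6 → p n = p s + s - n := hp.before s n hs (by omega)
      clear h hne hp
      rcases h1 with ⟨rfl | rfl, rfl | rfl⟩ | ⟨rfl | rfl, rfl | rfl⟩ <;> omega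
    · left
      have p1 := hne _ _ (h.pawn₁ n hs (by omega))
      refine ⟨hs, ?_⟩
      rcases h1 with ⟨rfl | rfl, rfl | rfl⟩ | ⟨rfl | rfl, rfl | rfl⟩ <;> omega
    · exfalso
      have p1 := hne _ _ (h.pawn₁ s hs (by omega))
      have p2 := hne _ _ (h.pawn₂ s hs (by omega))
      have := hp.step s hs
      push_cast at h2
      rcases h1 with ⟨rfl | rfl, rfl | rfl⟩ | ⟨rfl | rfl, rfl | rfl⟩ <;> omega
    · exfalso
      have hl : p n = p s + s - n + 1 ∨ p n = p s + n - s ∨ s + 6 < n := by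
        have := hp.after_left s n hs
        have := hp.after_right s n hs
        have := hp.step s hs
        omega
      clear h hne hp
      rcases h1 with ⟨rfl | rfl, rfl | rfl⟩ | ⟨rfl | rfl, rfl | rfl⟩ <;> omega
  · rcases hp.step s hs with hlr | hlr
    · have hl := fun h => hp.after_left s n hs hlr h
      obtain rfl | rfl | rfl | rfl | rfl | h5 :
        n = s + 1 ∨ n = s + 2 ∨ n = s + 3 ∨ n = s + 4 ∨ n = s + 5 ∨ s + 6 ≤ n := by omega
      · exfalso
        push_cast at h2
        clear h hne hp hl
        rcases h1 with ⟨rfl | rfl, rfl | rfl⟩ | ⟨rfl | rfl, rfl | rfl⟩ <;> omega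
      · right
        refine ⟨s, rfl, hs, hlr, rfl, rfl, ?_⟩
        have p3 := hne _ _ (h.pawn₃ s hs hlr (by omega))
        have hl := hl (by omega) (by omega)
        push_cast at h2 hl
        clear h hne hp
        rcases h1 with ⟨rfl | rfl, rfl | rfl⟩ | ⟨rfl | rfl, rfl | rfl⟩ <;> omega
      · exfalso
        have p3 := hne _ _ (h.pawn₄ s hs hlr (by omega))
        have p4 := hne _ _ (h.pawn₆ s hs hlr (by omega) (by omega))
        have hl := hl (by omega) (by omega)
        push_cast at h2 hl
        clear h hne hp
        rcases h1 with ⟨rfl | rfl, rfl | rfl⟩ | ⟨rfl | rfl, rfl | rfl⟩ <;> omega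
      · exfalso
        have p3 := hne _ _ (h.pawn₄ s hs hlr (by omega))
        have p4 := hne _ _ (h.pawn₅ s hs hlr (by omega))
        have hl := hl (by omega) (by omega)
        push_cast at h2 hl
        clear h hne hp
        rcases h1 with ⟨rfl | rfl, rfl | rfl⟩ | ⟨rfl | rfl, rfl | rfl⟩ <;> omega
      · exfalso
        have p3 := hne _ _ (h.pawn₃ s hs hlr (by omega))
        have hl := hl (by omega) (by omega)
        push_cast at h2 hl
        clear h hne hp
        rcases h1 with ⟨rfl | rfl, rfl | rfl⟩ | ⟨rfl | rfl, rfl | rfl⟩ <;> omega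
      · exfalso
        have hl := hl (by omega)
        clear h hne hp
        rcases h1 with ⟨rfl | rfl, rfl | rfl⟩ | ⟨rfl | rfl, rfl | rfl⟩ <;> omega
    · exfalso
      have := hp.after_right s n hs hlr (by omega)
      clear h hne hp
      rcases h1 with ⟨rfl | rfl, rfl | rfl⟩ | ⟨rfl | rfl, rfl | rfl⟩ <;> omega
  · exfalso
    have := hp.after_left s n hs h4 (by omega)
    clear h hne hp
    rcases h1 with ⟨rfl | rfl, rfl | rfl⟩ | ⟨rfl | rfl, rfl | rfl⟩ <;> omega

end InfiniteChess

/-! ### White's checks during the flight, and the replies -/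

namespace InfiniteChess
variable {W b₀ b : Board} {T : Square → Prop} {kd : Square → Step} {p : ℕ → ℤ} {n : ℕ}

/-- The moves with which white can give check to the fleeing king. -/
inductive Checks (kd : Square → Step) (p : ℕ → ℤ) (b : Board) (n : ℕ) : Move → Prop
  | left : b (p n - 1, -n - 2) = wPawn → Checks kd p b n ((p n - 1, -n - 2), (p n - 1, -n - 1))
  | right : b (p n + 1, -n - 2) = wPawn → Checks kd p b n ((p n + 1, -n - 2), (p n + 1, -n - 1))
  | fork : kd (p n, -n) = .fork → b (p n - 4, -n) = wKnight →
      Checks kd p b n ((p n - 4, -n), (p n - 2, -n - 1))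
  | back (s : ℕ) : n = s + 2 → kd (p s, -s) = .fork → p (s + 1) = p s - 1 →
      b (p s - 2, -s - 1) = wKnight → Checks kd p b n ((p s - 2, -s - 1), (p s, -s))

/-- The far side of the board, as the fleeing side needs it. -/
structure FarSide (b₀ : Board) : Prop where
  white : ∀ u v : ℤ, 6 ≤ v → ∀ k, b₀ (u, v) = some (.white, k) → k = .king
  black : ∀ u v : ℤ, 6 ≤ v → b₀ (u, v) ≠ bKing

theorem Flight.king_unique (h0 : FarSide b₀) (h : Flight W kd p b₀ b n) {u v : ℤ}
    (huv : b (u, v) = bKing) : u = p n ∧ v = -n := by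
  by_cases hv : v ≤ 5
  · by_contra hk
    rcases h.content u v hv hk with h | h | h <;> simp [h] at huv
  · rw [h.high u v (by omega)] at huv
    exact absurd huv (h0.black u v (by omega))

/-- White pieces other than the king are pawns and knights on the near side. -/
theorem Flight.white_near (h0 : FarSide b₀) (h : Flight W kd p b₀ b n) {u v : ℤ} {k : Kind}
    (huv : b (u, v) = some (.white, k)) :
    k = .king ∧ 6 ≤ v ∨ v ≤ 0 ∧ (k = .pawn ∨ k = .knight) := by
  by_cases hv : v ≤ 5
  · right
    have h1 := h.empty u v
    have h2 := h.content u v hv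
    by_cases hk : u = p n ∧ v = -n
    · rw [hk.1, hk.2, h.king] at huv
      simp at huv
    · rw [huv] at h1 h2
      refine ⟨?_, ?_⟩
      · by_contra
        simpa using h1 (by omega) hv
      · rcases h2 hk with h | h | h <;> simp at h <;> simp [h]
  · rw [h.high u v (by omega)] at huv
    exact .inl ⟨h0.white u v (by omega) k huv, by omega⟩

/-- There are no discovered checks, so the moved piece itself attacks the king: an attack by any
other piece would have existed before the move, against `h.safe`. The white king is too far away, a
pawn must have advanced straight into its checking square, and knights are handled by
`knight_cases`. -/
theorem Flight.checks (hp : Path W T kd p) (h : Flight W kd p b₀ b n)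
    (h0 : FarSide b₀) {m : Move}
    (hm : (Position.mk b .white).Legal m) (hc : (b.move m).InCheck .black) :
    Checks kd p b n m ∧ b m.2 = none := by
  obtain ⟨hm, -⟩ := hm
  simp only [h.short.canMove_iff] at hm
  obtain ⟨l, e1, e2, e3⟩ := hm
  rw [(h.short.move m).inCheck_iff] at hc
  obtain ⟨⟨s, s'⟩, ⟨t, t'⟩, k, c1, c2, c3⟩ := hc
  have hsafe := h.safe
  rw [h.short.inCheck_iff] at hsafe
  obtain ⟨⟨m1, m1'⟩, m2, m2'⟩ := m
  simp only at e1 e2 e3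
  -- the move does not capture the king
  have hmk : ¬ (m2 = p n ∧ m2' = -n) := by
    rintro ⟨rfl, rfl⟩
    rcases e3 with ⟨-, e3, -⟩ | ⟨-, e3⟩
    · simp [h.king] at e3
    · exact hsafe ⟨_, _, l, h.king, e1, e3⟩
  have hmk' : ¬ (m1 = p n ∧ m1' = -n) := by
    rintro ⟨rfl, rfl⟩
    simp [h.king] at e1
  simp only [Board.move_apply, Prod.mk.injEq] at c1 c2
  have ht : t = p n ∧ t' = -n := by
    split_ifs at c1
    · simp [e1] at c1
    · exact h.king_unique h0 c1
  obtain ⟨rfl, rfl⟩ := ht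
  have hs : s = m2 ∧ s' = m2' := by
    by_contra hs
    rw [if_neg hs] at c2
    split_ifs at c2
    exact hsafe ⟨_, _, k, h.king, c2, c3⟩
  obtain ⟨rfl, rfl⟩ := hs
  obtain rfl : l = k := by simpa [e1, Color.other] using c2
  have hempty : b (s, s') = none := by
    by_cases hv : s' ≤ 5
    · rcases h.content s s' hv hmk with h | h | h
      · exact h
      · exact absurd h (e2 _)
      · exact absurd h (e2 _)
    · exfalso
      rcases l <;> simp only [Hits, Color.other, Color.forward] at c3 <;> omega
  refine ⟨?_, hempty⟩
  rcases h.white_near h0 e1 with ⟨rfl, hv⟩ | ⟨hv, rfl | rfl⟩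
  · exfalso
    simp only [Hits, reduceCtorEq, false_and, false_or] at c3 e3
    omega
  · simp only [Hits, Color.other, Color.forward] at c3 e3
    obtain ⟨h1, h2⟩ : s = m1 ∧ s' = m1' + 1 := by
      simpa [hempty] using e3
    obtain rfl : m1' = -n - 2 := by omega
    obtain rfl : s' = -n - 1 := by omega
    subst h1
    obtain h1 | h1 : s = p n - 1 ∨ s = p n + 1 := by omega
    · subst h1
      exact .left e1
    · subst h1
      exact .right e1
  · rcases h.knight_cases hp e1 (by omega) e2 (by simpa using e3) c3 with
      ⟨h1, rfl, rfl, rfl, rfl⟩ | ⟨s, h1, h2, h3, rfl, rfl, rfl, rfl⟩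
    · exact .fork h1 e1
    · exact .back s h1 h2 h3 e1

/-- The move of the king along the path. -/
def pathMove (p : ℕ → ℤ) (n : ℕ) : Move := ((p n, -n), (p (n + 1), -n - 1))

theorem Path.near (hp : Path W T kd p) (n : ℕ) : p n - 1 ≤ p (n + 1) ∧ p (n + 1) ≤ p n + 1 := by
  have h1 := (hp.next n).2.2
  cases hk : kd (p n, -n) <;> simp only [hk] at h1 <;> omega

theorem Checks.white {m : Move} (hc : Checks kd p b n m) :
    ∃ k, b m.1 = some (.white, k) ∧ (k = .pawn ∨ k = .knight) := by
  rcases hc with h1 | h1 | ⟨-, h1⟩ | ⟨s, -, -, -, h1⟩ <;> exact ⟨_, h1, by simp⟩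

theorem Flight.move_apply (h : Flight W kd p b₀ b n) {m : Move} (hc : Checks kd p b n m)
    (hm : b m.2 = none) (u v : ℤ) : (b.move m).move (pathMove p n) (u, v) =
      if u = p (n + 1) ∧ v = -n - 1 then bKing else if u = p n ∧ v = -n then none else
      if (u, v) = m.2 then b m.1 else if (u, v) = m.1 then none else b (u, v) := by
  have hK := h.king
  have h1 : (p n, -(n : ℤ)) ≠ m.2 := by
    intro h1
    rw [← h1, hK] at hm
    simp at hm
  have h2 : (p n, -(n : ℤ)) ≠ m.1 := by
    obtain ⟨k, hk, -⟩ := hc.white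
    intro h2
    rw [← h2, hK] at hk
    simp at hk
  simp only [pathMove, Board.move_apply, Prod.mk.injEq]
  rw [if_neg h1, if_neg h2, hK]

/-- Near a fork the path is explicit, and its next square is not a knight's jump away from any of
the three possible squares of the knight. -/
theorem Flight.knight_not_hits (hp : Path W T kd p) (h : Flight W kd p b₀ b n)
    {u v : ℤ} (hk : b (u, v) = wKnight) (hv : v ≤ 5) :
    ¬ Hits (.white, .knight) (u, v) (p (n + 1), -n - 1) := by
  intro h1
  simp only [Hits] at h1
  rcases h.knights _ _ hk hv with h3 | ⟨s, hs, h3⟩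
  · obtain ⟨s, hs, rfl, rfl⟩ :=
      hp.knights u v h3 (n + 1) (by omega) (by omega) (by omega) (by omega)
    obtain h5 | rfl | h5 : n + 1 ≤ s ∨ n = s ∨ s + 1 ≤ n := by omega
    · have := hp.before s (n + 1) hs h5
      omega
    · have := hp.step n hs
      omega
    · have := hp.after_left s (n + 1) hs
      have := hp.after_right s (n + 1) hs
      have := hp.step s hs
      omega
  · have := hp.after_left s (n + 1) hs
    have := hp.after_right s (n + 1) hs
    have := hp.step s hs
    omega

/-- A track square lacks the hole on its lower right only if it is reached by a drop; there the
checking pawn vacates that square. -/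
theorem Path.right_hole (hS : Sea W T kd) (hp : Path W T kd p) (n : ℕ)
    (h : kd (p n, -(n : ℤ)) ≠ .drop) : W (p (n + 1) + 1, -(n : ℤ) - 2) = none := by
  have hT := hp.track n
  obtain ⟨hT', -, h1⟩ := hp.next n
  rcases hk : kd (p n, -n) <;> simp only [hk] at h1
  · rw [h1] at hT' ⊢
    simpa using hS.left_next _ _ hT hk hT'
  · rw [h1] at hT' ⊢
    have := hS.right_next _ _ hT hk hT'
    rwa [show p n + 2 = p n + 1 + 1 by ring] at this
  · exact absurd hk h
  · rcases h1 with h1 | h1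
    · rw [h1]
      simpa using hS.fork_left_next _ _ hT hk
    · rw [h1]
      have := hS.fork_right_next _ _ hT hk
      rwa [show p n + 2 = p n + 1 + 1 by ring] at this

theorem Path.left_hole (hS : Sea W T kd) (hp : Path W T kd p) (n : ℕ) :
    W (p (n + 1) - 1, -(n : ℤ) - 2) = none := by
  have := hS.hole _ _ (hp.next n).1
  rwa [show -(n : ℤ) - 1 - 1 = -n - 2 by ring] at this

/-- On the left there is no pawn, because the next track square has its hole there, and the knight's
second check can occur only at a left step. -/
theorem Flight.checks_drop (hS : Sea W T kd) (hp : Path W T kd p) (h : Flight W kd p b₀ b n)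
    {m : Move} (hc : Checks kd p b n m) (hd : kd (p n, -n) = .drop) :
    m = ((p n + 1, -(n : ℤ) - 2), (p n + 1, -(n : ℤ) - 1)) := by
  have hn : p (n + 1) = p n := by
    simpa [hd] using (hp.next n).2.2
  have hl := hp.left_hole hS n
  rcases hc with h1 | h1 | ⟨h1, -⟩ | ⟨s, rfl, hs, hs', -⟩
  · rw [h.deep _ _ le_rfl, ← hn, hl] at h1
    simp at h1
  · rfl
  · simp [hd] at h1
  · have h1 := hp.after_left s (s + 2) hs hs' (by omega) (by omega)
    have h2 := hp.after_left s (s + 2 + 1) hs hs' (by omega) (by omega)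
    push_cast at h1 h2
    omega

/-- After a check the king can continue along the path. -/
theorem Flight.evade_safe (hS : Sea W T kd) (hp : Path W T kd p) (h : Flight W kd p b₀ b n)
    (h0 : FarSide b₀) {m : Move} (hc : Checks kd p b n m) (hm : b m.2 = none) :
    ¬ ((b.move m).move (pathMove p n)).InCheck .black := by
  rw [((h.short.move _).move _).inCheck_iff]
  rintro ⟨⟨s, s'⟩, ⟨t, t'⟩, k, c1, c2, c3⟩
  have hmv := h.move_apply hc hm
  obtain ⟨k', hk', hk''⟩ := hc.white
  have ht : t = p (n + 1) ∧ t' = -n - 1 := by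
    rw [hmv] at c1
    by_contra ht
    rw [if_neg ht] at c1
    split_ifs at c1 with h1 h2 h3
    · simp [hk'] at c1
    · exact h1 (h.king_unique h0 c1)
  obtain ⟨rfl, rfl⟩ := ht
  rw [hmv] at c2
  split_ifs at c2 with h1 h2 h3 h4
  · simp [Color.other] at c2
  -- The piece that has just given check does not attack the next square of the path.
  · clear hmv c1 hk' hk''
    simp only [Color.other] at c2 c3
    have hl := hp.near n
    rcases hc with h5 | h5 | ⟨h5, h6⟩ | ⟨r, rfl, hs, hs', h5⟩ <;>
      obtain ⟨h7, h8⟩ := Prod.mk.inj h3 <;> subst h7 h8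
    · obtain rfl : Kind.pawn = k := by simpa [h5] using c2
      simp only [Hits, Color.forward] at c3
      omega
    · obtain rfl : Kind.pawn = k := by simpa [h5] using c2
      simp only [Hits, Color.forward] at c3
      omega
    · obtain rfl : Kind.knight = k := by simpa [h6] using c2
      have := hp.step n h5
      simp only [Hits] at c3
      omega
    · obtain rfl : Kind.knight = k := by simpa [h5] using c2
      have := hp.after_left r (r + 2 + 1) hs hs' (by omega) (by omega)
      simp only [Hits] at c3
      omega
  · simp only [Color.other] at c2 c3
    rcases h.white_near h0 c2 with ⟨rfl, hv⟩ | ⟨hv, rfl | rfl⟩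
    · simp only [Hits] at c3
      omega
    · simp only [Hits, Color.forward] at c3
      -- A pawn attacking the next square stands in a row that was untouched before White's check.
      -- Its two possible squares are holes, except the right one at a drop, and that one has just
      -- been vacated by the checking pawn.
      obtain rfl : s' = -n - 2 := by omega
      rw [h.deep _ _ le_rfl] at c2
      obtain rfl | rfl : s = p (n + 1) - 1 ∨ s = p (n + 1) + 1 := by omega
      · simp [hp.left_hole hS n] at c2
      · by_cases hd : kd (p n, -n) = .drop
        · rw [h.checks_drop hS hp hc hd] at h4
          have hn : p (n + 1) = p n := by
            simpa [hd] using (hp.next n).2.2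
          simp [hn] at h4
        · simp [hp.right_hole hS n hd] at c2
    · exact h.knight_not_hits hp c2 (by omega) c3

theorem Flight.evade_legal (hS : Sea W T kd) (hp : Path W T kd p) (h : Flight W kd p b₀ b n)
    (h0 : FarSide b₀) {m : Move} (hc : Checks kd p b n m) (hm : b m.2 = none) :
    (Position.mk (b.move m) .black).Legal (pathMove p n) := by
  refine ⟨?_, h.evade_safe hS hp h0 hc hm⟩
  obtain ⟨k', hk', -⟩ := hc.white
  have hK := h.king
  have h1 : (p n, -(n : ℤ)) ≠ m.2 := by
    intro h1
    rw [← h1, hK] at hm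
    simp at hm
  have h2 : (p n, -(n : ℤ)) ≠ m.1 := by
    intro h2
    rw [← h2, hK] at hk'
    simp at hk'
  have h3 := hp.near n
  rw [(h.short.move m).canMove_iff]
  refine ⟨.king, ?_, ?_, .inr ⟨by simp, ?_⟩⟩
  · rw [Board.move_apply, pathMove, if_neg h1, if_neg h2, hK]
  · intro l
    rw [Board.move_apply, pathMove]
    have := h.content (p (n + 1)) (-n - 1) (by omega) (by omega)
    split_ifs
    · simp [hk']
    · simp
    · rcases this with h | h | h <;> simp [h]
  · simp only [Hits, pathMove]
    omega

theorem Flight.evade (hS : Sea W T kd) (hp : Path W T kd p) (h : Flight W kd p b₀ b n)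
    (h0 : FarSide b₀) {m : Move} (hc : Checks kd p b n m) (hm : b m.2 = none) :
    Flight W kd p b₀ ((b.move m).move (pathMove p n)) (n + 1) := by
  have hmv := h.move_apply hc hm
  have hsafe := h.evade_safe hS hp h0 hc hm
  have hs := (h.short.move m).move (pathMove p n)
  obtain ⟨k, hk, hk'⟩ := hc.white
  have hm1 : m.1.2 ≤ 0 := by
    rcases hc with h1 | h1 | ⟨-, h1⟩ | ⟨s, -, -, -, h1⟩ <;> simp only <;> omega
  have hm2 : m.2.2 ≤ 0 := by
    rcases hc with h1 | h1 | ⟨-, h1⟩ | ⟨s, -, -, -, h1⟩ <;> simp only <;> omega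
  have hdeep : -(n : ℤ) - 2 ≤ m.1.2 ∧ -(n : ℤ) - 2 ≤ m.2.2 := by
    rcases hc with h1 | h1 | ⟨-, h1⟩ | ⟨s, rfl, -, -, h1⟩ <;> dsimp only <;> omega
  -- A pawn survives the round unless the king captures it or it is one of the two pawns able to
  -- give check.
  have keep : ∀ u v : ℤ, b (u, v) = wPawn → ¬ (u = p (n + 1) ∧ v = -n - 1) →
      ¬ (v = -n - 2 ∧ (u = p n - 1 ∨ u = p n + 1)) →
      ((b.move m).move (pathMove p n)) (u, v) = wPawn := by
    intro u v h1 h2 h3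
    rw [hmv, if_neg h2, if_neg, if_neg, if_neg, h1]
    · intro h4
      rw [h4] at h1
      rcases hc with h5 | h5 | ⟨h5, h6⟩ | ⟨r, -, -, -, h5⟩ <;> obtain ⟨h7, h8⟩ := Prod.mk.inj h4
      · exact h3 ⟨h8, .inl h7⟩
      · exact h3 ⟨h8, .inr h7⟩
      · simp [h6] at h1
      · simp [h5] at h1
    · intro h4
      rw [h4, hm] at h1
      simp at h1
    · rintro ⟨rfl, rfl⟩
      simp [h.king] at h1
  -- After a left turn at a fork comes a drop, where the advance of exactly this pawn is the only
  -- check.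
  have hpawn₆ : ∀ s : ℕ, n = s + 1 → kd (p s, -s) = .fork → p (s + 1) = p s - 1 →
      (b.move m).move (pathMove p n) (p s, -s - 2) = wPawn := by
    rintro s rfl h1 h2
    have h3 := hS.kd_fork_left _ _ (hp.track s) h1
    have h4 := h.checks_drop hS hp hc (by rw [h2, ← h3]; push_cast; ring_nf)
    have h5 : b m.1 = wPawn := by
      rcases hc with h5 | h5 | ⟨-, h5⟩ | ⟨r, -, -, -, h5⟩ <;> simp at h4
      · omega
      · exact h5
      · omega
      · omega
    have h6 := hp.after_left s (s + 1 + 1) h1 h2 (by omega) (by omega)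
    rw [hmv, if_neg (by push_cast at h6; omega), if_neg (by omega), if_pos, h5]
    rw [h4, h2]
    simp
    omega
  generalize (b.move m).move (pathMove p n) = b' at *
  refine ⟨hs, ?_, hsafe, ?_, ?_, ?_, ?_, ?_, ?_, ?_, ?_, ?_, ?_, ?_⟩
  · rw [hmv, if_pos ⟨rfl, by push_cast; ring⟩]
  · intro u v huv
    rw [hmv, if_neg (by omega), if_neg (by omega), if_neg, if_neg, h.high u v huv] <;> intro h4
    · rw [← h4] at hm1
      omega
    · rw [← h4] at hm2
      omega
  · intro u v hu hv
    rw [hmv, if_neg (by omega), if_neg (by omega), if_neg, if_neg, h.empty u v hu hv] <;> intro h4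
    · rw [← h4] at hm1
      omega
    · rw [← h4] at hm2
      omega
  · intro u v hv huv
    push_cast at huv
    have := h.content u v hv
    rw [hmv, if_neg (by omega)]
    split_ifs with h1 h2 h3
    · simp
    · rcases hk' with rfl | rfl <;> simp [hk]
    · simp
    · exact this h1
  · intro u v huv
    push_cast at huv
    rw [hmv, if_neg (by omega), if_neg (by omega), if_neg, if_neg, h.deep u v (by omega)] <;>
      intro h4 <;> rw [← h4] at hdeep <;> omega
  · intro u v huv hv
    rw [hmv] at huv
    split_ifs at huv with h1 h2 h3 h4
    · simp at huv
    · right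
      rcases hc with h5 | h5 | ⟨h5, h6⟩ | ⟨r, rfl, h6, h7, h5⟩ <;> obtain ⟨h8, h9⟩ := Prod.mk.inj h3
      · simp [h5] at huv
      · simp [h5] at huv
      · exact ⟨n, h5, .inl ⟨le_rfl, h8, h9⟩⟩
      · exact ⟨r, h6, .inr ⟨le_rfl, h7, h8, h9⟩⟩
    · rcases h.knights u v huv hv with h5 | ⟨s, h5, h6⟩
      · exact .inl h5
      · exact .inr ⟨s, h5, by omega⟩
  · intro s h1 h2
    have := hp.before s n h1
    have := hp.before s (n + 1) h1
    exact keep _ _ (h.pawn₁ s h1 (by omega)) (by omega) (by omega)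
  · intro s h1 h2
    exact keep _ _ (h.pawn₂ s h1 (by omega)) (by omega)
      (by rintro ⟨h3, h4⟩; obtain rfl : n = s := by omega
          omega)
  · intro s h1 h2 h3
    have h4 := hp.after_left s (n + 1) h1 h2
    exact keep _ _ (h.pawn₃ s h1 h2 (by omega)) (by push_cast at h4; omega)
      (by rintro ⟨h3, h4⟩; obtain rfl : n = s + 1 := by omega
          omega)
  · intro s h1 h2 h3
    have h4 := hp.after_left s (n + 1) h1 h2
    exact keep _ _ (h.pawn₄ s h1 h2 (by omega)) (by push_cast at h4; omega)
      (by rintro ⟨h3, h4⟩; obtain rfl : n = s := by omega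
          omega)
  · intro s h1 h2 h3
    have h4 := hp.after_left s (n + 1) h1 h2
    exact keep _ _ (h.pawn₅ s h1 h2 (by omega)) (by push_cast at h4; omega)
      (by rintro ⟨h3, h4⟩; obtain rfl : n = s + 1 := by omega
          omega)
  · intro s h1 h2 h3 h4
    by_cases h5 : n = s + 1
    · exact hpawn₆ s h5 h1 h2
    · exact keep _ _ (h.pawn₆ s h1 h2 (by omega) (by omega)) (by omega) (by omega)

end InfiniteChess

namespace InfiniteChess

/-! The symmetry that exchanges the two players. -/

theorem Color.other_other (c : Color) : c.other.other = c := by cases c <;> rfl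

def flipSquare (s : Square) : Square := (s.1, 10 - s.2)

def flipMove (m : Move) : Move := (flipSquare m.1, flipSquare m.2)

def flipPiece (P : Piece) : Piece := (P.1.other, P.2)

def Board.flip (B : Board) : Board := fun s => (B (flipSquare s)).map flipPiece

def Position.flip (p : Position) : Position := ⟨p.board.flip, p.turn.other⟩

@[simp] theorem flipSquare_flipSquare (s : Square) : flipSquare (flipSquare s) = s := by
  simp [flipSquare]

@[simp] theorem flipMove_flipMove (m : Move) : flipMove (flipMove m) = m := by
  simp [flipMove]

theorem flipSquare_eq_iff {s t : Square} : flipSquare s = t ↔ s = flipSquare t := by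
  constructor <;> rintro rfl <;> simp

@[simp] theorem flipPiece_flipPiece (P : Piece) : flipPiece (flipPiece P) = P := by
  simp [flipPiece, Color.other_other]

@[simp] theorem Board.flip_flip (B : Board) : B.flip.flip = B := by
  funext s
  simp [Board.flip, Function.comp_def]

@[simp] theorem Position.flip_flip (p : Position) : p.flip.flip = p := by
  simp [Position.flip, Color.other_other]

theorem Board.flip_eq_some {B : Board} {s : Square} {c : Color} {k : Kind} :
    B.flip s = some (c, k) ↔ B (flipSquare s) = some (c.other, k) := by
  simp only [Board.flip, Option.map_eq_some_iff, flipPiece]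
  constructor
  · rintro ⟨⟨d, l⟩, h1, h2⟩
    simp only [Prod.mk.injEq] at h2
    rw [h1, ← h2.1, ← h2.2, Color.other_other]
  · intro h
    exact ⟨_, h, by simp [Color.other_other]⟩

theorem Board.flip_eq_none {B : Board} {s : Square} : B.flip s = none ↔ B (flipSquare s) = none := by
  simp [Board.flip]

theorem Board.Short.flip {B : Board} (h : B.Short) : B.flip.Short := by
  rintro s ⟨c, k⟩ h1
  exact h _ (c.other, k) (Board.flip_eq_some.1 h1)

theorem Board.flip_move (B : Board) (m : Move) : (B.move m).flip = B.flip.move (flipMove m) := by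
  funext s
  simp only [Board.flip, Board.move_apply, flipMove, flipSquare_eq_iff, flipSquare_flipSquare]
  split_ifs <;> rfl

theorem hits_flip {c : Color} {k : Kind} {s t : Square} :
    Hits (c.other, k) (flipSquare s) (flipSquare t) ↔ Hits (c, k) s t := by
  obtain ⟨a, b⟩ := s
  obtain ⟨x, y⟩ := t
  cases k <;> cases c <;> simp only [Hits, flipSquare, Color.other, Color.forward] <;> omega

theorem Board.Short.inCheck_flip {B : Board} (h : B.Short) (c : Color) :
    B.flip.InCheck c ↔ B.InCheck c.other := by
  rw [h.inCheck_iff, h.flip.inCheck_iff]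
  constructor
  · rintro ⟨s, t, k, h1, h2, h3⟩
    exact ⟨_, _, k, Board.flip_eq_some.1 h1, Board.flip_eq_some.1 h2, hits_flip.2 h3⟩
  · rintro ⟨s, t, k, h1, h2, h3⟩
    refine ⟨flipSquare s, flipSquare t, k, Board.flip_eq_some.2 (by simpa using h1),
      Board.flip_eq_some.2 (by simpa using h2), ?_⟩
    rw [← hits_flip]
    simpa using h3

theorem Board.Short.legal_flip {B : Board} (h : B.Short) {c : Color} {m : Move}
    (hm : (Position.mk B c).Legal m) : (Position.mk B.flip c.other).Legal (flipMove m) := by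
  obtain ⟨h1, h2⟩ := hm
  simp only [h.canMove_iff] at h1 h2
  refine ⟨?_, ?_⟩
  · simp only [h.flip.canMove_iff]
    obtain ⟨k, e1, e2, e3⟩ := h1
    refine ⟨k, Board.flip_eq_some.2 (by simpa [flipMove, Color.other_other] using e1),
      fun l => ?_, ?_⟩
    · rw [ne_eq, Board.flip_eq_some]
      simpa [flipMove, Color.other_other] using e2 l
    · simp only [ne_eq, Board.flip_eq_none, flipMove, hits_flip, flipSquare_flipSquare]
      refine e3.imp ?_ id
      rintro ⟨e3, e4, e5, e6⟩
      refine ⟨e3, e4, e5, ?_⟩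
      cases c <;> simp only [flipSquare, Color.forward, Color.other] at * <;> omega
  · simp only [← Board.flip_move, (h.move m).inCheck_flip, Color.other_other]
    exact h2

namespace Position

theorem after_concat (p : Position) (h : List Move) (m : Move) :
    p.after (h ++ [m]) = (p.after h).move m := by
  simp [after]

theorem flip_after (p : Position) (h : List Move) :
    (p.after h).flip = p.flip.after (h.map flipMove) := by
  induction h using List.reverseRecOn with
  | nil => rfl
  | append_singleton h m ih =>
    rw [List.map_append, List.map_singleton, after_concat, after_concat, ← ih]
    simp [flip, move, Board.flip_move]

theorem short_after {p : Position} (hp : p.board.Short) (h : List Move) :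
    (p.after h).board.Short := by
  induction h using List.reverseRecOn with
  | nil => exact hp
  | append_singleton h m ih =>
    rw [after_concat]
    exact ih.move m

theorem legal_flip {p : Position} (hp : p.board.Short) {m : Move} :
    p.flip.Legal (flipMove m) ↔ p.Legal m := by
  constructor
  · intro h
    simpa [Position.flip, Color.other_other] using Board.Short.legal_flip hp.flip h
  · exact Board.Short.legal_flip hp

/-- The strategy of the other player obtained by exchanging the players. -/
def flipStrategy (τ : Strategy) : Strategy := fun h => flipMove (τ (h.map flipMove))

@[simp] theorem flipStrategy_flipStrategy (τ : Strategy) : flipStrategy (flipStrategy τ) = τ := by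
  funext h
  simp [flipStrategy, Function.comp_def]

theorem isPlay_concat {p : Position} {h : List Move} {m : Move} :
    p.IsPlay (h ++ [m]) ↔ p.IsPlay h ∧ (p.after h).Legal m := by
  simp only [IsPlay, List.prefix_concat_iff]
  constructor
  · intro H
    exact ⟨fun g m hg => H g m (.inr hg), H h m (.inl rfl)⟩
  · rintro ⟨H, H'⟩ g m' (hg | hg)
    · obtain ⟨rfl, hm⟩ := List.append_inj' hg rfl
      simp only [List.cons.injEq, and_true] at hm
      rwa [hm]
    · exact H g m' hg

theorem follows_concat {p : Position} {c : Color} {τ : Strategy} {h : List Move} {m : Move} :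
    p.Follows c τ (h ++ [m]) ↔
      p.Follows c τ h ∧ (p.after h).Legal m ∧ ((p.after h).turn = c → m = τ h) := by
  simp only [Follows, isPlay_concat, List.prefix_concat_iff]
  constructor
  · rintro ⟨⟨H1, H2⟩, H3⟩
    exact ⟨⟨H1, fun g m hg => H3 g m (.inr hg)⟩, H2, H3 h m (.inl rfl)⟩
  · rintro ⟨⟨H1, H2⟩, H3, H4⟩
    refine ⟨⟨H1, H3⟩, ?_⟩
    rintro g m' (hg | hg)
    · obtain ⟨rfl, hm⟩ := List.append_inj' hg rfl
      simp only [List.cons.injEq, and_true] at hm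
      rwa [hm]
    · exact H2 g m' hg

theorem follows_nil (p : Position) (c : Color) (τ : Strategy) : p.Follows c τ [] := by
  constructor <;> intro g m h <;> simp at h

theorem Follows.flip {p : Position} (hp : p.board.Short) {c : Color} {τ : Strategy}
    {h : List Move} (H : p.Follows c τ h) :
    p.flip.Follows c.other (flipStrategy τ) (h.map flipMove) := by
  induction h using List.reverseRecOn with
  | nil => exact follows_nil _ _ _
  | append_singleton h m ih =>
    rw [follows_concat] at H
    rw [List.map_append, List.map_singleton, follows_concat, ← flip_after]
    refine ⟨ih H.1, (legal_flip (short_after hp h)).2 H.2.1, fun ht => ?_⟩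
    rw [H.2.2]
    · simp [flipStrategy, Function.comp_def]
    · have := congrArg Color.other ht
      simpa [Position.flip, Color.other_other] using this

theorem follows_flip {p : Position} (hp : p.board.Short) {c : Color} {τ : Strategy}
    {h : List Move} : p.flip.Follows c.other τ h ↔
      p.Follows c (flipStrategy τ) (h.map flipMove) := by
  constructor
  · intro H
    simpa [Color.other_other] using H.flip (p := p.flip) hp.flip
  · intro H
    simpa [Function.comp_def] using H.flip hp

theorem IsStrategy.flip {p : Position} (hp : p.board.Short) {c : Color} {τ : Strategy}
    (H : p.IsStrategy c τ) : p.flip.IsStrategy c.other (flipStrategy τ) := by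
  intro h h1 h2 ⟨m, h3⟩
  rw [follows_flip hp, flipStrategy_flipStrategy] at h1
  have e : p.flip.after h = (p.after (h.map flipMove)).flip := by
    rw [flip_after]
    simp [Function.comp_def]
  have hs := short_after hp (h.map flipMove)
  rw [e] at h2 h3 ⊢
  have := congrArg Color.other h2
  refine (legal_flip hs).2 (H _ h1 (by simpa [Position.flip, Color.other_other] using this)
    ⟨flipMove m, ?_⟩)
  rw [← legal_flip hs]
  simpa using h3

theorem Checkmated.flip {p : Position} (hp : p.board.Short) {c : Color} (H : p.Checkmated c) :
    p.flip.Checkmated c.other := by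
  obtain ⟨h1, h2, h3⟩ := H
  refine ⟨by simp [Position.flip, h1], ?_, fun m hm => h3 (flipMove m) ?_⟩
  · rw [Position.flip, hp.inCheck_flip, Color.other_other]
    exact h2
  · rw [← legal_flip hp]
    simpa using hm

theorem Defeats.flip {p : Position} (hp : p.board.Short) {c : Color} {τ σ : Strategy}
    (H : p.Defeats c τ σ) : p.flip.Defeats c.other (flipStrategy τ) (flipStrategy σ) := by
  obtain ⟨h, h1, h2, h3⟩ := H
  refine ⟨h.map flipMove, h1.flip hp, h2.flip hp, ?_⟩
  rw [← flip_after]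
  exact h3.flip (short_after hp h)

theorem LegalAgainst.flip {p : Position} (hp : p.board.Short) {c : Color} {τ σ : Strategy}
    (H : p.LegalAgainst c τ σ) : p.flip.LegalAgainst c.other (flipStrategy τ) (flipStrategy σ) := by
  intro h h1 h1' h2 ⟨m, h3⟩
  rw [follows_flip hp, flipStrategy_flipStrategy] at h1 h1'
  have e : p.flip.after h = (p.after (h.map flipMove)).flip := by
    rw [flip_after]
    simp [Function.comp_def]
  have hs := short_after hp (h.map flipMove)
  rw [e] at h2 h3 ⊢
  have := congrArg Color.other h2
  refine (legal_flip hs).2 (H _ h1 h1' (by simpa [Position.flip, Color.other_other] using this)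
    ⟨flipMove m, ?_⟩)
  rw [← legal_flip hs]
  simpa using h3

theorem IsDrawing.flip {p : Position} (hp : p.board.Short) {c : Color} {τ : Strategy}
    (H : p.IsDrawing c τ) : p.flip.IsDrawing c.other (flipStrategy τ) := by
  refine ⟨H.1.flip hp, fun σ h1 h2 => H.2 (flipStrategy σ) ?_ ?_⟩
  · simpa [Color.other_other] using h1.flip (p := p.flip) hp.flip
  · simpa [Color.other_other] using h2.flip (p := p.flip) hp.flip

theorem isDraw_of_isDrawing {p : Position} (H : ∀ c, ∃ τ, p.IsDrawing c τ) : p.IsDraw := by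
  refine fun c => ⟨?_, H c⟩
  rintro ⟨τ, h1, h2⟩
  obtain ⟨δ, h3, h4⟩ := H c.other
  refine h4 τ ?_ ?_
  · rwa [Color.other_other]
  · rw [Color.other_other]
    exact h2 δ h3

theorem ComputableWin.flip {p : Position} (hp : p.board.Short)
    (hc : ∀ τ : Strategy, Computable τ → Computable (flipStrategy τ)) {c : Color}
    (H : p.ComputableWin c) : p.flip.ComputableWin c.other := by
  obtain ⟨τ, h1, h2, h3⟩ := H
  refine ⟨flipStrategy τ, h1.flip hp, hc τ h2, fun σ h4 h5 => ?_⟩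
  have := (h3 (flipStrategy σ) (hc σ h4) ?_).flip hp
  · simpa using this
  · simpa [Color.other_other] using h5.flip (p := p.flip) hp.flip

/-- A strategy that maintains an invariant. -/
theorem Follows.invariant {p : Position} {c : Color} {τ : Strategy} (I J : List Move → Prop)
    (h₁ : p.turn = c → I []) (h₂ : p.turn ≠ c → J [])
    (hI : ∀ h, I h → (p.after h).turn = c → J (h ++ [τ h]))
    (hJ : ∀ h m, J h → (p.after h).turn ≠ c → (p.after h).Legal m → I (h ++ [m]))
    {h : List Move} (H : p.Follows c τ h) :
    ((p.after h).turn = c → I h) ∧ ((p.after h).turn ≠ c → J h) := by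
  induction h using List.reverseRecOn with
  | nil => exact ⟨h₁, h₂⟩
  | append_singleton h m ih =>
    rw [follows_concat] at H
    have ih := ih H.1
    rw [after_concat]
    by_cases ht : (p.after h).turn = c
    · refine ⟨fun h3 => ?_, fun _ => ?_⟩
      · exfalso
        rw [move, ht] at h3
        cases c <;> simp [Color.other] at h3
      · rw [H.2.2 ht]
        exact hI h (ih.1 ht) ht
    · refine ⟨fun _ => hJ h m (ih.2 ht) ht H.2.1, fun h3 => ?_⟩
      exfalso
      apply h3
      rw [move]
      generalize (p.after h).turn = d at ht
      cases c <;> cases d <;> simp [Color.other] at ht ⊢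

end Position
end InfiniteChess

/-! ### The symmetric board -/

namespace InfiniteChess

/-- The board with the field `W` and, opposite to it, its mirror image. -/
def fullBoard (W : Board) : Board := fun s => if s.2 ≤ 5 then W s else W.flip s

variable {W b₀ b : Board} {T : Square → Prop} {kd : Square → Step} {p : ℕ → ℤ} {n : ℕ}

theorem fullBoard_low {x y : ℤ} (h : y ≤ 5) : fullBoard W (x, y) = W (x, y) := if_pos h

theorem fullBoard_high {x y : ℤ} (h : 6 ≤ y) : fullBoard W (x, y) = W.flip (x, y) :=
  if_neg (by simp; omega)

namespace Sea

theorem white (hS : Sea W T kd) {x y : ℤ} (hy : y ≤ 5) {k : Kind}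
    (h : W (x, y) = some (.white, k)) : k = .pawn ∨ k = .knight ∧ y ≤ -3 := by
  by_cases hk : (x, y) = ((0, 0) : Square)
  · rw [hk, hS.king] at h
    simp at h
  · have h' := hS.knight_deep x y
    rcases hS.content x y hy hk with h1 | h1 | h1 <;> rw [h1] at h <;> simp at h
    · exact .inl h.symm
    · exact .inr ⟨h.symm, h' h1⟩

theorem black (hS : Sea W T kd) {x y : ℤ} (hy : y ≤ 5) {k : Kind}
    (h : W (x, y) = some (.black, k)) : k = .king ∧ x = 0 ∧ y = 0 := by
  by_cases hk : (x, y) = ((0, 0) : Square)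
  · rw [hk, hS.king] at h
    simp at h hk
    exact ⟨h.symm, hk⟩
  · rcases hS.content x y hy hk with h1 | h1 | h1 <;> rw [h1] at h <;> simp at h

/-- The axis of the mirror is row 5. The definition treats it as part of the lower half, which is
harmless because it is empty. -/
theorem full_flip (hS : Sea W T kd) : (fullBoard W).flip = fullBoard W := by
  funext ⟨x, y⟩
  rw [Board.flip, flipSquare]
  obtain h | rfl | h : y < 5 ∨ y = 5 ∨ 5 < y := by omega
  · rw [fullBoard_high (by dsimp only; omega), fullBoard_low (by omega)]
    simp [Board.flip, flipSquare, Function.comp_def]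
  · rw [fullBoard_low (by norm_num), fullBoard_low (by norm_num)]
    simp [hS.surface x 5]
  · rw [fullBoard_low (by dsimp only; omega), fullBoard_high (by omega)]
    simp [Board.flip, flipSquare]

theorem full_short (hS : Sea W T kd) : (fullBoard W).Short := by
  have low : ∀ x y c k, y ≤ 5 → fullBoard W (x, y) = some (c, k) → k.Short := by
    intro x y c k hy h
    rw [fullBoard_low hy] at h
    cases c
    · rcases hS.white hy h with rfl | ⟨rfl, -⟩ <;> trivial
    · obtain ⟨rfl, -⟩ := hS.black hy h
      trivial
  rintro ⟨x, y⟩ ⟨c, k⟩ h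
  by_cases hy : y ≤ 5
  · exact low x y c k hy h
  · rw [← hS.full_flip, Board.flip_eq_some] at h
    exact low _ _ _ _ (by omega) h

theorem full_black_king (hS : Sea W T kd) {x y : ℤ} (h : fullBoard W (x, y) = bKing) :
    x = 0 ∧ y = 0 := by
  by_cases hy : y ≤ 5
  · rw [fullBoard_low hy] at h
    exact (hS.black hy h).2
  · rw [← hS.full_flip, Board.flip_eq_some, flipSquare, fullBoard_low (by dsimp only; omega)] at h
    rcases hS.white (by omega) h with h | ⟨h, -⟩ <;> simp at h

/-- The two squares from which a white pawn could attack the king are holes, and the knights stand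
at least three rows below him. -/
theorem full_black_safe (hS : Sea W T kd) : ¬ (fullBoard W).InCheck .black := by
  rw [hS.full_short.inCheck_iff]
  rintro ⟨⟨s, s'⟩, ⟨t, t'⟩, k, h1, h2, h3⟩
  obtain ⟨rfl, rfl⟩ := hS.full_black_king h1
  have hs : s' ≤ 5 := by
    cases k <;> simp only [Hits, Color.other, Color.forward] at h3 <;> omega
  rw [fullBoard_low hs] at h2
  rcases hS.white hs h2 with rfl | ⟨rfl, h4⟩
  · simp only [Hits, Color.other, Color.forward] at h3
    obtain rfl : s' = -1 := by omega
    obtain rfl | rfl : s = -1 ∨ s = 1 := by omega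
    · have := hS.hole _ _ hS.start
      simp at this
      simp [this] at h2
    · simp [hS.hole_start] at h2
  · simp only [Hits] at h3
    omega

theorem full_regular (hS : Sea W T kd) : (fullBoard W).Regular := by
  have hb : (∀ s t : Square, fullBoard W s = bKing → fullBoard W t = bKing → s = t) := by
    rintro ⟨x, y⟩ ⟨u, v⟩ h1 h2
    obtain ⟨rfl, rfl⟩ := hS.full_black_king h1
    obtain ⟨rfl, rfl⟩ := hS.full_black_king h2
    rfl
  intro c
  cases c
  · refine ⟨fun s t h1 h2 => ?_, ?_⟩
    · rw [← hS.full_flip, Board.flip_eq_some] at h1 h2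
      simpa using congrArg flipSquare (hb _ _ h1 h2)
    · rw [← hS.full_flip, hS.full_short.inCheck_flip]
      exact hS.full_black_safe
  · exact ⟨hb, hS.full_black_safe⟩

theorem huntStart (hS : Sea W T kd) : HuntStart W (fullBoard W) where
  short := hS.full_short
  low _ _ h := fullBoard_low h
  high x y h h' := by
    have := hS.full_black_king h'
    omega
  safe := (hS.full_regular .white).2

theorem farSide (hS : Sea W T kd) : FarSide (fullBoard W) where
  white u v hv k h := by
    rw [← hS.full_flip, Board.flip_eq_some, flipSquare, fullBoard_low (by dsimp only; omega)] at h
    exact (hS.black (by omega) h).1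
  black u v hv h' := by
    have := hS.full_black_king h'
    omega

theorem flight (hS : Sea W T kd) (hp : Path W T kd p) :
    Flight W kd p (fullBoard W) (fullBoard W) 0 where
  short := hS.full_short
  king := by
    rw [hp.zero]
    exact (fullBoard_low (by norm_num)).trans hS.king
  safe := hS.full_black_safe
  high _ _ _ := rfl
  empty u v h1 h2 := by rw [fullBoard_low h2, hS.surface _ _ h1 h2]
  content u v h1 h2 := by
    rw [fullBoard_low h1]
    rw [hp.zero] at h2
    exact hS.content u v h1 (by simpa using h2)
  deep u v h := fullBoard_low (by push_cast at h; omega)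
  knights u v h1 h2 := by
    rw [fullBoard_low h2] at h1
    exact .inl h1
  pawn₁ s h _ := by rw [fullBoard_low (by omega), hp.pawn₁ s h]
  pawn₂ s h _ := by rw [fullBoard_low (by omega), hp.pawn₂ s h]
  pawn₃ s h _ _ := by rw [fullBoard_low (by omega), hp.pawn₃ s h]
  pawn₄ s h _ _ := by rw [fullBoard_low (by omega), hp.pawn₄ s h]
  pawn₅ s h _ _ := by rw [fullBoard_low (by omega), hp.pawn₅ s h]
  pawn₆ s h _ h1 _ := by omega

/-- The squares around the start are guarded. -/
theorem start_guarded (hS : Sea W T kd) {u v : ℤ} (h : Hits (.black, .king) (0, 0) (u, v)) :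
    ∃ s t, t ≤ 0 ∧ ¬ (s = u ∧ t = v) ∧ W (s, t) = wPawn ∧ Hits (.white, .pawn) (s, t) (u, v) := by
  have h1 := hS.down _ _ hS.start
  have h2 := hS.drop₃ _ _ hS.start hS.kd_start
  have h3 := hS.drop₄ _ _ hS.start hS.kd_start
  have h4 := hS.pawn_start
  simp only [Hits, Color.forward] at h ⊢
  obtain hv | hv | hv : v = 1 ∨ v = 0 ∨ v = -1 := by omega
  · by_cases hu : u = 1
    · exact ⟨2, 0, by omega, by omega, h4 _ (by omega) (by omega) (by omega), by omega, by omega⟩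
    · exact ⟨u - 1, 0, by omega, by omega, h4 _ (by omega) (by omega) (by omega), by omega,
        by omega⟩
  · exact ⟨0, 0 - 1, by omega, by omega, h1, by omega, by omega⟩
  · by_cases hu : u = 0
    · exact ⟨0 + 1, 0 - 2, by omega, by omega, h3, by omega, by omega⟩
    · exact ⟨0, 0 - 2, by omega, by omega, h2, by omega, by omega⟩

end Sea

/-- When white stops giving check, the hunt of his own king can begin. -/
theorem Flight.counter (hS : Sea W T kd) (h : Flight W kd p (fullBoard W) b n) {m : Move}
    (hm : (Position.mk b .white).Legal m) (hc : ¬ (b.move m).InCheck .black) :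
    HuntStart W (b.move m).flip := by
  have h0 := hS.farSide
  obtain ⟨hm1, hm2⟩ := hm
  simp only [h.short.canMove_iff] at hm1 hm2
  obtain ⟨k, e1, e2, e3⟩ := hm1
  have hs := h.short.move m
  obtain ⟨⟨x, x'⟩, y, y'⟩ := m
  simp only at e1 e2 e3
  have hk : x' ≤ 0 ∧ (k = .pawn ∨ k = .knight) := by
    -- The white king cannot move: all squares around him are guarded by pawns of the mirror field,
    -- which is untouched.
    refine (h.white_near h0 e1).resolve_left ?_
    rintro ⟨rfl, hx⟩
    have e4 := (h.high x x' hx).symm.trans e1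
    rw [← hS.full_flip, Board.flip_eq_some, flipSquare] at e4
    obtain ⟨rfl, hx'⟩ := hS.full_black_king e4
    obtain rfl : x' = 10 := by simp only at hx'; omega
    have e5 : Hits (.white, .king) (0, 10) (y, y') := by simpa using e3
    have e6 : Hits (.black, .king) (0, 0) (y, 10 - y') := by
      simp only [Hits] at e5 ⊢
      omega
    obtain ⟨s, t, ht, hst, e7, e8⟩ := hS.start_guarded e6
    apply hm2
    rw [hs.inCheck_iff]
    refine ⟨(s, 10 - t), (y, y'), .pawn, ?_, ?_, ?_⟩
    · rw [Board.move_apply, if_pos rfl, e1]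
    · have e9 : fullBoard W (s, 10 - t) = some (.black, .pawn) := by
        rw [← hS.full_flip, Board.flip_eq_some, flipSquare, fullBoard_low (by dsimp only; omega)]
        simpa [Color.other] using e7
      rw [← h.high _ _ (by omega)] at e9
      rw [Board.move_apply, if_neg (by simp; omega), if_neg, e9, Color.other]
      intro h5
      rw [h5, e1] at e9
      simp at e9
    · simp only [Hits, Color.forward, Color.other] at e8 ⊢
      omega
  -- A white pawn or knight moves from row 0 or lower, so it cannot reach rows 5 and above, which
  -- make up the field for the counter-hunt.
  have hy : y' ≤ 2 := by
    rcases hk.2 with rfl | rfl <;> simp only [Hits, Color.forward] at e3 <;> omega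
  refine ⟨hs.flip, ?_, ?_, ?_⟩
  · intro u v hv
    have : (fullBoard W).flip (u, v) = W (u, v) := by rw [hS.full_flip, fullBoard_low hv]
    rw [← this, Board.flip, Board.flip]
    congr 1
    rw [flipSquare, Board.move_apply, if_neg (by simp; omega), if_neg (by simp; omega)]
    by_cases hv' : v = 5
    · subst hv'
      rw [h.empty _ _ (by norm_num) (by norm_num), fullBoard_low (by norm_num),
        hS.surface _ _ (by norm_num) (by norm_num)]
    · rw [h.high _ _ (by dsimp only; omega)]
  · intro u v hv huv
    rw [Board.flip_eq_some, flipSquare, Board.move_apply] at huv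
    split_ifs at huv
    · rw [e1] at huv
      rcases hk.2 with rfl | rfl <;> simp at huv
    · rcases h.white_near h0 huv with ⟨-, h1⟩ | ⟨-, h1⟩
      · dsimp only at h1
        omega
      · simp at h1
  · rw [hs.inCheck_flip]
    exact hc

end InfiniteChess

namespace InfiniteChess

/-! Primitive recursive functions on the integers. -/

theorem primrec_intCast : Primrec fun n : ℕ => (n : ℤ) := by
  rw [← Primrec.encode_iff]
  refine Primrec.nat_double.of_eq fun n => ?_
  rfl

theorem primrec_negSucc : Primrec Int.negSucc := by
  rw [← Primrec.encode_iff]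
  refine Primrec.nat_double_succ.of_eq fun n => ?_
  rfl

/-- Nonnegative integers have even codes and negative integers odd ones; half of the code, rounded
down, is the argument of the constructor. -/
theorem primrec_int_cases {σ : Type*} [Primcodable σ] {f g : ℕ → σ} (hf : Primrec f)
    (hg : Primrec g) :
    Primrec fun z : ℤ => (match z with | .ofNat n => f n | .negSucc n => g n : σ) := by
  have : Primrec fun z : ℤ => bif (Encodable.encode z).bodd then
      g (Encodable.encode z).div2 else f (Encodable.encode z).div2 :=
    Primrec.cond (Primrec.nat_bodd.comp Primrec.encode)
      (hg.comp (Primrec.nat_div2.comp Primrec.encode))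
      (hf.comp (Primrec.nat_div2.comp Primrec.encode))
  refine this.of_eq fun z => ?_
  cases z with
  | ofNat n =>
    have : Encodable.encode (Int.ofNat n) = 2 * n := rfl
    rw [this]
    simp [Nat.div2_val]
  | negSucc n =>
    have : Encodable.encode (Int.negSucc n) = 2 * n + 1 := rfl
    rw [this]
    simp [Nat.div2_val]

theorem primrec_toNat : Primrec Int.toNat :=
  (primrec_int_cases Primrec.id (Primrec.const 0)).of_eq fun z => by cases z <;> rfl

theorem primrec_int_neg : Primrec fun z : ℤ => -z := by
  have h : Primrec fun n : ℕ => -(n : ℤ) :=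
    (Primrec.nat_casesOn₁ (0 : ℤ) primrec_negSucc).of_eq fun n => by cases n <;> rfl
  exact (primrec_int_cases h (primrec_intCast.comp Primrec.succ)).of_eq fun z => by cases z <;> rfl

theorem primrec_int_subNat : Primrec₂ fun a b : ℕ => (a : ℤ) - b := by
  have : Primrec fun x : ℕ × ℕ => if x.2 ≤ x.1 then ((x.1 - x.2 : ℕ) : ℤ) else
      -((x.2 - x.1 : ℕ) : ℤ) :=
    Primrec.ite (Primrec.nat_le.comp Primrec.snd Primrec.fst)
      (primrec_intCast.comp (Primrec.nat_sub.comp Primrec.fst Primrec.snd))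
      (primrec_int_neg.comp (primrec_intCast.comp (Primrec.nat_sub.comp Primrec.snd Primrec.fst)))
  refine Primrec₂.mk (this.of_eq fun x => ?_)
  split_ifs <;> omega

/-- Both summands are split into positive and negative parts, which reduces the sum to a difference
of natural numbers. -/
theorem primrec_int_add : Primrec₂ fun a b : ℤ => a + b := by
  have h1 := primrec_toNat.comp (Primrec.fst (α := ℤ) (β := ℤ))
  have h2 := primrec_toNat.comp (Primrec.snd (α := ℤ) (β := ℤ))
  have h3 := primrec_toNat.comp (primrec_int_neg.comp (Primrec.fst (α := ℤ) (β := ℤ)))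
  have h4 := primrec_toNat.comp (primrec_int_neg.comp (Primrec.snd (α := ℤ) (β := ℤ)))
  refine Primrec₂.mk ((primrec_int_subNat.comp (Primrec.nat_add.comp h1 h2)
    (Primrec.nat_add.comp h3 h4)).of_eq fun x => ?_)
  push_cast
  omega

theorem primrec_int_sub : Primrec₂ fun a b : ℤ => a - b :=
  Primrec₂.mk ((primrec_int_add.comp Primrec.fst (primrec_int_neg.comp Primrec.snd)).of_eq
    fun _ => (sub_eq_add_neg _ _).symm)

theorem primrec_int_le : PrimrecRel fun a b : ℤ => a ≤ b := by
  have : PrimrecPred fun x : ℤ × ℤ => (x.1 - x.2).toNat = 0 :=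
    Primrec.eq.comp (primrec_toNat.comp primrec_int_sub) (Primrec.const 0)
  exact this.of_eq fun x => by omega

theorem primrec_flipSquare : Primrec flipSquare :=
  Primrec.fst.pair (primrec_int_sub.comp (Primrec.const 10) Primrec.snd)

theorem primrec_flipMove : Primrec flipMove :=
  (primrec_flipSquare.comp Primrec.fst).pair (primrec_flipSquare.comp Primrec.snd)

theorem computable_flipStrategy {τ : Strategy} (hτ : Computable τ) :
    Computable (Position.flipStrategy τ) :=
  primrec_flipMove.to_comp.comp (hτ.comp (Primrec.list_map Primrec.id
    (primrec_flipMove.comp Primrec.snd).to₂).to_comp)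

end InfiniteChess

/-! ### Strategies: hunting, fleeing and the computable win -/

namespace InfiniteChess
variable {W b₀ b : Board} {T : Square → Prop} {kd : Square → Step} {p : ℕ → ℤ} {n : ℕ}

/-- The square of arrival of the last move. -/
def lastSquare (h : List Move) : Square := (h.getLast?.map Prod.snd).getD (0, 0)

theorem lastSquare_concat (h : List Move) (m : Move) : lastSquare (h ++ [m]) = m.2 := by
  simp [lastSquare]

theorem lastSquare_computable : Computable lastSquare := by
  refine (Primrec.option_getD.comp (Primrec.option_map
    (Primrec.list_head?.comp Primrec.list_reverse) (Primrec.snd.comp Primrec.snd).to₂)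
    (Primrec.const ((0, 0) : Square))).to_comp.of_eq fun h => ?_
  simp [lastSquare]

/-- White's strategy: hunt the black king. -/
def huntStrategy (kd : Square → Step) : Strategy := fun h => driveMove kd (lastSquare h)

section Hunting

variable (hS : Sea W T kd) {h : List Move}
include hS

/-- Every legal reply is a king move, so the last square of the history is that of the black king.
For the empty history the default `(0, 0)` of `lastSquare` is his initial square. -/
theorem hunt_invariant
    (H : (Position.mk (fullBoard W) .white).Follows .white (huntStrategy kd) h) :
    (((Position.mk (fullBoard W) .white).after h).turn = .white →
      Hunt W T kd (fullBoard W) ((Position.mk (fullBoard W) .white).after h).board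
        (lastSquare h).1 (lastSquare h).2) ∧
    (((Position.mk (fullBoard W) .white).after h).turn ≠ .white →
      ∃ b x y, Hunt W T kd (fullBoard W) b x y ∧
        ((Position.mk (fullBoard W) .white).after h).board = b.move (driveMove kd (x, y))) := by
  refine Position.Follows.invariant
    (fun h => Hunt W T kd (fullBoard W) ((Position.mk (fullBoard W) .white).after h).board
        (lastSquare h).1 (lastSquare h).2)
    (fun h => ∃ b x y, Hunt W T kd (fullBoard W) b x y ∧
        ((Position.mk (fullBoard W) .white).after h).board = b.move (driveMove kd (x, y)))
    (fun _ => Hunt.start hS hS.huntStart) (fun h => absurd rfl h) ?_ ?_ H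
  · intro h h1 _
    exact ⟨_, _, _, h1, by rw [Position.after_concat]; rfl⟩
  · rintro h m ⟨b, x, y, h1, h2⟩ h3 h4
    have h5 : (Position.mk (b.move (driveMove kd (x, y))) .black).Legal m := by
      rw [← h2]
      convert h4
      generalize ((Position.mk (fullBoard W) .white).after h).turn = c at h3
      cases c
      · simp at h3
      · rfl
    obtain ⟨h6, h7⟩ := h1.reply hS m h5
    rw [lastSquare_concat, Position.after_concat]
    have := h1.next hS (u := m.2.1) (v := m.2.2) h7
    rw [← h2, ← h6] at this
    exact this

theorem hunt_isStrategy :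
    (Position.mk (fullBoard W) .white).IsStrategy .white (huntStrategy kd) := by
  intro h h1 h2 _
  have h3 := ((hunt_invariant hS h1).1 h2).drive_legal hS hS.huntStart
  rw [huntStrategy]
  convert h3

/-- White is never in check on his own turn, so he is never mated. -/
theorem hunt_isDrawing :
    (Position.mk (fullBoard W) .white).IsDrawing .white (huntStrategy kd) := by
  refine ⟨hunt_isStrategy hS, ?_⟩
  rintro σ - ⟨h, -, h1, h2, h3, -⟩
  exact ((hunt_invariant hS h1).1 h2).not_inCheck hS hS.huntStart h3

end Hunting

open Classical in
/-- Black's reply on the board `b` after `l` moves: flee along the path as long as white gives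
check, then hunt the white king. -/
noncomputable def fleeMove (kd : Square → Step) (p : ℕ → ℤ) (b : Board) (l : ℕ) : Move :=
  -- On Black's turn number `n`, counted from 0, there have been `2 * n + 1` moves.
  if b.InCheck .black then pathMove p (l / 2)
  else flipMove (driveMove kd (Classical.epsilon fun s => b.flip s = bKing))

noncomputable def fleeStrategy (W : Board) (kd : Square → Step) (p : ℕ → ℤ) : Strategy := fun h =>
  fleeMove kd p ((Position.mk (fullBoard W) .white).after h).board h.length

/-- The states of black's play with black to move. -/
def FleeState (W : Board) (T : Square → Prop) (kd : Square → Step) (p : ℕ → ℤ) (b : Board)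
    (l : ℕ) : Prop :=
  (∃ b' m, Flight W kd p (fullBoard W) b' (l / 2) ∧ b = b'.move m ∧ b.InCheck .black ∧
    Checks kd p b' (l / 2) m ∧ b' m.2 = none ∧ l % 2 = 1) ∨
  ∃ b₀ x y, HuntStart W b₀ ∧ Hunt W T kd b₀ b.flip x y

theorem Hunt.king_unique (h0 : HuntStart W b₀) {x y : ℤ}
    (h : Hunt W T kd b₀ b x y) {s : Square} (hs : b s = bKing) : s = (x, y) := by
  obtain ⟨u, v⟩ := s
  by_cases hv : v ≤ 5
  · by_contra hk
    rcases h.content u v hv (by simpa using hk) with h | h | h <;> simp [h] at hs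
  · rw [h.high u v (by omega)] at hs
    exact absurd hs (h0.high u v (by omega))

theorem Hunt.fleeMove_eq (hS : Sea W T kd) (h0 : HuntStart W b₀) {x y : ℤ}
    (h : Hunt W T kd b₀ b.flip x y) (l : ℕ) :
    fleeMove kd p b l = flipMove (driveMove kd (x, y)) := by
  have h3 : ¬ b.InCheck .black := by
    have := h.not_inCheck hS h0
    rwa [← Board.flip_flip b, h.short.inCheck_flip]
  rw [fleeMove, if_neg h3, h.king_unique h0 (Classical.epsilon_spec (p := fun s => b.flip s = bKing)
    ⟨_, h.king⟩)]

section Fleeing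

variable (hS : Sea W T kd) (hp : Path W T kd p) {h : List Move}
include hS hp

/-- Black's play has two phases, flight and counter-hunt. The first move without check leads from
one to the other, and there is no way back, since White's replies are then forced. -/
theorem flee_invariant
    (H : (Position.mk (fullBoard W) .white).Follows .black (fleeStrategy W kd p) h) :
    ((Position.mk (fullBoard W) .white).after h).turn = .black →
      FleeState W T kd p ((Position.mk (fullBoard W) .white).after h).board h.length := by
  refine (Position.Follows.invariant
    (fun h => FleeState W T kd p ((Position.mk (fullBoard W) .white).after h).board h.length)
    (fun h => (∃ n, h.length = 2 * n ∧ Flight W kd p (fullBoard W)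
      ((Position.mk (fullBoard W) .white).after h).board n) ∨
      ∃ b₀ b x y, HuntStart W b₀ ∧ Hunt W T kd b₀ b x y ∧
        ((Position.mk (fullBoard W) .white).after h).board.flip = b.move (driveMove kd (x, y)))
    (fun h => absurd h (by simp)) (fun _ => .inl ⟨0, rfl, hS.flight hp⟩) ?_ ?_ H).1
  · rintro h h1 -
    rw [Position.after_concat]
    generalize hb : ((Position.mk (fullBoard W) .white).after h) = q at h1
    simp only [fleeStrategy, hb, Position.move]
    rcases h1 with ⟨b', m, h1, h2, h3, h4, h5, h6⟩ | ⟨b₀, x, y, h1, h2⟩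
    · rw [fleeMove, if_pos h3, h2]
      refine .inl ⟨h.length / 2 + 1, ?_, h1.evade hS hp hS.farSide h4 h5⟩
      simp
      omega
    · rw [h2.fleeMove_eq hS h1]
      exact .inr ⟨b₀, _, x, y, h1, h2, by rw [Board.flip_move, flipMove_flipMove]⟩
  · rintro h m h1 h2 h3
    rw [Position.after_concat]
    generalize hb : ((Position.mk (fullBoard W) .white).after h) = q at h1 h2 h3
    obtain ⟨b, c⟩ := q
    obtain rfl : c = .white := by cases c <;> simp at h2 ⊢
    simp only [Position.move] at h1 ⊢
    rcases h1 with ⟨n, h1, h4⟩ | ⟨b₀, b', x, y, h1, h4, h5⟩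
    · by_cases hc : (b.move m).InCheck .black
      · obtain ⟨h6, h7⟩ := h4.checks hp hS.farSide h3 hc
        have h8 : (h ++ [m]).length / 2 = n := by simp; omega
        refine .inl ⟨b, m, by rwa [h8], rfl, hc, by rwa [h8], h7, by simp; omega⟩
      · exact .inr ⟨_, _, _, h4.counter hS h3 hc, Hunt.start hS (h4.counter hS h3 hc)⟩
    · have hs : b.Short := by
        rw [← Board.flip_flip b, h5]
        exact (h4.short.move _).flip
      have h6 := hs.legal_flip h3
      rw [h5] at h6
      obtain ⟨h7, h8⟩ := h4.reply hS _ h6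
      have := h4.next hS (u := (flipMove m).2.1) (v := (flipMove m).2.2) h8
      rw [← h5, ← h7] at this
      refine .inr ⟨b₀, (flipMove m).2.1, (flipMove m).2.2, h1, ?_⟩
      rw [Board.flip_move]
      exact this

theorem flee_legal
    (H : (Position.mk (fullBoard W) .white).Follows .black (fleeStrategy W kd p) h)
    (ht : ((Position.mk (fullBoard W) .white).after h).turn = .black) :
    ((Position.mk (fullBoard W) .white).after h).Legal (fleeStrategy W kd p h) := by
  have h1 := flee_invariant hS hp H ht
  have hsq := Position.short_after (p := Position.mk (fullBoard W) .white) hS.full_short h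
  generalize hb : ((Position.mk (fullBoard W) .white).after h) = q at h1 ht hsq
  simp only [fleeStrategy, hb]
  obtain ⟨b, c⟩ := q
  simp only at ht h1 hsq ⊢
  subst ht
  rcases h1 with ⟨b', m, h1, rfl, h3, h4, h5, h6⟩ | ⟨b₀, x, y, h1, h2⟩
  · rw [fleeMove, if_pos h3]
    exact h1.evade_legal hS hp hS.farSide h4 h5
  · rw [h2.fleeMove_eq hS h1]
    simpa [Color.other] using h2.short.legal_flip (h2.drive_legal hS h1)

/-- On each of his turns Black has a legal move, namely the one of the strategy, so he is never
mated. -/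
theorem flee_isDrawing :
    (Position.mk (fullBoard W) .white).IsDrawing .black (fleeStrategy W kd p) := by
  refine ⟨fun h h1 h2 _ => flee_legal hS hp h1 h2, ?_⟩
  rintro σ - ⟨h, -, h1, h2, -, h3⟩
  exact h3 _ (flee_legal hS hp h1 h2)

theorem full_isDraw (c : Color) : (Position.mk (fullBoard W) c).IsDraw := by
  have main : ∀ d, ∃ τ, (Position.mk (fullBoard W) .white).IsDrawing d τ := by
    intro d
    cases d
    · exact ⟨_, hunt_isDrawing hS⟩
    · exact ⟨_, flee_isDrawing hS hp⟩
  cases c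
  · exact Position.isDraw_of_isDrawing main
  · refine Position.isDraw_of_isDrawing fun d => ?_
    obtain ⟨τ, h⟩ := main d.other
    have := h.flip hS.full_short
    rw [Position.flip, hS.full_flip, Color.other_other] at this
    exact ⟨_, this⟩

end Fleeing

/-- If the black king has no computable way down the field, then white has a computable win. -/
theorem full_computableWin_white (hS : Sea W T kd) (hc : Computable (huntStrategy kd))
    (hk : ∀ k : ℕ → Square, Computable k → k 0 = (0, 0) →
      ¬ ∀ n, Next T kd (k n) (k (n + 1))) :
    (Position.mk (fullBoard W) .white).ComputableWin .white := by
  refine ⟨huntStrategy kd, hunt_isStrategy hS, hc, fun σ hσ hl => ?_⟩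
  set q := Position.mk (fullBoard W) .white
  by_contra hd
  let half : List Move → List Move := fun h => h ++ [huntStrategy kd h]
  -- `H n` is the play after `n` moves of each side. It is defined without regard to legality, so
  -- that it is visibly computable from `σ`.
  let H : ℕ → List Move := fun n => n.rec [] fun _ h => half h ++ [σ (half h)]
  have half_c : Computable half :=
    Computable.list_append.comp Computable.id (Computable.list_cons.comp hc (Computable.const []))
  have H_c : Computable H := by
    refine Computable.nat_rec (f := id) (g := fun _ => ([] : List Move))
      (h := fun _ (x : ℕ × List Move) => half x.2 ++ [σ (half x.2)])
      Computable.id (Computable.const _) ?_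
    have h1 : Computable fun x : ℕ × (ℕ × List Move) => half x.2.2 :=
      half_c.comp (Computable.snd.comp Computable.snd)
    exact (Computable.list_append.comp h1
      (Computable.list_cons.comp (hσ.comp h1) (Computable.const []))).to₂
  have step : ∀ n, q.Follows .white (huntStrategy kd) (H n) → q.Follows .black σ (H n) →
      (q.after (H n)).turn = .white → q.Follows .white (huntStrategy kd) (H (n + 1)) ∧
      q.Follows .black σ (H (n + 1)) ∧ (q.after (H (n + 1))).turn = .white ∧
      Next T kd (lastSquare (H n)) (lastSquare (H (n + 1))) := by
    intro n h1 h2 h3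
    have h4 := (hunt_invariant hS h1).1 h3
    have h5 : (q.after (H n)).Legal (huntStrategy kd (H n)) := hunt_isStrategy hS _ h1 h3
      ⟨driveMove kd (lastSquare (H n)), by convert h4.drive_legal hS hS.huntStart⟩
    have h6 : q.Follows .white (huntStrategy kd) (half (H n)) :=
      Position.follows_concat.2 ⟨h1, h5, fun _ => rfl⟩
    have h7 : q.Follows .black σ (half (H n)) :=
      Position.follows_concat.2 ⟨h2, h5, fun h => by rw [h3] at h; cases h⟩
    have h8 : q.after (half (H n)) =
        ⟨(q.after (H n)).board.move (driveMove kd (lastSquare (H n))), .black⟩ := by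
      rw [Position.after_concat, Position.move, h3]
      rfl
    -- Without a legal reply Black would be mated, because he is in check; but `σ` is assumed not to
    -- be defeated.
    have h9 : ∃ m, (q.after (half (H n))).Legal m := by
      by_contra! hn
      refine hd ⟨half (H n), h6, h7, by rw [h8]; rfl, ?_, hn⟩
      rw [h8]
      exact h4.drive_inCheck hS
    have h10 : (q.after (half (H n))).turn = .black := by rw [h8]
    have h11 := hl _ h6 h7 h10 h9
    refine ⟨Position.follows_concat.2 ⟨h6, h11, fun h => by rw [h10] at h; cases h⟩,
      Position.follows_concat.2 ⟨h7, h11, fun _ => rfl⟩, ?_, ?_⟩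
    · rw [Position.after_concat, Position.move, h10]
      rfl
    · rw [h8] at h11
      have := (h4.reply hS _ h11).2
      change Next T kd _ (lastSquare (half (H n) ++ [σ (half (H n))]))
      rw [lastSquare_concat]
      exact this
  have all : ∀ n, q.Follows .white (huntStrategy kd) (H n) ∧ q.Follows .black σ (H n) ∧
      (q.after (H n)).turn = .white := by
    intro n
    induction n with
    | zero => exact ⟨Position.follows_nil _ _ _, Position.follows_nil _ _ _, rfl⟩
    | succ n ih =>
      obtain ⟨h1, h2, h3, -⟩ := step n ih.1 ih.2.1 ih.2.2
      exact ⟨h1, h2, h3⟩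
  -- The squares of the king in this endless play form a computable track.
  refine hk (fun n => lastSquare (H n)) (lastSquare_computable.comp H_c) rfl fun n => ?_
  exact (step n (all n).1 (all n).2.1 (all n).2.2).2.2.2

theorem full_computableWin (hS : Sea W T kd) (hc : Computable (huntStrategy kd))
    (hk : ∀ k : ℕ → Square, Computable k → k 0 = (0, 0) →
      ¬ ∀ n, Next T kd (k n) (k (n + 1))) (c : Color) :
    (Position.mk (fullBoard W) c).ComputableWin c := by
  have hw := full_computableWin_white hS hc hk
  cases c
  · exact hw
  · have := hw.flip hS.full_short fun _ => computable_flipStrategy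
    rwa [Position.flip, hS.full_flip] at this

end InfiniteChess

namespace InfiniteChess

/-! The tree of tracks. -/

/-- The file (relative to the left margin of the tree) at which the node `s` starts; the newest
bit of `s` comes first. -/
def nodeFile : List Bool → ℕ
  | [] => 1
  | b :: s => 13 * nodeFile s + if b then 12 else 1

/-- `s` avoids the diagonal computations, as far as they end within `s.length` steps. -/
def Avoids (s : List Bool) : Prop :=
  ∀ n < s.length, ∀ b, s.reverse[n]? = some b →
    Nat.Partrec.Code.evaln s.length (Denumerable.ofNat Nat.Partrec.Code n) n ≠ some b.toNat

/-- A computation that has ended within fewer steps also ends within more, so the tree is closed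
under initial segments. -/
theorem Avoids.tail {b : Bool} {s : List Bool} (h : Avoids (b :: s)) : Avoids s := by
  intro n hn c hc he
  refine h n (by simp; omega) c ?_ ?_
  · rw [List.reverse_cons, List.getElem?_append_left (by simpa using hn), hc]
  · exact Nat.Partrec.Code.evaln_mono (Nat.le_succ _) he

/-- The length of the part of block `d` in which the tracks do not branch. -/
def runLength : ℕ → ℕ
  | 0 => 0
  | d + 1 => 6 * 25 ^ d + 8

def nextLevel (x : ℕ × ℕ) : ℕ × ℕ :=
  if x.2 + 1 < runLength x.1 + 5 then (x.1, x.2 + 1) else (x.1 + 1, 0)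

/-- The block to which a depth belongs, and the place in the block. -/
def level (t : ℕ) : ℕ × ℕ := t.rec (0, 0) fun _ x => nextLevel x

theorem level_succ (t : ℕ) : level (t + 1) = nextLevel (level t) := rfl

/-- The base values of the tracks in block `d`. -/
def IsBase : ℕ → ℕ → Prop
  | 0, y => y = 0
  | d + 1, y => ∃ s, s.length = d ∧ Avoids s ∧ y = nodeFile s

def childBase (y : ℕ) (b : Bool) : ℕ := 13 * y + if b then 12 else 1

theorem nodeFile_cons (b : Bool) (s : List Bool) :
    nodeFile (b :: s) = childBase (nodeFile s) b := rfl

/-- The file of the track with base value `y` at place `c` of a block with run length `l`;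
`b` distinguishes the two branches at the end of the block. -/
def trackFile (l c y : ℕ) (b : Bool) : ℕ :=
  if c < l then y + 2 * min c (6 * y)
  else if b then 13 * y + 2 * (c - l + 1) else 13 * y + if c = l then 0 else 1

/-- The step has to be read off from the file without knowledge of the base value `y`. In the run,
`13 * c < 6 * X` is equivalent to `c < 6 * y`, both while `X = y + 2 * c` and when `X = 13 * y`.
After the fork, residues at most 1 modulo 13 mark the left branch and larger ones the right branch.
-/
def stepKind (l c : ℕ) (X : ℤ) : Step :=
  if l ≤ c then
    if X % 13 ≤ 1 then (if c = l then .drop else .left) else .right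
  else if c + 1 = l then .fork
  else if 13 * c < 6 * X then .right else .left

/-- The steps in coordinates in which the left step is vertical. -/
def StepTo (k : Step) (X X' : ℤ) : Prop :=
  match k with
  | .left => X' = X
  | .right => X' = X + 2
  | .drop => X' = X + 1
  | .fork => X' = X ∨ X' = X + 2

theorem stepTo_trackFile {l c y : ℕ} {b : Bool} (hc : c + 1 < l + 5)
    (hl : l = 0 ∧ y = 0 ∧ b = false ∨ 1 ≤ y ∧ 6 * y + 8 ≤ l) (X : ℤ) :
    StepTo (stepKind l c (trackFile l c y b)) (trackFile l c y b) X ↔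
      if c + 1 = l then ∃ b', X = trackFile l (c + 1) y b' else X = trackFile l (c + 1) y b := by
  by_cases h : l ≤ c
  · obtain ⟨j, rfl⟩ := Nat.exists_eq_add_of_le h
    have hj : j < 4 := by omega
    simp only [trackFile, stepKind, Bool.exists_bool]
    interval_cases j <;> cases b <;> simp only [if_true, if_false, Bool.false_eq_true] <;>
      split_ifs <;> simp only [StepTo] <;> omega
  · simp only [trackFile, stepKind, Bool.exists_bool]
    cases b <;> simp only [if_true, if_false, Bool.false_eq_true] <;>
      split_ifs <;> simp only [StepTo] <;> omega

theorem stepTo_trackFile_end {l y : ℕ} {b : Bool} (hl : l = 0 → b = false) (X : ℤ) :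
    StepTo (stepKind l (l + 4) (trackFile l (l + 4) y b)) (trackFile l (l + 4) y b) X ↔
      X = childBase y b := by
  simp only [trackFile, stepKind, childBase]
  cases b <;> simp only [if_true, if_false, Bool.false_eq_true] <;>
    split_ifs <;> simp only [StepTo] <;> omega

theorem nodeFile_pos (s : List Bool) : 1 ≤ nodeFile s := by
  cases s with
  | nil => exact le_rfl
  | cons b s => rw [nodeFile]; cases b <;> simp

/-- For `m ≥ 1` one has `13 * m + 12 ≤ 25 * m`. -/
theorem nodeFile_le (s : List Bool) : nodeFile s ≤ 25 ^ s.length := by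
  induction s with
  | nil => exact le_rfl
  | cons b s ih =>
    have := nodeFile_pos s
    rw [nodeFile, List.length_cons, pow_succ]
    split_ifs <;> omega

/-- Siblings are 11 apart. A gap of 11 between parents grows to `13 * 11`, of which the bits take
back at most 11. -/
theorem nodeFile_sep {s s' : List Bool} (h : s.length = s'.length) :
    s = s' ∨ nodeFile s + 11 ≤ nodeFile s' ∨ nodeFile s' + 11 ≤ nodeFile s := by
  induction s generalizing s' with
  | nil =>
    left
    exact (List.length_eq_zero_iff.1 h.symm).symm
  | cons b s ih =>
    cases s' with
    | nil => simp at h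
    | cons b' s' =>
      simp only [nodeFile]
      rcases ih (by simpa using h) with rfl | h1 | h1
      · cases b <;> cases b' <;> simp
      · right; left
        cases b <;> cases b' <;> simp <;> omega
      · right; right
        cases b <;> cases b' <;> simp <;> omega

theorem IsBase.sep {d y y' : ℕ} (h : IsBase d y) (h' : IsBase d y') :
    y = y' ∨ y + 11 ≤ y' ∨ y' + 11 ≤ y := by
  cases d with
  | zero => exact .inl (h.trans h'.symm)
  | succ d =>
    obtain ⟨s, h1, -, rfl⟩ := h
    obtain ⟨s', h2, -, rfl⟩ := h'
    rcases nodeFile_sep (h1.trans h2.symm) with rfl | h3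
    · exact .inl rfl
    · exact .inr h3

/-- The run is long enough for the `6 * y` right steps that lead from `y` to `13 * y`, with 8
straight rows to spare before the branches. -/
theorem IsBase.bound {d y : ℕ} (h : IsBase d y) :
    d = 0 ∧ runLength d = 0 ∧ y = 0 ∨ 1 ≤ d ∧ 1 ≤ y ∧ 6 * y + 8 ≤ runLength d := by
  cases d with
  | zero => exact .inl ⟨rfl, rfl, h⟩
  | succ d =>
    obtain ⟨s, h1, -, rfl⟩ := h
    have := nodeFile_le s
    rw [h1] at this
    refine .inr ⟨by omega, nodeFile_pos s, ?_⟩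
    rw [runLength]
    omega

theorem IsBase.parent {d y : ℕ} (h : IsBase (d + 1) y) :
    ∃ y' b, IsBase d y' ∧ (d = 0 → b = false) ∧ y = childBase y' b := by
  obtain ⟨s, h1, h2, rfl⟩ := h
  cases d with
  | zero =>
    obtain rfl := List.length_eq_zero_iff.1 h1
    exact ⟨0, false, rfl, fun _ => rfl, rfl⟩
  | succ d =>
    cases s with
    | nil => simp at h1
    | cons b s => exact ⟨nodeFile s, b, ⟨s, by simpa using h1, h2.tail, rfl⟩, by simp, rfl⟩

/-- `X` is the file of a track in the row at depth `t`. -/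
def Row (t : ℕ) (X : ℤ) : Prop :=
  ∃ y b, IsBase (level t).1 y ∧ ((level t).1 = 0 → b = false) ∧
    X = trackFile (runLength (level t).1) (level t).2 y b

/-- The run length of the block of depth `t`. -/
def runOf (t : ℕ) : ℕ := runLength (level t).1

/-- The place of the depth `t` in its block. -/
def placeOf (t : ℕ) : ℕ := (level t).2

/-- The kind of step from the file `X` at depth `t`. -/
def kindAt (t : ℕ) (X : ℤ) : Step := stepKind (runOf t) (placeOf t) X

theorem place_next (t : ℕ) :
    placeOf t + 1 < runOf t + 5 ∧ placeOf (t + 1) = placeOf t + 1 ∧ runOf (t + 1) = runOf t ∧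
      (level (t + 1)).1 = (level t).1 ∨
    placeOf t + 1 = runOf t + 5 ∧ placeOf (t + 1) = 0 ∧ 14 ≤ runOf (t + 1) ∧
      (level (t + 1)).1 = (level t).1 + 1 := by
  have hlt : ∀ t, placeOf t < runOf t + 5 := by
    intro t
    induction t with
    | zero => simp [placeOf, level]
    | succ t ih =>
      simp only [placeOf, runOf, level_succ, nextLevel] at ih ⊢
      split_ifs <;> dsimp only <;> omega
  have h1 := hlt t
  simp only [placeOf, runOf, level_succ, nextLevel] at h1 ⊢
  split_ifs with h
  · exact .inl ⟨h, rfl, rfl, rfl⟩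
  · refine .inr ⟨by omega, rfl, ?_, rfl⟩
    have := Nat.one_le_pow (level t).1 25 (by norm_num)
    simp only [runLength]
    omega

theorem place_lt (t : ℕ) : placeOf t < runOf t + 5 := by
  have := place_next t
  omega

theorem run_cases (t : ℕ) : runOf t = 0 ∧ t < 5 ∧ placeOf t = t ∨ 14 ≤ runOf t ∧ 5 ≤ t ∧
    (placeOf t < runOf t → placeOf t + 5 ≤ t) := by
  induction t with
  | zero => exact .inl ⟨rfl, by norm_num, rfl⟩
  | succ t ih =>
    have := place_next t
    omega

/-- Every track in the row at depth `t + 1` comes from a track in the row above. -/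
theorem Row.pred {t : ℕ} {X : ℤ} (h : Row (t + 1) X) :
    ∃ X', Row t X' ∧ StepTo (kindAt t X') X' X := by
  obtain ⟨y, b, h1, h2, h3⟩ := h
  rcases place_next t with ⟨h4, h5, h6, h7⟩ | ⟨h4, h5, h6, h7⟩
  · rw [h7] at h1 h2 h3
    refine ⟨_, ⟨y, b, h1, h2, rfl⟩, ?_⟩
    rw [kindAt]
    refine (stepTo_trackFile h4 ?_ X).2 ?_
    · have := h1.bound
      unfold runOf
      tauto
    · change X = trackFile (runOf t) (placeOf (t + 1)) y b at h3
      rw [h5] at h3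
      split_ifs
      · exact ⟨b, h3⟩
      · exact h3
  · rw [h7] at h1 h2 h3
    obtain ⟨y', b', h8, h9, h10⟩ := h1.parent
    refine ⟨_, ⟨y', b', h8, h9, rfl⟩, ?_⟩
    have h11 : placeOf t = runOf t + 4 := by omega
    have h12 : (level (t + 1)).2 = 0 := h5
    change StepTo (stepKind (runOf t) (placeOf t) (trackFile (runOf t) (placeOf t) y' b'))
      (trackFile (runOf t) (placeOf t) y' b') X
    rw [h11, stepTo_trackFile_end, h3, h12, ← h10]
    · unfold runOf at h6
      rw [h7] at h6
      simp [trackFile]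
      intro
      omega
    · intro h13
      apply h9
      by_contra hd
      have := h8.bound
      unfold runOf at h13
      omega

/-- Within a block every step of the right kind follows a track. -/
theorem Row.succ {t : ℕ} {X X' : ℤ} (h : Row t X) (hs : StepTo (kindAt t X) X X')
    (ht : placeOf t + 1 < runOf t + 5) : Row (t + 1) X' := by
  obtain ⟨y, b, h1, h2, h3⟩ := h
  rcases place_next t with ⟨h4, h5, h6, h7⟩ | ⟨h4, -⟩
  · rw [h3, kindAt] at hs
    have hb := h1.bound
    rw [show runLength (level t).1 = runOf t from rfl] at hs hb
    have h8 := (stepTo_trackFile h4 (by tauto) X').1 hs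
    have h9 : ∃ b', ((level t).1 = 0 → b' = false) ∧
        X' = trackFile (runOf t) (placeOf t + 1) y b' := by
      split_ifs at h8 with h9
      · obtain ⟨b', h8⟩ := h8
        exact ⟨b', by omega, h8⟩
      · exact ⟨b, h2, h8⟩
    obtain ⟨b', h9, h10⟩ := h9
    refine ⟨y, b', by rwa [h7], by rwa [h7], ?_⟩
    change X' = trackFile (runOf (t + 1)) (placeOf (t + 1)) y b'
    rw [h6, h5, h10]
  · omega

theorem Row.sep {t : ℕ} {X X' : ℤ} (h : Row t X) (h' : Row t X') (ht : placeOf t < runOf t) :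
    X = X' ∨ X + 11 ≤ X' ∨ X' + 11 ≤ X := by
  obtain ⟨y, b, h1, -, rfl⟩ := h
  obtain ⟨y', b', h1', -, rfl⟩ := h'
  have := h1.sep h1'
  change ((trackFile (runOf t) (placeOf t) y b : ℕ) : ℤ) = _ ∨ _
  unfold trackFile
  unfold placeOf runOf at *
  rw [if_pos ht, if_pos ht]
  omega

/-- In the last 8 rows of the run and in the branching part, all tracks of the node with base value
`y` have `X / 13 = y`. -/
theorem Row.sep_div {t : ℕ} {X X' : ℤ} (h : Row t X) (h' : Row t X')
    (ht : runOf t ≤ placeOf t + 8) :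
    X / 13 = X' / 13 ∨ X / 13 + 11 ≤ X' / 13 ∨ X' / 13 + 11 ≤ X / 13 := by
  have key : ∀ {X : ℤ}, Row t X → ∃ y, IsBase (level t).1 y ∧ X / 13 = y := by
    rintro X ⟨y, b, h1, h2, rfl⟩
    refine ⟨y, h1, ?_⟩
    have h3 := h1.bound
    have h4 := place_lt t
    unfold trackFile
    unfold placeOf runOf at *
    split_ifs <;> omega
  obtain ⟨y, h1, h2⟩ := key h
  obtain ⟨y', h1', h2'⟩ := key h'
  have := h1.sep h1'
  omega

theorem Row.mod_fork {t : ℕ} {X : ℤ} (h : Row t X) (ht : runOf t ≤ placeOf t) :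
    placeOf t = runOf t ∧ X % 13 = 0 ∨ placeOf t ≠ runOf t ∧ X % 13 = 1 ∨
      runOf t ≠ 0 ∧ X % 13 = 2 * (placeOf t - runOf t + 1) := by
  obtain ⟨y, b, h1, h2, rfl⟩ := h
  have h3 := h1.bound
  have h4 := place_lt t
  unfold trackFile
  unfold placeOf runOf at *
  split_ifs with h5 h6 h7
  · omega
  · right; right
    have : (level t).1 ≠ 0 := fun h => by simp [h2 h] at h6
    omega
  · omega
  · omega

theorem Row.mod_run {t : ℕ} {X : ℤ} (h : Row t X) (ht : placeOf t < runOf t)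
    (ht' : runOf t ≤ placeOf t + 8) : X % 13 = 0 ∧ 6 * X ≤ 13 * placeOf t ∧ 0 ≤ X := by
  obtain ⟨y, b, h1, -, rfl⟩ := h
  have h3 := h1.bound
  unfold trackFile
  unfold placeOf runOf at *
  split_ifs
  omega

theorem kindAt_eq_left {t : ℕ} {X : ℤ} : kindAt t X = .left ↔
    runOf t < placeOf t ∧ X % 13 ≤ 1 ∨ placeOf t + 1 < runOf t ∧ 6 * X ≤ 13 * placeOf t := by
  unfold kindAt stepKind
  split_ifs <;> simp <;> omega

theorem kindAt_eq_right {t : ℕ} {X : ℤ} : kindAt t X = .right ↔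
    runOf t ≤ placeOf t ∧ 2 ≤ X % 13 ∨ placeOf t + 1 < runOf t ∧ 13 * placeOf t < 6 * X := by
  unfold kindAt stepKind
  split_ifs <;> simp <;> omega

theorem kindAt_eq_drop {t : ℕ} {X : ℤ} : kindAt t X = .drop ↔
    runOf t = placeOf t ∧ X % 13 ≤ 1 := by
  unfold kindAt stepKind
  split_ifs <;> simp <;> omega

theorem kindAt_eq_fork {t : ℕ} {X : ℤ} : kindAt t X = .fork ↔ placeOf t + 1 = runOf t := by
  unfold kindAt stepKind
  split_ifs <;> simp <;> omega

/-- The empty squares at depth `t + 1`. -/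
def Hole (t : ℕ) (X : ℤ) : Prop :=
  Row t X ∨ (Row t (X - 2) ∧ ¬ (placeOf t = runOf t + 1 ∧ (X - 2) % 13 = 1)) ∨
    (placeOf t + 1 = runOf t ∧ Row t (X + 1))

/-- The squares of the white knights at depth `t`. -/
def KnightAt (t : ℕ) (X : ℤ) : Prop := placeOf t + 1 = runOf t ∧ Row t (X + 4)

open Classical in
/-- The field of white pawns, in the coordinates depth and file. -/
noncomputable def fieldAt (t : ℕ) (X : ℤ) : Option Piece :=
  if t = 0 ∧ X = 0 then bKing
  else if 1 ≤ t ∧ Hole (t - 1) X then none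
  else if KnightAt t X then wKnight
  else wPawn

/-- The field of white pawns. -/
noncomputable def field : Board := fun s =>
  if 0 < s.2 then none else fieldAt (-s.2).toNat (s.1 - s.2)

/-- The squares of the tracks. -/
def OnTrack (s : Square) : Prop := s.2 ≤ 0 ∧ Row (-s.2).toNat (s.1 - s.2)

def trackStep (s : Square) : Step := kindAt (-s.2).toNat (s.1 - s.2)

theorem exists_depth {x y : ℤ} (h : y ≤ 0) : ∃ (t : ℕ) (X : ℤ), y = -t ∧ x = X - t :=
  ⟨(-y).toNat, x - y, by omega, by omega⟩

theorem onTrack_iff {t : ℕ} {X : ℤ} : OnTrack (X - t, -t) ↔ Row t X := by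
  simp [OnTrack]

theorem trackStep_eq {t : ℕ} {X : ℤ} : trackStep (X - t, -t) = kindAt t X := by
  simp [trackStep]

theorem onTrack_at {x y : ℤ} (t : ℕ) (X : ℤ) (h1 : y = -t) (h2 : x = X - t) :
    OnTrack (x, y) ↔ Row t X := by
  rw [h1, h2, onTrack_iff]

theorem trackStep_at {x y : ℤ} (t : ℕ) (X : ℤ) (h1 : y = -t) (h2 : x = X - t) :
    trackStep (x, y) = kindAt t X := by
  rw [h1, h2, trackStep_eq]

theorem field_eq {x y : ℤ} (t : ℕ) (X : ℤ) (h1 : y = -t) (h2 : x = X - t) :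
    field (x, y) = fieldAt t X := by
  subst h1 h2
  rw [field, if_neg (by simp)]
  simp

theorem fieldAt_pawn {t : ℕ} {X : ℤ} (h1 : ¬ Hole t X) (h2 : ¬ KnightAt (t + 1) X) :
    fieldAt (t + 1) X = wPawn := by
  rw [fieldAt, if_neg (by simp), if_neg (by simpa using h1), if_neg h2]

theorem fieldAt_none {t : ℕ} {X : ℤ} (h1 : Hole t X) : fieldAt (t + 1) X = none := by
  rw [fieldAt, if_neg (by simp), if_pos (by simpa using h1)]

theorem fieldAt_knight {t : ℕ} {X : ℤ} : fieldAt t X = wKnight ↔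
    KnightAt t X ∧ ¬ (1 ≤ t ∧ Hole (t - 1) X) := by
  unfold fieldAt
  split_ifs with h1 h2 h3
  · simp only [reduceCtorEq, false_iff, Option.some.injEq, Prod.mk.injEq, false_and]
    rintro ⟨⟨h2, -⟩, -⟩
    have h3 : runOf t = 0 := by rw [h1.1]; rfl
    omega
  · simp [h2]
  · simp only [true_iff]
    exact ⟨h3, h2⟩
  · simp [h3]

/-! ### No stray holes or knights near a track -/

theorem Hole.cases {t : ℕ} {Z : ℤ} (h : Hole t Z) : ∃ X, Row t X ∧
    (Z = X ∨ Z = X + 2 ∧ ¬ (placeOf t = runOf t + 1 ∧ X % 13 = 1) ∨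
      placeOf t + 1 = runOf t ∧ Z + 1 = X) := by
  rcases h with h | ⟨h, h'⟩ | ⟨h, h'⟩
  · exact ⟨_, h, .inl rfl⟩
  · exact ⟨_, h, .inr (.inl ⟨by ring, h'⟩)⟩
  · exact ⟨_, h', .inr (.inr ⟨h, rfl⟩)⟩

theorem Row.pred' {t : ℕ} {Z : ℤ} (h : Row (t + 1) Z) : ∃ X, Row t X ∧
    ((runOf t < placeOf t ∧ X % 13 ≤ 1 ∨ placeOf t + 1 < runOf t ∧ 6 * X ≤ 13 * placeOf t) ∧
        Z = X ∨
      (runOf t ≤ placeOf t ∧ 2 ≤ X % 13 ∨ placeOf t + 1 < runOf t ∧ 13 * placeOf t < 6 * X) ∧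
        Z = X + 2 ∨
      (runOf t = placeOf t ∧ X % 13 ≤ 1) ∧ Z = X + 1 ∨
      placeOf t + 1 = runOf t ∧ (Z = X ∨ Z = X + 2)) := by
  obtain ⟨X, h1, h2⟩ := h.pred
  refine ⟨X, h1, ?_⟩
  rw [← kindAt_eq_left, ← kindAt_eq_right, ← kindAt_eq_drop, ← kindAt_eq_fork (X := X)]
  cases hk : kindAt t X <;> simpa [hk, StepTo] using h2

/-- The knight belongs to a fork on file `X + e + 4`, which is reached by a straight step. The
bounds on `e` put that file strictly between 0 and 11 to the right of `X`, where no other track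
runs. -/
theorem Row.no_knight_one {t : ℕ} {X e : ℤ} (h : Row t X) (h1 : -4 < e) (h2 : e < 7) :
    ¬ KnightAt (t + 1) (X + e) := by
  rintro ⟨h3, h4⟩
  obtain ⟨X', h5, h6⟩ := h4.pred'
  have := place_next t
  have := h.sep h5
  have := h5.mod_run
  omega

theorem Row.no_knight_two {t : ℕ} {X e : ℤ} (h : Row t X) (h1 : -4 < e) (h2 : e < 7) :
    ¬ KnightAt (t + 1 + 1) (X + e) := by
  rintro ⟨h3, h4⟩
  obtain ⟨X', h5, h6⟩ := h4.pred'
  obtain ⟨X'', h7, h8⟩ := h5.pred'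
  have := place_next t
  have := place_next (t + 1)
  have := h.sep h7
  have := h7.mod_run
  have := h5.mod_run
  omega

/-- Two tracks less than 11 files apart coincide in the run; beyond it they are branches of the same
node, told apart by residues modulo 13. -/
theorem Row.near_zero {t : ℕ} {X X' : ℤ} (h : Row t X) (h' : Row t X') (h1 : X < X' + 11)
    (h2 : X' < X + 11) : placeOf t < runOf t ∧ X' = X ∨ runOf t ≤ placeOf t ∧ X' / 13 = X / 13 ∧
      (placeOf t = runOf t ∧ X' % 13 = 0 ∨ placeOf t ≠ runOf t ∧ X' % 13 = 1 ∨
      runOf t ≠ 0 ∧ X' % 13 = 2 * (placeOf t - runOf t + 1)) := by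
  rcases lt_or_ge (placeOf t) (runOf t) with h3 | h3
  · have := h.sep h' h3
    omega
  · have := h.sep_div h' (by omega)
    have := h'.mod_fork h3
    refine .inr ⟨h3, by omega, this⟩

theorem Row.near_one {t : ℕ} {X Z : ℤ} (h : Row t X) (h' : Row (t + 1) Z) (h1 : X < Z + 9)
    (h2 : Z < X + 9) :
    placeOf t < runOf t ∧ StepTo (kindAt t X) X Z ∨
    runOf t ≤ placeOf t ∧ Z / 13 = X / 13 ∧
      (Z % 13 = 1 ∨ runOf t ≠ 0 ∧ Z % 13 = 2 * (placeOf t - runOf t + 2)) := by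
  obtain ⟨X', h3, h4⟩ := h'.pred
  have h5 : X' ≤ Z ∧ Z ≤ X' + 2 := by
    cases hk : kindAt t X' <;> rw [hk] at h4 <;> simp only [StepTo] at h4 <;> omega
  rcases h.near_zero h3 (by omega) (by omega) with ⟨h6, rfl⟩ | ⟨h6, h7, h8⟩
  · exact .inl ⟨h6, h4⟩
  · right
    have := place_lt t
    cases hk : kindAt t X' <;> rw [hk] at h4
    · rw [kindAt_eq_left] at hk
      simp only [StepTo] at h4
      omega
    · rw [kindAt_eq_right] at hk
      simp only [StepTo] at h4
      omega
    · rw [kindAt_eq_drop] at hk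
      simp only [StepTo] at h4
      omega
    · rw [kindAt_eq_fork] at hk
      omega
-- This lemma and the following ones share one argument: a hole comes from a track square in the row
-- above it, that track is close enough to be the given one or its sibling branch, and the residues
-- exclude every case.
theorem Row.hole_left₁ {t : ℕ} {X : ℤ} (h : Row t X) (hk : kindAt t X = .left) :
    ¬ Hole t (X - 2) := by
  intro h1
  obtain ⟨X', h2, h3⟩ := Hole.cases h1
  have h4 := h.near_zero h2 (by omega) (by omega)
  have h5 := h.near_zero h (by omega) (by omega)
  have h6 := place_next t
  have h7 := @Row.mod_run t X h
  rw [kindAt_eq_left] at hk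
  omega

theorem Row.hole_left₂ {t : ℕ} {X : ℤ} (h : Row t X) (hk : kindAt t X = .left) :
    ¬ Hole (t + 1) (X + 3) := by
  intro h1
  obtain ⟨X', h2, h3⟩ := Hole.cases h1
  have h4 := h.near_one h2 (by omega) (by omega)
  rw [hk] at h4
  simp only [StepTo] at h4
  have h5 := h.near_zero h (by omega) (by omega)
  have h6 := place_next t
  have h7 := @Row.mod_run t X h
  rw [kindAt_eq_left] at hk
  omega

theorem Row.hole_left₃ {t : ℕ} {X : ℤ} (h : Row t X) (hk : kindAt t X = .left) :
    ¬ Hole (t + 1) (X + 1) := by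
  intro h1
  obtain ⟨X', h2, h3⟩ := Hole.cases h1
  have h4 := h.near_one h2 (by omega) (by omega)
  rw [hk] at h4
  simp only [StepTo] at h4
  have h5 := h.near_zero h (by omega) (by omega)
  have h6 := place_next t
  have h7 := @Row.mod_run t X h
  rw [kindAt_eq_left] at hk
  omega

theorem Row.hole_left₄ {t : ℕ} {X : ℤ} (h : Row t X) (hk : kindAt t X = .left) :
    ¬ Hole (t + 1) (X + 4) := by
  intro h1
  obtain ⟨X', h2, h3⟩ := Hole.cases h1
  have h4 := h.near_one h2 (by omega) (by omega)
  rw [hk] at h4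
  simp only [StepTo] at h4
  have h5 := h.near_zero h (by omega) (by omega)
  have h6 := place_next t
  have h7 := @Row.mod_run t X h
  rw [kindAt_eq_left] at hk
  omega

theorem Row.hole_left_end {t : ℕ} {X : ℤ} (h : Row t X) (hk : kindAt t X = .left) (hn : ¬ Row (t + 1) X) :
    ¬ Hole (t + 1) X := by
  intro h1
  obtain ⟨X', h2, h3⟩ := Hole.cases h1
  have hne : X' ≠ X := fun e => hn (e ▸ h2)
  have h4 := h.near_one h2 (by omega) (by omega)
  rw [hk] at h4
  simp only [StepTo] at h4
  have h5 := h.near_zero h (by omega) (by omega)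
  have h6 := place_next t
  have h7 := @Row.mod_run t X h
  rw [kindAt_eq_left] at hk
  omega

theorem Row.hole_right₁ {t : ℕ} {X : ℤ} (h : Row t X) (hk : kindAt t X = .right) :
    ¬ Hole t (X + 4) := by
  intro h1
  obtain ⟨X', h2, h3⟩ := Hole.cases h1
  have h4 := h.near_zero h2 (by omega) (by omega)
  have h5 := h.near_zero h (by omega) (by omega)
  have h6 := place_next t
  have h7 := @Row.mod_run t X h
  rw [kindAt_eq_right] at hk
  omega

theorem Row.hole_right₂ {t : ℕ} {X : ℤ} (h : Row t X) (hk : kindAt t X = .right) :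
    ¬ Hole (t + 1) X := by
  intro h1
  obtain ⟨X', h2, h3⟩ := Hole.cases h1
  have h4 := h.near_one h2 (by omega) (by omega)
  rw [hk] at h4
  simp only [StepTo] at h4
  have h5 := h.near_zero h (by omega) (by omega)
  have h6 := place_next t
  have h7 := @Row.mod_run t X h
  rw [kindAt_eq_right] at hk
  omega

theorem Row.hole_right₃ {t : ℕ} {X : ℤ} (h : Row t X) (hk : kindAt t X = .right) :
    ¬ Hole (t + 1) (X + 1) := by
  intro h1
  obtain ⟨X', h2, h3⟩ := Hole.cases h1
  have h4 := h.near_one h2 (by omega) (by omega)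
  rw [hk] at h4
  simp only [StepTo] at h4
  have h5 := h.near_zero h (by omega) (by omega)
  have h6 := place_next t
  have h7 := @Row.mod_run t X h
  rw [kindAt_eq_right] at hk
  omega

theorem Row.hole_right₄ {t : ℕ} {X : ℤ} (h : Row t X) (hk : kindAt t X = .right) :
    ¬ Hole (t + 1) (X + 3) := by
  intro h1
  obtain ⟨X', h2, h3⟩ := Hole.cases h1
  have h4 := h.near_one h2 (by omega) (by omega)
  rw [hk] at h4
  simp only [StepTo] at h4
  have h5 := h.near_zero h (by omega) (by omega)
  have h6 := place_next t
  have h7 := @Row.mod_run t X h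
  rw [kindAt_eq_right] at hk
  omega

theorem Row.hole_right_end {t : ℕ} {X : ℤ} (h : Row t X) (hk : kindAt t X = .right) (hn : ¬ Row (t + 1) (X + 2)) :
    ¬ Hole (t + 1) (X + 4) := by
  intro h1
  obtain ⟨X', h2, h3⟩ := Hole.cases h1
  have hne : X' ≠ X + 2 := fun e => hn (e ▸ h2)
  have h4 := h.near_one h2 (by omega) (by omega)
  rw [hk] at h4
  simp only [StepTo] at h4
  have h5 := h.near_zero h (by omega) (by omega)
  have h6 := place_next t
  have h7 := @Row.mod_run t X h
  rw [kindAt_eq_right] at hk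
  omega

theorem Row.hole_drop₁ {t : ℕ} {X : ℤ} (h : Row t X) (hk : kindAt t X = .drop) :
    ¬ Hole t (X - 1) := by
  intro h1
  obtain ⟨X', h2, h3⟩ := Hole.cases h1
  have h4 := h.near_zero h2 (by omega) (by omega)
  have h5 := h.near_zero h (by omega) (by omega)
  have h6 := place_next t
  have h7 := @Row.mod_run t X h
  rw [kindAt_eq_drop] at hk
  omega

theorem Row.hole_drop₂ {t : ℕ} {X : ℤ} (h : Row t X) (hk : kindAt t X = .drop) :
    ¬ Hole t (X + 3) := by
  intro h1
  obtain ⟨X', h2, h3⟩ := Hole.cases h1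
  have h4 := h.near_zero h2 (by omega) (by omega)
  have h5 := h.near_zero h (by omega) (by omega)
  have h6 := place_next t
  have h7 := @Row.mod_run t X h
  rw [kindAt_eq_drop] at hk
  omega

theorem Row.hole_drop₃ {t : ℕ} {X : ℤ} (h : Row t X) (hk : kindAt t X = .drop) :
    ¬ Hole (t + 1) (X + 2) := by
  intro h1
  obtain ⟨X', h2, h3⟩ := Hole.cases h1
  have h4 := h.near_one h2 (by omega) (by omega)
  rw [hk] at h4
  simp only [StepTo] at h4
  have h5 := h.near_zero h (by omega) (by omega)
  have h6 := place_next t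
  have h7 := @Row.mod_run t X h
  rw [kindAt_eq_drop] at hk
  omega

theorem Row.hole_drop₄ {t : ℕ} {X : ℤ} (h : Row t X) (hk : kindAt t X = .drop) :
    ¬ Hole (t + 1) (X + 3) := by
  intro h1
  obtain ⟨X', h2, h3⟩ := Hole.cases h1
  have h4 := h.near_one h2 (by omega) (by omega)
  rw [hk] at h4
  simp only [StepTo] at h4
  have h5 := h.near_zero h (by omega) (by omega)
  have h6 := place_next t
  have h7 := @Row.mod_run t X h
  rw [kindAt_eq_drop] at hk
  omega

theorem Row.hole_fork₃ {t : ℕ} {X : ℤ} (h : Row t X) (hk : kindAt t X = .fork) :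
    ¬ Hole t (X - 2) := by
  intro h1
  obtain ⟨X', h2, h3⟩ := Hole.cases h1
  have h4 := h.near_zero h2 (by omega) (by omega)
  have h5 := h.near_zero h (by omega) (by omega)
  have h6 := place_next t
  have h7 := @Row.mod_run t X h
  rw [kindAt_eq_fork] at hk
  omega

theorem Row.hole_fork₄ {t : ℕ} {X : ℤ} (h : Row t X) (hk : kindAt t X = .fork) :
    ¬ Hole t (X + 4) := by
  intro h1
  obtain ⟨X', h2, h3⟩ := Hole.cases h1
  have h4 := h.near_zero h2 (by omega) (by omega)
  have h5 := h.near_zero h (by omega) (by omega)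
  have h6 := place_next t
  have h7 := @Row.mod_run t X h
  rw [kindAt_eq_fork] at hk
  omega

theorem Row.hole_fork₅ {t : ℕ} {X : ℤ} (h : Row t X) (hk : kindAt t X = .fork) :
    ¬ Hole (t + 1) (X + 1) := by
  intro h1
  obtain ⟨X', h2, h3⟩ := Hole.cases h1
  have h4 := h.near_one h2 (by omega) (by omega)
  rw [hk] at h4
  simp only [StepTo] at h4
  have h5 := h.near_zero h (by omega) (by omega)
  have h6 := place_next t
  have h7 := @Row.mod_run t X h
  rw [kindAt_eq_fork] at hk
  omega

theorem Row.hole_down {t : ℕ} {X : ℤ} (h : Row t X) : ¬ Hole t (X + 1) := by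
  intro h1
  obtain ⟨X', h2, h3⟩ := Hole.cases h1
  have := h.near_zero h2 (by omega) (by omega)
  have := h.near_zero h (by omega) (by omega)
  have := place_next t
  omega
end InfiniteChess

/-! ### The field meets the requirements of the hunt -/

namespace InfiniteChess

theorem row_zero : Row 0 0 := ⟨0, false, rfl, fun _ => rfl, rfl⟩

theorem KnightAt.le {t : ℕ} {X : ℤ} (h : KnightAt t X) : 3 ≤ t := by
  have := run_cases t
  have := h.1
  omega

theorem Row.pawn_one {t : ℕ} {X e : ℤ} (h : Row t X) (h1 : -4 < e) (h2 : e < 7)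
    (h3 : ¬ Hole t (X + e)) : fieldAt (t + 1) (X + e) = wPawn :=
  fieldAt_pawn h3 (h.no_knight_one h1 h2)

theorem Row.pawn_two {t : ℕ} {X e : ℤ} (h : Row t X) (h1 : -4 < e) (h2 : e < 7)
    (h3 : ¬ Hole (t + 1) (X + e)) : fieldAt (t + 1 + 1) (X + e) = wPawn :=
  fieldAt_pawn h3 (h.no_knight_two h1 h2)

theorem Row.fork_knight {t : ℕ} {X : ℤ} (h : Row t X) (hk : kindAt t X = .fork) :
    fieldAt t (X - 4) = wKnight := by
  rw [kindAt_eq_fork] at hk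
  rw [fieldAt_knight]
  refine ⟨⟨hk, by simpa using h⟩, ?_⟩
  rintro ⟨h1, h2⟩
  obtain ⟨t, rfl⟩ := Nat.exists_eq_add_of_le' h1
  obtain ⟨X', h3, h4⟩ := h.pred'
  obtain ⟨X'', h5, h6⟩ := Hole.cases h2
  have h7 := place_next t
  have h8 := run_cases (t + 1)
  have h9 := @Row.mod_run t X' h3
  have h10 := h3.near_zero h5
  omega

theorem sea_field : Sea field OnTrack trackStep where
  start := onTrack_iff (t := 0) (X := 0) |>.2 row_zero
  kd_start := by
    rw [← kindAt_eq_drop (t := 0) (X := 0) |>.2 ⟨rfl, by norm_num⟩]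
    exact trackStep_eq (t := 0) (X := 0)
  king := by
    rw [field_eq 0 0 (by simp) (by simp)]
    simp [fieldAt]
  content x y hy h := by
    by_cases h1 : 0 < y
    · simp [field, h1]
    · obtain ⟨t, X, rfl, rfl⟩ := exists_depth (x := x) (not_lt.1 h1)
      rw [field_eq t X rfl rfl, fieldAt]
      have : ¬ (t = 0 ∧ X = 0) := by
        rintro ⟨rfl, rfl⟩
        simp at h
      split_ifs <;> simp
  surface x y h _ := by simp [field, show 0 < y by omega]
  hole_start := by
    rw [field_eq 1 2 (by simp) (by simp)]
    exact fieldAt_none (.inr (.inl ⟨row_zero, by decide⟩))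
  knight_deep x y h := by
    by_cases h1 : 0 < y
    · simp [field, h1] at h
    · obtain ⟨t, X, rfl, rfl⟩ := exists_depth (x := x) (not_lt.1 h1)
      rw [field_eq t X rfl rfl, fieldAt_knight] at h
      have := h.1.le
      omega
  pawn_start x h1 h2 h := by
    rw [field_eq 0 x (by simp) (by simp), fieldAt, if_neg (by simpa using h), if_neg (by simp),
      if_neg]
    intro h3
    have := h3.le
    omega
  depth x y h := h.1
  down x y h := by
    obtain ⟨t, X, rfl, rfl⟩ := exists_depth (x := x) h.1
    rw [onTrack_iff] at h
    rw [field_eq (t + 1) (X + 1) (by push_cast; ring) (by push_cast; ring)]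
    exact h.pawn_one (by norm_num) (by norm_num) (h.hole_down)
  hole x y h := by
    obtain ⟨t, X, rfl, rfl⟩ := exists_depth (x := x) h.1
    rw [onTrack_iff] at h
    rw [field_eq (t + 1) X (by push_cast; ring) (by push_cast; ring)]
    exact fieldAt_none (.inl h)
  left₁ x y h hk := by
    obtain ⟨t, X, rfl, rfl⟩ := exists_depth (x := x) h.1
    rw [onTrack_iff] at h
    rw [trackStep_eq] at hk
    rw [field_eq (t + 1) (X - 2) (by push_cast; ring) (by push_cast; ring)]
    exact h.pawn_one (e := -2) (by norm_num) (by norm_num) (h.hole_left₁ hk)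
  left₂ x y h hk := by
    obtain ⟨t, X, rfl, rfl⟩ := exists_depth (x := x) h.1
    rw [onTrack_iff] at h
    rw [trackStep_eq] at hk
    rw [field_eq (t + 1 + 1) (X + 3) (by push_cast; ring) (by push_cast; ring)]
    exact h.pawn_two (by norm_num) (by norm_num) (h.hole_left₂ hk)
  left₃ x y h hk := by
    obtain ⟨t, X, rfl, rfl⟩ := exists_depth (x := x) h.1
    rw [onTrack_iff] at h
    rw [trackStep_eq] at hk
    rw [field_eq (t + 1 + 1) (X + 1) (by push_cast; ring) (by push_cast; ring)]
    exact h.pawn_two (by norm_num) (by norm_num) (h.hole_left₃ hk)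
  left₄ x y h hk := by
    obtain ⟨t, X, rfl, rfl⟩ := exists_depth (x := x) h.1
    rw [onTrack_iff] at h
    rw [trackStep_eq] at hk
    rw [field_eq (t + 1 + 1) (X + 4) (by push_cast; ring) (by push_cast; ring)]
    exact h.pawn_two (by norm_num) (by norm_num) (h.hole_left₄ hk)
  left_end x y h hk hn := by
    obtain ⟨t, X, rfl, rfl⟩ := exists_depth (x := x) h.1
    rw [onTrack_iff] at h
    rw [trackStep_eq] at hk
    rw [onTrack_at (t + 1) X (by push_cast; ring) (by push_cast; ring)] at hn
    rw [field_eq (t + 1 + 1) X (by push_cast; ring) (by push_cast; ring)]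
    simpa using h.pawn_two (e := 0) (by norm_num) (by norm_num)
      (by simpa using h.hole_left_end hk hn)
  left_next x y h hk hn := by
    obtain ⟨t, X, rfl, rfl⟩ := exists_depth (x := x) h.1
    rw [onTrack_iff] at h
    rw [trackStep_eq] at hk
    rw [onTrack_at (t + 1) X (by push_cast; ring) (by push_cast; ring)] at hn
    rw [field_eq (t + 1 + 1) (X + 2) (by push_cast; ring) (by push_cast; ring)]
    rw [kindAt_eq_left] at hk
    have := place_next t
    -- Only a square reached by a drop lacks its right hole, and a left step never leads to the row
    -- concerned.
    exact fieldAt_none (.inr (.inl ⟨by simpa using hn, by omega⟩))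
  right₁ x y h hk := by
    obtain ⟨t, X, rfl, rfl⟩ := exists_depth (x := x) h.1
    rw [onTrack_iff] at h
    rw [trackStep_eq] at hk
    rw [field_eq (t + 1) (X + 4) (by push_cast; ring) (by push_cast; ring)]
    exact h.pawn_one (by norm_num) (by norm_num) (h.hole_right₁ hk)
  right₂ x y h hk := by
    obtain ⟨t, X, rfl, rfl⟩ := exists_depth (x := x) h.1
    rw [onTrack_iff] at h
    rw [trackStep_eq] at hk
    rw [field_eq (t + 1 + 1) X (by push_cast; ring) (by push_cast; ring)]
    simpa using h.pawn_two (e := 0) (by norm_num) (by norm_num)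
      (by simpa using h.hole_right₂ hk)
  right₃ x y h hk := by
    obtain ⟨t, X, rfl, rfl⟩ := exists_depth (x := x) h.1
    rw [onTrack_iff] at h
    rw [trackStep_eq] at hk
    rw [field_eq (t + 1 + 1) (X + 1) (by push_cast; ring) (by push_cast; ring)]
    exact h.pawn_two (by norm_num) (by norm_num) (h.hole_right₃ hk)
  right₄ x y h hk := by
    obtain ⟨t, X, rfl, rfl⟩ := exists_depth (x := x) h.1
    rw [onTrack_iff] at h
    rw [trackStep_eq] at hk
    rw [field_eq (t + 1 + 1) (X + 3) (by push_cast; ring) (by push_cast; ring)]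
    exact h.pawn_two (by norm_num) (by norm_num) (h.hole_right₄ hk)
  right_end x y h hk hn := by
    obtain ⟨t, X, rfl, rfl⟩ := exists_depth (x := x) h.1
    rw [onTrack_iff] at h
    rw [trackStep_eq] at hk
    rw [onTrack_at (t + 1) (X + 2) (by push_cast; ring) (by push_cast; ring)] at hn
    rw [field_eq (t + 1 + 1) (X + 4) (by push_cast; ring) (by push_cast; ring)]
    exact h.pawn_two (by norm_num) (by norm_num) (h.hole_right_end hk hn)
  right_next x y h hk hn := by
    obtain ⟨t, X, rfl, rfl⟩ := exists_depth (x := x) h.1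
    rw [onTrack_iff] at h
    rw [trackStep_eq] at hk
    rw [onTrack_at (t + 1) (X + 2) (by push_cast; ring) (by push_cast; ring)] at hn
    rw [field_eq (t + 1 + 1) (X + 4) (by push_cast; ring) (by push_cast; ring)]
    rw [kindAt_eq_right] at hk
    have := place_next t
    refine fieldAt_none (.inr (.inl ⟨by convert hn using 1; ring, ?_⟩))
    have := hn.mod_fork
    have := h.mod_fork
    omega
  drop₁ x y h hk := by
    obtain ⟨t, X, rfl, rfl⟩ := exists_depth (x := x) h.1
    rw [onTrack_iff] at h
    rw [trackStep_eq] at hk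
    rw [field_eq (t + 1) (X - 1) (by push_cast; ring) (by push_cast; ring)]
    exact h.pawn_one (e := -1) (by norm_num) (by norm_num) (h.hole_drop₁ hk)
  drop₂ x y h hk := by
    obtain ⟨t, X, rfl, rfl⟩ := exists_depth (x := x) h.1
    rw [onTrack_iff] at h
    rw [trackStep_eq] at hk
    rw [field_eq (t + 1) (X + 3) (by push_cast; ring) (by push_cast; ring)]
    exact h.pawn_one (by norm_num) (by norm_num) (h.hole_drop₂ hk)
  drop₃ x y h hk := by
    obtain ⟨t, X, rfl, rfl⟩ := exists_depth (x := x) h.1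
    rw [onTrack_iff] at h
    rw [trackStep_eq] at hk
    rw [field_eq (t + 1 + 1) (X + 2) (by push_cast; ring) (by push_cast; ring)]
    exact h.pawn_two (by norm_num) (by norm_num) (h.hole_drop₃ hk)
  drop₄ x y h hk := by
    obtain ⟨t, X, rfl, rfl⟩ := exists_depth (x := x) h.1
    rw [onTrack_iff] at h
    rw [trackStep_eq] at hk
    rw [field_eq (t + 1 + 1) (X + 3) (by push_cast; ring) (by push_cast; ring)]
    exact h.pawn_two (by norm_num) (by norm_num) (h.hole_drop₄ hk)
  drop_next x y h hk := by
    obtain ⟨t, X, rfl, rfl⟩ := exists_depth (x := x) h.1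
    rw [onTrack_iff] at h
    rw [trackStep_eq] at hk
    rw [onTrack_at (t + 1) (X + 1) (by push_cast; ring) (by push_cast; ring)]
    have := place_next t
    refine h.succ (by rw [hk]; simp [StepTo]) ?_
    rw [kindAt_eq_drop] at hk
    omega
  fork₁ x y h hk := by
    obtain ⟨t, X, rfl, rfl⟩ := exists_depth (x := x) h.1
    rw [onTrack_iff] at h
    rw [trackStep_eq] at hk
    rw [field_eq t (X - 4) (by ring) (by ring)]
    exact h.fork_knight hk
  fork₂ x y h hk := by
    obtain ⟨t, X, rfl, rfl⟩ := exists_depth (x := x) h.1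
    rw [onTrack_iff] at h
    rw [trackStep_eq] at hk
    rw [field_eq (t + 1) (X - 1) (by push_cast; ring) (by push_cast; ring)]
    rw [kindAt_eq_fork] at hk
    exact fieldAt_none (.inr (.inr ⟨hk, by simpa using h⟩))
  fork₃ x y h hk := by
    obtain ⟨t, X, rfl, rfl⟩ := exists_depth (x := x) h.1
    rw [onTrack_iff] at h
    rw [trackStep_eq] at hk
    rw [field_eq (t + 1) (X - 2) (by push_cast; ring) (by push_cast; ring)]
    exact h.pawn_one (e := -2) (by norm_num) (by norm_num) (h.hole_fork₃ hk)
  fork₄ x y h hk := by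
    obtain ⟨t, X, rfl, rfl⟩ := exists_depth (x := x) h.1
    rw [onTrack_iff] at h
    rw [trackStep_eq] at hk
    rw [field_eq (t + 1) (X + 4) (by push_cast; ring) (by push_cast; ring)]
    exact h.pawn_one (by norm_num) (by norm_num) (h.hole_fork₄ hk)
  fork₅ x y h hk := by
    obtain ⟨t, X, rfl, rfl⟩ := exists_depth (x := x) h.1
    rw [onTrack_iff] at h
    rw [trackStep_eq] at hk
    rw [field_eq (t + 1 + 1) (X + 1) (by push_cast; ring) (by push_cast; ring)]
    exact h.pawn_two (by norm_num) (by norm_num) (h.hole_fork₅ hk)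
  fork_left x y h hk := by
    obtain ⟨t, X, rfl, rfl⟩ := exists_depth (x := x) h.1
    rw [onTrack_iff] at h
    rw [trackStep_eq] at hk
    rw [onTrack_at (t + 1) X (by push_cast; ring) (by push_cast; ring)]
    refine h.succ (by rw [hk]; simp [StepTo]) ?_
    rw [kindAt_eq_fork] at hk
    omega
  fork_right x y h hk := by
    obtain ⟨t, X, rfl, rfl⟩ := exists_depth (x := x) h.1
    rw [onTrack_iff] at h
    rw [trackStep_eq] at hk
    rw [onTrack_at (t + 1) (X + 2) (by push_cast; ring) (by push_cast; ring)]
    refine h.succ (by rw [hk]; simp [StepTo]) ?_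
    rw [kindAt_eq_fork] at hk
    omega
  fork_left_next x y h hk := by
    obtain ⟨t, X, rfl, rfl⟩ := exists_depth (x := x) h.1
    rw [onTrack_iff] at h
    rw [trackStep_eq] at hk
    rw [field_eq (t + 1 + 1) (X + 2) (by push_cast; ring) (by push_cast; ring)]
    have h1 : Row (t + 1) (X) := by
      refine h.succ (by rw [hk]; simp [StepTo]) ?_
      rw [kindAt_eq_fork] at hk
      omega
    rw [kindAt_eq_fork] at hk
    have := place_next t
    refine fieldAt_none (.inr (.inl ⟨by convert h1 using 1; ring, by omega⟩))
  fork_right_next x y h hk := by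
    obtain ⟨t, X, rfl, rfl⟩ := exists_depth (x := x) h.1
    rw [onTrack_iff] at h
    rw [trackStep_eq] at hk
    rw [field_eq (t + 1 + 1) (X + 4) (by push_cast; ring) (by push_cast; ring)]
    have h1 : Row (t + 1) (X + 2) := by
      refine h.succ (by rw [hk]; simp [StepTo]) ?_
      rw [kindAt_eq_fork] at hk
      omega
    rw [kindAt_eq_fork] at hk
    have := place_next t
    refine fieldAt_none (.inr (.inl ⟨by convert h1 using 1; ring, by omega⟩))
  kd_left x y h hk hn := by
    obtain ⟨t, X, rfl, rfl⟩ := exists_depth (x := x) h.1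
    rw [onTrack_iff] at h
    rw [trackStep_eq] at hk
    rw [trackStep_at (t + 1) X (by push_cast; ring) (by push_cast; ring)]
    rw [Ne, kindAt_eq_drop]
    rw [kindAt_eq_left] at hk
    have := place_next t
    omega
  kd_right x y h hk hn := by
    obtain ⟨t, X, rfl, rfl⟩ := exists_depth (x := x) h.1
    rw [onTrack_iff] at h
    rw [trackStep_eq] at hk
    rw [trackStep_at (t + 1) (X + 2) (by push_cast; ring) (by push_cast; ring)]
    rw [Ne, Ne, kindAt_eq_drop, kindAt_eq_fork]
    rw [kindAt_eq_right] at hk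
    have := place_next t
    have := @Row.mod_run t X h
    have := @Row.mod_fork t X h
    omega
  kd_drop x y h hk := by
    obtain ⟨t, X, rfl, rfl⟩ := exists_depth (x := x) h.1
    rw [onTrack_iff] at h
    rw [trackStep_eq] at hk
    rw [trackStep_at (t + 1) (X + 1) (by push_cast; ring) (by push_cast; ring)]
    rw [kindAt_eq_left]
    rw [kindAt_eq_drop] at hk
    have := place_next t
    have := @Row.mod_fork t X h
    omega
  kd_fork_left x y h hk := by
    obtain ⟨t, X, rfl, rfl⟩ := exists_depth (x := x) h.1
    rw [onTrack_iff] at h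
    rw [trackStep_eq] at hk
    rw [trackStep_at (t + 1) X (by push_cast; ring) (by push_cast; ring)]
    rw [kindAt_eq_drop]
    rw [kindAt_eq_fork] at hk
    have := place_next t
    have := @Row.mod_run t X h
    omega
  kd_fork_right x y h hk := by
    obtain ⟨t, X, rfl, rfl⟩ := exists_depth (x := x) h.1
    rw [onTrack_iff] at h
    rw [trackStep_eq] at hk
    rw [trackStep_at (t + 1) (X + 2) (by push_cast; ring) (by push_cast; ring)]
    rw [kindAt_eq_right]
    rw [kindAt_eq_fork] at hk
    have := place_next t
    have := @Row.mod_run t X h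
    omega

end InfiniteChess

/-! ### Endless tracks give infinite paths -/

namespace InfiniteChess

/-- `X t` is the file at depth `t` of a track that never ends. -/
structure Endless (X : ℕ → ℤ) : Prop where
  zero : X 0 = 0
  row : ∀ t, Row t (X t)
  step : ∀ t, StepTo (kindAt t (X t)) (X t) (X (t + 1))

variable {X : ℕ → ℤ}

/-- Runs that contain a fork have length at least 14, so going back up to six rows from the fork
does not leave the block. -/
theorem placeOf_before_fork {n j : ℕ} (h : placeOf (n + j) + 1 = runOf (n + j)) (hj : j ≤ 6) :
    placeOf n + 1 + j = runOf n := by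
  induction j generalizing n with
  | zero => exact h
  | succ j ih =>
    rw [Nat.add_comm j, ← Nat.add_assoc] at h
    have := ih h (by omega)
    have := place_next n
    have := run_cases (n + 1)
    omega

namespace Endless

theorem le_add (h : Endless X) (n j : ℕ) : X n ≤ X (n + j) ∧ X (n + j) ≤ X n + 2 * j := by
  induction j with
  | zero => simp
  | succ j ih =>
    have := h.step (n + j)
    cases hk : kindAt (n + j) (X (n + j)) <;> rw [hk] at this <;>
      simp only [StepTo, add_assoc] at this <;> omega

theorem eq_before_fork (h : Endless X) {n j : ℕ} (hn : placeOf n + 1 + j = runOf n) (hj : j ≤ 6) :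
    X (n + j) = X n := by
  induction j generalizing n with
  | zero => rfl
  | succ j ih =>
    have h1 := (h.row n).mod_run (by omega) (by omega)
    have h2 := h.step n
    rw [kindAt_eq_left.2 (.inr ⟨by omega, h1.2.1⟩)] at h2
    have := place_next n
    rw [Nat.add_comm j, ← Nat.add_assoc, ih (by omega) (by omega), h2]

theorem eq_after_left (h : Endless X) {m : ℕ} (h1 : placeOf m = runOf m + 1) (h2 : X m % 13 = 1)
    {j : ℕ} (hj : j ≤ 4) :
    X (m + j) = X m ∧ (j ≤ 3 → placeOf (m + j) = runOf (m + j) + 1 + j) := by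
  induction j with
  | zero => simp [h1]
  | succ j ih =>
    obtain ⟨h3, h4⟩ := ih (by omega)
    have h4 := h4 (by omega)
    have h5 := h.step (m + j)
    rw [kindAt_eq_left.2 (.inl ⟨by omega, by omega⟩)] at h5
    have := place_next (m + j)
    rw [← Nat.add_assoc]
    exact ⟨by rw [h5, h3], by omega⟩

theorem eq_after_right (h : Endless X) {m : ℕ} (h1 : placeOf m = runOf m) (h2 : X m % 13 = 2)
    {j : ℕ} (hj : j ≤ 5) :
    X (m + j) = X m + 2 * j ∧ (j ≤ 4 → placeOf (m + j) = runOf (m + j) + j) := by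
  induction j with
  | zero => simp [h1]
  | succ j ih =>
    obtain ⟨h3, h4⟩ := ih (by omega)
    have h4 := h4 (by omega)
    have h5 := h.step (m + j)
    have h6 : 2 ≤ X (m + j) % 13 := by
      obtain rfl | rfl | rfl | rfl | rfl : j = 0 ∨ j = 1 ∨ j = 2 ∨ j = 3 ∨ j = 4 := by omega
      all_goals omega
    rw [kindAt_eq_right.2 (.inl ⟨by omega, h6⟩)] at h5
    have := place_next (m + j)
    rw [← Nat.add_assoc]
    refine ⟨?_, by omega⟩
    rw [h5, h3]
    push_cast
    ring

theorem trackStep_eq_fork {s : ℕ} {Z : ℤ} : trackStep (Z - s, -s) = .fork ↔ placeOf s + 1 = runOf s := by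
  rw [trackStep_eq, kindAt_eq_fork]

theorem path (h : Endless X) : Path field OnTrack trackStep fun t => X t - t where
  zero := by simp [h.zero]
  next n := by
    refine ⟨?_, rfl, ?_⟩
    · rw [onTrack_at (n + 1) (X (n + 1)) (by push_cast; ring) rfl]
      exact h.row _
    · rw [trackStep_eq]
      have := h.step n
      cases hk : kindAt n (X n) <;> rw [hk] at this <;> simp only [StepTo] at this ⊢ <;>
        push_cast <;> omega
  track n := onTrack_iff.2 (h.row n)
  knights u v hw n h1 h2 h3 h4 := by
    have hv : v ≤ 0 := by
      by_contra hv
      simp [field, show 0 < v by omega] at hw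
    obtain ⟨t, Z, rfl, rfl⟩ := exists_depth (x := u) hv
    rw [field_eq t Z rfl rfl, fieldAt_knight] at hw
    obtain ⟨⟨h5, h6⟩, -⟩ := hw
    -- At the depth of the knight both its fork and the path lie on files divisible by 13. The
    -- quotients are equal or at least 11 apart, and the latter is excluded by the closeness of the
    -- knight to the path.
    have h7 := (h.row t).sep_div h6 (by omega)
    have h8 := (h.row t).mod_run (by omega) (by omega)
    have h9 := h6.mod_run (by omega) (by omega)
    have h10 : X n - 12 ≤ X t ∧ X t ≤ X n + 12 := by
      rcases le_total n t with h10 | h10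
      · obtain ⟨j, rfl⟩ := Nat.exists_eq_add_of_le h10
        have := h.le_add n j
        omega
      · obtain ⟨j, rfl⟩ := Nat.exists_eq_add_of_le h10
        have := h.le_add t j
        omega
    refine ⟨t, trackStep_eq_fork.2 h5, ?_, rfl⟩
    omega
  before s n hs h1 h2 := by
    rw [trackStep_eq_fork] at hs
    obtain ⟨j, rfl⟩ := Nat.exists_eq_add_of_le h1
    rw [h.eq_before_fork (placeOf_before_fork hs (by omega)) (by omega)]
    push_cast
    ring
  after_left s n hs h1 h2 h3 := by
    rw [trackStep_eq_fork] at hs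
    have h4 := (h.row s).mod_run (by omega) (by omega)
    have h5 := place_next s
    have h6 := place_next (s + 1)
    have h7 := h.step (s + 1)
    push_cast at h1
    rw [kindAt_eq_drop.2 (by omega)] at h7
    simp only [StepTo] at h7
    obtain ⟨j, rfl⟩ := Nat.exists_eq_add_of_le h2
    have := h.eq_after_left (m := s + 1 + 1) (j := j) (by omega) (by omega) (by omega)
    rw [this.1]
    push_cast
    omega
  after_right s n hs h1 h2 h3 := by
    rw [trackStep_eq_fork] at hs
    have h4 := (h.row s).mod_run (by omega) (by omega)
    have h5 := place_next s
    push_cast at h1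
    obtain rfl | h6 := h2.eq_or_lt
    · ring
    obtain ⟨j, rfl⟩ := Nat.exists_eq_add_of_le h6
    have := h.eq_after_right (m := s + 1) (j := j) (by omega) (by omega) (by omega)
    rw [Nat.succ_eq_add_one, this.1]
    push_cast
    omega
  pawn₁ s hs := by
    rw [trackStep_eq_fork] at hs
    have h1 := run_cases s
    obtain ⟨t, rfl⟩ : ∃ t, s = t + 2 := ⟨s - 2, by omega⟩
    have h2 := placeOf_before_fork hs (by omega)
    have h3 := h.eq_before_fork h2 (by omega)
    have h4 := place_next t
    rw [h3, field_eq (t + 1) (X t - 3) (by push_cast; ring) (by push_cast; ring)]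
    refine fieldAt_pawn (fun h5 => ?_) fun h5 => ?_
    · obtain ⟨X', h6, h7⟩ := Hole.cases h5
      have := (h.row t).near_zero h6 (by omega) (by omega)
      omega
    · have := h5.1
      omega
  pawn₂ s hs := by
    rw [trackStep_eq_fork] at hs
    have h1 := (h.row s).mod_run (by omega) (by omega)
    have h2 := place_next s
    have h3 := h.le_add s 1
    rw [field_eq (s + 1 + 1) (X s + -1) (by push_cast; ring) (by push_cast; ring)]
    refine (h.row s).pawn_two (by norm_num) (by norm_num) fun h5 => ?_
    obtain ⟨X', h6, h7⟩ := Hole.cases h5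
    have := (h.row (s + 1)).near_zero h6 (by omega) (by omega)
    have := (h.row (s + 1)).near_zero (h.row (s + 1)) (by omega) (by omega)
    omega
  pawn₃ s hs := by
    rw [trackStep_eq_fork] at hs
    have h1 := (h.row s).mod_run (by omega) (by omega)
    have h2 := place_next s
    have h2' := place_next (s + 1)
    have h2'' := place_next (s + 1 + 1)
    have h3 := h.le_add s 1
    have h4 := h.le_add (s + 1) 1
    rw [field_eq (s + 1 + 1 + 1) (X s) (by push_cast; ring) (by push_cast; ring)]
    refine fieldAt_pawn (t := s + 1 + 1) (fun h5 => ?_) fun h5 => ?_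
    · obtain ⟨X', h6, h7⟩ := Hole.cases h5
      have := (h.row (s + 1 + 1)).near_zero h6 (by omega) (by omega)
      have := (h.row (s + 1 + 1)).near_zero (h.row (s + 1 + 1)) (by omega) (by omega)
      omega
    · have := h5.1
      omega
  pawn₄ s hs := by
    rw [trackStep_eq_fork] at hs
    have h1 := (h.row s).mod_run (by omega) (by omega)
    have h2 := place_next s
    have h3 := h.le_add s 1
    rw [field_eq (s + 1 + 1) (X s + -2) (by push_cast; ring) (by push_cast; ring)]
    refine (h.row s).pawn_two (by norm_num) (by norm_num) fun h5 => ?_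
    obtain ⟨X', h6, h7⟩ := Hole.cases h5
    have := (h.row (s + 1)).near_zero h6 (by omega) (by omega)
    have := (h.row (s + 1)).near_zero (h.row (s + 1)) (by omega) (by omega)
    omega
  pawn₅ s hs := by
    rw [trackStep_eq_fork] at hs
    have h1 := (h.row s).mod_run (by omega) (by omega)
    have h2 := place_next s
    have h2' := place_next (s + 1)
    have h2'' := place_next (s + 1 + 1)
    have h3 := h.le_add s 1
    have h4 := h.le_add (s + 1) 1
    rw [field_eq (s + 1 + 1 + 1) (X s + 2) (by push_cast; ring) (by push_cast; ring)]
    refine fieldAt_pawn (t := s + 1 + 1) (fun h5 => ?_) fun h5 => ?_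
    · obtain ⟨X', h6, h7⟩ := Hole.cases h5
      have := (h.row (s + 1 + 1)).near_zero h6 (by omega) (by omega)
      have := (h.row (s + 1 + 1)).near_zero (h.row (s + 1 + 1)) (by omega) (by omega)
      omega
    · have := h5.1
      omega

end Endless

/-- The first `d` values of `f`, the newest one first. -/
def initial (f : ℕ → Bool) (d : ℕ) : List Bool := ((List.range d).map f).reverse

theorem initial_succ (f : ℕ → Bool) (d : ℕ) : initial f (d + 1) = f d :: initial f d := by
  simp [initial, List.range_succ]

theorem initial_length (f : ℕ → Bool) (d : ℕ) : (initial f d).length = d := by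
  simp [initial]

theorem initial_get {f : ℕ → Bool} {d n : ℕ} (h : n < d) :
    (initial f d).reverse[n]? = some (f n) := by
  simp [initial, h]

def branchBase (f : ℕ → Bool) : ℕ → ℕ
  | 0 => 0
  | d + 1 => nodeFile (initial f d)

def branchBit (f : ℕ → Bool) : ℕ → Bool
  | 0 => false
  | d + 1 => f d

theorem childBase_branch (f : ℕ → Bool) (d : ℕ) :
    childBase (branchBase f d) (branchBit f d) = branchBase f (d + 1) := by
  cases d with
  | zero => rfl
  | succ d => rw [branchBase, branchBase, branchBit, initial_succ, nodeFile_cons]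

/-- The track through the tree that follows the branch `f`. -/
def branchFile (f : ℕ → Bool) (t : ℕ) : ℤ :=
  trackFile (runOf t) (placeOf t) (branchBase f (level t).1) (branchBit f (level t).1)

theorem branch_endless {f : ℕ → Bool} (h : ∀ d, Avoids (initial f d)) :
    Endless (branchFile f) where
  zero := rfl
  row t := by
    refine ⟨_, _, ?_, ?_, rfl⟩
    · cases (level t).1 with
      | zero => rfl
      | succ d => exact ⟨_, initial_length f d, h d, rfl⟩
    · intro h
      rw [h, branchBit]
  step t := by
    have hb : IsBase (level t).1 (branchBase f (level t).1) := by
      cases (level t).1 with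
      | zero => rfl
      | succ d => exact ⟨_, initial_length f d, h d, rfl⟩
    have hb := hb.bound
    rw [show runLength (level t).1 = runOf t from rfl] at hb
    have h0 : (level t).1 = 0 → branchBit f (level t).1 = false := by
      intro h
      rw [h, branchBit]
    rcases place_next t with ⟨h4, h5, h6, h7⟩ | ⟨h4, h5, h6, h7⟩
    · have : branchFile f (t + 1) = trackFile (runOf t) (placeOf t + 1)
          (branchBase f (level t).1) (branchBit f (level t).1) := by
        rw [branchFile, h5, h6, h7]
      rw [this]
      refine (stepTo_trackFile h4 (by tauto) _).2 ?_
      split_ifs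
      · exact ⟨_, rfl⟩
      · rfl
    · have h8 : placeOf t = runOf t + 4 := by omega
      rw [branchFile, branchFile, kindAt, h8, stepTo_trackFile_end (by
        intro h
        apply h0
        omega), h5, h7, childBase_branch, trackFile, if_pos (by omega)]
      simp

/-- Bit `n` of the branch is 1 exactly if program `n` outputs 0 on input `n`, so it never agrees
with that program's output. -/
theorem exists_endless : ∃ X, Endless X := by
  classical
  refine ⟨_, branch_endless (f := fun n =>
    decide (0 ∈ (Denumerable.ofNat Nat.Partrec.Code n).eval n)) fun d n hn b hb he => ?_⟩
  rw [initial_length] at hn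
  rw [initial_get hn] at hb
  have he := Nat.Partrec.Code.evaln_sound he
  by_cases h : 0 ∈ (Denumerable.ofNat Nat.Partrec.Code n).eval n
  · obtain rfl : true = b := by simpa [h] using hb
    exact absurd (Part.mem_unique he h) (by simp)
  · obtain rfl : false = b := by simpa [h] using hb
    exact h he

end InfiniteChess

/-! ### No endless track is computable -/

namespace InfiniteChess

/-- The depth at which block `d` begins. -/
def blockStart : ℕ → ℕ
  | 0 => 0
  | d + 1 => blockStart d + (runLength d + 5)

theorem level_blockStart_add {d c : ℕ} (hc : c < runLength d + 5) :
    level (blockStart d + c) = (d, c) := by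
  induction d generalizing c with
  | zero =>
    induction c with
    | zero => rfl
    | succ c ih =>
      rw [← Nat.add_assoc, level_succ, ih (by omega), nextLevel, if_pos hc]
  | succ d ihd =>
    induction c with
    | zero =>
      rw [blockStart, Nat.add_zero, show blockStart d + (runLength d + 5) =
        blockStart d + (runLength d + 4) + 1 by ring, level_succ, ihd (by omega), nextLevel, if_neg (by simp)]
    | succ c ih =>
      rw [← Nat.add_assoc, level_succ, ih (by omega), nextLevel, if_pos hc]

theorem runOf_blockStart_add {d c : ℕ} (hc : c < runLength d + 5) :
    runOf (blockStart d + c) = runLength d := by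
  rw [runOf, level_blockStart_add hc]

theorem placeOf_blockStart_add {d c : ℕ} (hc : c < runLength d + 5) :
    placeOf (blockStart d + c) = c := by
  rw [placeOf, level_blockStart_add hc]

theorem row_blockStart {d : ℕ} {X : ℤ} (h : Row (blockStart d) X) :
    ∃ y : ℕ, IsBase d y ∧ X = y := by
  obtain ⟨y, b, h1, h2, rfl⟩ := h
  have h3 := level_blockStart_add (d := d) (c := 0) (by omega)
  rw [Nat.add_zero] at h3
  rw [h3] at h1 h2 ⊢
  have := h1.bound
  refine ⟨y, h1, ?_⟩
  dsimp only at this h2 ⊢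
  rw [trackFile]
  split_ifs with h4 h5 h6
  · simp
  · have := h2 (by omega)
    simp [h5] at this
  · omega
  · omega

namespace Endless

variable {X : ℕ → ℤ}

/-- At the fork the track picks a bit; induction on the place in the block shows that the formula
for the track with this bit holds until the end. -/
theorem child (h : Endless X) {d y : ℕ} (hy : IsBase d y) (hX : X (blockStart d) = y) :
    ∃ b, X (blockStart (d + 1)) = childBase y b := by
  have hb := hy.bound
  have key : ∀ c, c < runLength d + 5 → ∃ b, (runLength d = 0 → b = false) ∧
      X (blockStart d + c) = trackFile (runLength d) c y b := by
    intro c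
    induction c with
    | zero =>
      refine fun _ => ⟨false, fun _ => rfl, ?_⟩
      rw [Nat.add_zero, hX, trackFile]
      split_ifs
      · simp
      · simp_all
      · simp_all
        omega
      · simp_all
    | succ c ih =>
      intro hc
      obtain ⟨b, h1, h2⟩ := ih (by omega)
      have h3 := h.step (blockStart d + c)
      rw [kindAt, runOf_blockStart_add (by omega), placeOf_blockStart_add (by omega), h2] at h3
      have h4 := (stepTo_trackFile hc (by tauto) _).1 h3
      split_ifs at h4
      · obtain ⟨b', h4⟩ := h4
        exact ⟨b', by omega, h4⟩
      · exact ⟨b, h1, h4⟩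
  obtain ⟨b, h1, h2⟩ := key (runLength d + 4) (by omega)
  have h3 := h.step (blockStart d + (runLength d + 4))
  rw [kindAt, runOf_blockStart_add (by omega), placeOf_blockStart_add (by omega), h2] at h3
  exact ⟨b, (stepTo_trackFile_end h1 _).1 h3⟩

/-- The branch of the tree that a track follows. -/
def branch (X : ℕ → ℤ) (d : ℕ) : Bool := decide ((X (blockStart (d + 2))).toNat % 13 ≠ 1)

/-- At the start of each block the file of the track is the base value of a surviving node. Since
`nodeFile` is injective on lists of equal length, that node is the list of bits chosen so far. -/
theorem avoids (h : Endless X) (d : ℕ) : Avoids (initial (branch X) d) ∧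
    X (blockStart (d + 1)) = nodeFile (initial (branch X) d) := by
  induction d with
  | zero =>
    refine ⟨fun n hn => by simp [initial] at hn, ?_⟩
    obtain ⟨y, ⟨s, h1, -, rfl⟩, h3⟩ := row_blockStart (h.row (blockStart 1))
    rw [h3, List.length_eq_zero_iff.1 h1]
    rfl
  | succ d ih =>
    obtain ⟨b, hb⟩ := h.child (d := d + 1) ⟨_, initial_length _ _, ih.1, rfl⟩ ih.2
    obtain ⟨y, ⟨s, h1, h2, rfl⟩, h3⟩ := row_blockStart (h.row (blockStart (d + 1 + 1)))
    -- The bit chosen in block `d + 1` shows at the start of block `d + 2` as the residue 1 or 12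
    -- modulo 13.
    have hbr : branch X d = b := by
      rw [branch, hb, childBase, Int.toNat_natCast]
      cases b <;> simp
    have : s = b :: initial (branch X) d := by
      rw [h3, ← nodeFile_cons] at hb
      have hb : nodeFile s = nodeFile (b :: initial (branch X) d) := by exact_mod_cast hb
      rcases nodeFile_sep (s := s) (s' := b :: initial (branch X) d)
        (by rw [h1, List.length_cons, initial_length]) with h4 | h4 | h4
      · exact h4
      · omega
      · omega
    rw [initial_succ, hbr, ← this]
    exact ⟨h2, h3⟩

end Endless

theorem primrec_runLength : Primrec runLength := by
  have hp : Primrec fun d : ℕ => 25 ^ d :=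
    (Primrec.nat_rec₁ (f := fun _ n => 25 * n) 1
      (Primrec.nat_mul.comp (Primrec.const 25) Primrec.snd).to₂).of_eq fun d => by
      induction d with
      | zero => rfl
      | succ d ih => rw [pow_succ, ← ih, mul_comm]
  refine (Primrec.nat_casesOn₁ 0 (Primrec.nat_add.comp (Primrec.nat_mul.comp (Primrec.const 6) hp)
    (Primrec.const 8))).of_eq fun d => ?_
  cases d <;> rfl

theorem primrec_blockStart : Primrec blockStart :=
  (Primrec.nat_rec₁ (f := fun d n => n + (runLength d + 5)) 0
    (Primrec.nat_add.comp Primrec.snd (Primrec.nat_add.comp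
      (primrec_runLength.comp Primrec.fst) (Primrec.const 5))).to₂).of_eq fun d => by
    induction d with
    | zero => rfl
    | succ d ih => rw [blockStart, ← ih]

/-- Diagonalization: if program `m` computes `f`, then bit `m` of the branch equals the output of
program `m` on `m`. -/
theorem exists_not_avoids {f : ℕ → Bool} (hf : Computable f) : ∃ d, ¬ Avoids (initial f d) := by
  have h1 : Computable fun n => (f n).toNat :=
    (Computable.cond hf (Computable.const 1) (Computable.const 0)).of_eq fun n => by
      cases f n <;> rfl
  obtain ⟨c, hc⟩ := Nat.Partrec.Code.exists_code.1 (Partrec.nat_iff.1 h1.partrec)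
  obtain ⟨m, rfl⟩ : ∃ m, c = Denumerable.ofNat Nat.Partrec.Code m :=
    ⟨Encodable.encode c, (Denumerable.ofNat_encode c).symm⟩
  have h2 : (f m).toNat ∈ (Denumerable.ofNat Nat.Partrec.Code m).eval m := by
    rw [hc]
    exact Part.mem_some _
  obtain ⟨k, hk⟩ := Nat.Partrec.Code.evaln_complete.1 h2
  -- The segment must contain bit `m` and be long enough for the computation to end within `k`
  -- steps.
  refine ⟨max k (m + 1), fun h => ?_⟩
  refine h m (by rw [initial_length]; omega) (f m) (initial_get (by omega)) ?_
  rw [initial_length]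
  exact Nat.Partrec.Code.evaln_mono (le_max_left _ _) hk

theorem endless_of_next {k : ℕ → Square} (h0 : k 0 = (0, 0))
    (h : ∀ n, Next OnTrack trackStep (k n) (k (n + 1))) : Endless fun t => (k t).1 + t := by
  have h2 : ∀ t, (k t).2 = -t := by
    intro t
    induction t with
    | zero => simp [h0]
    | succ t ih =>
      rw [(h t).2.1, ih]
      push_cast
      ring
  have h3 : ∀ t, k t = ((k t).1 + t - t, -(t : ℤ)) := fun t => by
    rw [← h2]
    simp
  refine ⟨by simp [h0], fun t => ?_, fun t => ?_⟩
  · rw [← onTrack_iff, ← h3]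
    cases t with
    | zero =>
      rw [h0]
      exact sea_field.start
    | succ t => exact (h t).1
  · rw [← trackStep_eq, ← h3]
    have := (h t).2.2
    cases hk : trackStep (k t) <;> rw [hk] at this <;> simp only [StepTo] at this ⊢ <;>
      push_cast <;> omega

theorem no_computable_track (k : ℕ → Square) (hk : Computable k) (h0 : k 0 = (0, 0)) :
    ¬ ∀ n, Next OnTrack trackStep (k n) (k (n + 1)) := by
  intro h
  have hX : Computable fun t => (k t).1 + (t : ℤ) :=
    primrec_int_add.to_comp.comp (Computable.fst.comp hk) primrec_intCast.to_comp
  have hf : Computable (Endless.branch fun t => (k t).1 + (t : ℤ)) := by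
    have h1 : Primrec fun d => blockStart (d + 2) :=
      primrec_blockStart.comp (Primrec.nat_add.comp Primrec.id (Primrec.const 2))
    have h2 : PrimrecPred fun z : ℤ => z.toNat % 13 ≠ 1 :=
      (Primrec.eq.comp (Primrec.nat_mod.comp primrec_toNat (Primrec.const 13))
        (Primrec.const 1)).not
    exact h2.decide.to_comp.comp (hX.comp h1.to_comp)
  obtain ⟨d, hd⟩ := exists_not_avoids hf
  exact hd ((endless_of_next h0 h).avoids d).1

end InfiniteChess

namespace InfiniteChess

/-! The field of white pawns is computable. -/

theorem primrec_boolToNat : Primrec Bool.toNat := Primrec.dom_bool _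

/-- The step bound makes `evaln` primitive recursive, and only the finitely many `n < s.length` have
to be tested. -/
theorem primrecPred_avoids : PrimrecPred Avoids := by
  have h1 : Primrec fun x : ℕ × List Bool => Nat.Partrec.Code.evaln x.2.length
      (Denumerable.ofNat Nat.Partrec.Code x.1) x.1 :=
    Nat.Partrec.Code.primrec_evaln.comp
      (((Primrec.list_length.comp Primrec.snd).pair
        ((Primrec.ofNat Nat.Partrec.Code).comp Primrec.fst)).pair Primrec.fst)
  have h2 : Primrec fun x : ℕ × List Bool => x.2.reverse[x.1]?.map Bool.toNat :=
    Primrec.option_map (Primrec.list_getElem?.comp (Primrec.list_reverse.comp Primrec.snd)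
      Primrec.fst) (primrec_boolToNat.comp Primrec.snd).to₂
  have h3 : PrimrecRel fun (n : ℕ) (s : List Bool) => Nat.Partrec.Code.evaln s.length
      (Denumerable.ofNat Nat.Partrec.Code n) n ≠ s.reverse[n]?.map Bool.toNat :=
    (Primrec.eq.comp h1 h2).not
  refine (h3.forall_mem_list.comp (Primrec.list_range.comp Primrec.list_length)
    Primrec.id).of_eq fun s => ?_
  simp only [List.mem_range, id_eq, Avoids]
  refine forall₂_congr fun n hn => ?_
  rw [List.getElem?_eq_getElem (by simpa using hn)]
  simp

/-- The lists of `d` bits. -/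
def bitLists : ℕ → List (List Bool)
  | 0 => [[]]
  | d + 1 => (bitLists d).flatMap fun s => [true :: s, false :: s]

theorem mem_bitLists {d : ℕ} {s : List Bool} : s ∈ bitLists d ↔ s.length = d := by
  induction d generalizing s with
  | zero => simp [bitLists]
  | succ d ih =>
    cases s with
    | nil => simp [bitLists]
    | cons b s => cases b <;> simp [bitLists, ih]

theorem primrec_bitLists : Primrec bitLists := by
  have h : Primrec₂ fun (_ : ℕ × List (List Bool)) (s : List Bool) => [true :: s, false :: s] :=
    (Primrec.list_cons.comp (Primrec.list_cons.comp (Primrec.const true) Primrec.snd)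
      (Primrec.list_cons.comp (Primrec.list_cons.comp (Primrec.const false) Primrec.snd)
        (Primrec.const []))).to₂
  refine (Primrec.nat_rec₁ (f := fun _ L => L.flatMap fun s => [true :: s, false :: s]) [[]]
    (Primrec.list_flatMap Primrec.snd h).to₂).of_eq fun d => ?_
  induction d with
  | zero => rfl
  | succ d ih => rw [bitLists, ← ih]

theorem primrec_nodeFile : Primrec nodeFile := by
  have h : Primrec₂ fun (_ : List Bool) (x : Bool × ℕ) => 13 * x.2 + if x.1 then 12 else 1 :=
    (Primrec.nat_add.comp (Primrec.nat_mul.comp (Primrec.const 13)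
      (Primrec.snd.comp Primrec.snd)) ((Primrec.dom_bool fun b => if b then 12 else 1).comp
        (Primrec.fst.comp Primrec.snd))).to₂
  refine (Primrec.list_foldr Primrec.id (Primrec.const 1) h).of_eq fun s => ?_
  induction s with
  | nil => rfl
  | cons b s ih =>
    rw [nodeFile, ← ih]
    rfl

/-- The list of the base values of the tracks in block `d`. -/
theorem exists_baseList : ∃ L : ℕ → List ℕ, Primrec L ∧ ∀ d y, y ∈ L d ↔ IsBase d y := by
  classical
  refine ⟨fun d => Nat.casesOn d [0] fun d => ((bitLists d).filter (Avoids ·)).map nodeFile,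
    Primrec.nat_casesOn₁ _ (Primrec.list_map ((Primrec.listFilter primrecPred_avoids).comp
      primrec_bitLists) (primrec_nodeFile.comp Primrec.snd).to₂), fun d y => ?_⟩
  cases d with
  | zero => simp [IsBase]
  | succ d =>
    simp only [List.mem_map, List.mem_filter, mem_bitLists, decide_eq_true_eq, IsBase]
    exact exists_congr fun s => by rw [and_assoc, eq_comm (a := y)]

theorem primrec_level : Primrec level := by
  have h : Primrec nextLevel :=
    Primrec.ite (Primrec.nat_lt.comp (Primrec.nat_add.comp Primrec.snd (Primrec.const 1))
        (Primrec.nat_add.comp (primrec_runLength.comp Primrec.fst) (Primrec.const 5)))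
      (Primrec.fst.pair (Primrec.nat_add.comp Primrec.snd (Primrec.const 1)))
      ((Primrec.nat_add.comp Primrec.fst (Primrec.const 1)).pair (Primrec.const 0))
  exact Primrec.nat_rec₁ (0, 0) (h.comp Primrec.snd).to₂

theorem primrec_runOf : Primrec runOf := primrec_runLength.comp (Primrec.fst.comp primrec_level)

theorem primrec_placeOf : Primrec placeOf := Primrec.snd.comp primrec_level

theorem primrec_trackFile (b : Bool) :
    Primrec fun x : ℕ × ℕ × ℕ => trackFile x.1 x.2.1 x.2.2 b := by
  have hl : Primrec fun x : ℕ × ℕ × ℕ => x.1 := Primrec.fst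
  have hc : Primrec fun x : ℕ × ℕ × ℕ => x.2.1 := Primrec.fst.comp Primrec.snd
  have hy : Primrec fun x : ℕ × ℕ × ℕ => x.2.2 := Primrec.snd.comp Primrec.snd
  have h13 : Primrec fun x : ℕ × ℕ × ℕ => 13 * x.2.2 := Primrec.nat_mul.comp (Primrec.const 13) hy
  have h1 : Primrec fun x : ℕ × ℕ × ℕ => x.2.2 + 2 * min x.2.1 (6 * x.2.2) :=
    Primrec.nat_add.comp hy (Primrec.nat_mul.comp (Primrec.const 2)
      (Primrec.nat_min.comp hc (Primrec.nat_mul.comp (Primrec.const 6) hy)))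
  have h2 : Primrec fun x : ℕ × ℕ × ℕ => 13 * x.2.2 + 2 * (x.2.1 - x.1 + 1) :=
    Primrec.nat_add.comp h13 (Primrec.nat_mul.comp (Primrec.const 2)
      (Primrec.nat_add.comp (Primrec.nat_sub.comp hc hl) (Primrec.const 1)))
  have h3 : Primrec fun x : ℕ × ℕ × ℕ => 13 * x.2.2 + if x.2.1 = x.1 then 0 else 1 :=
    Primrec.nat_add.comp h13 (Primrec.ite (Primrec.eq.comp hc hl) (Primrec.const 0)
      (Primrec.const 1))
  cases b
  · exact Primrec.ite (Primrec.nat_lt.comp hc hl) h1 h3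
  · exact Primrec.ite (Primrec.nat_lt.comp hc hl) h1 h2

theorem primrecRel_row : PrimrecRel Row := by
  obtain ⟨L, hL, h⟩ := exists_baseList
  have hd : Primrec fun x : ℕ × ℕ × ℤ => (level x.2.1).1 :=
    Primrec.fst.comp (primrec_level.comp (Primrec.fst.comp Primrec.snd))
  have hX : Primrec fun x : ℕ × ℕ × ℤ => x.2.2 := Primrec.snd.comp Primrec.snd
  have hf : ∀ b, PrimrecPred fun x : ℕ × ℕ × ℤ =>
      x.2.2 = ((trackFile (runOf x.2.1) (placeOf x.2.1) x.1 b : ℕ) : ℤ) := fun b =>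
    Primrec.eq.comp hX (primrec_intCast.comp ((primrec_trackFile b).comp
      ((primrec_runOf.comp (Primrec.fst.comp Primrec.snd)).pair
        ((primrec_placeOf.comp (Primrec.fst.comp Primrec.snd)).pair Primrec.fst))))
  have h1 : PrimrecRel fun (y : ℕ) (x : ℕ × ℤ) =>
      x.2 = ((trackFile (runOf x.1) (placeOf x.1) y false : ℕ) : ℤ) ∨
      (level x.1).1 ≠ 0 ∧ x.2 = ((trackFile (runOf x.1) (placeOf x.1) y true : ℕ) : ℤ) :=
    (hf false).or ((Primrec.eq.comp hd (Primrec.const 0)).not.and (hf true))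
  have h2 : PrimrecPred fun x : ℕ × ℤ => ∃ y ∈ L (level x.1).1,
      x.2 = ((trackFile (runOf x.1) (placeOf x.1) y false : ℕ) : ℤ) ∨
      (level x.1).1 ≠ 0 ∧ x.2 = ((trackFile (runOf x.1) (placeOf x.1) y true : ℕ) : ℤ) :=
    h1.exists_mem_list.comp
      (hL.comp (Primrec.fst.comp (primrec_level.comp Primrec.fst))) Primrec.id
  refine h2.of_eq fun x => exists_congr fun y => ?_
  simp [h, runOf, placeOf]

/-- The remainder of `-(n + 1)` modulo 13 is `12 - n % 13`. -/
theorem primrec_int_mod : Primrec fun z : ℤ => z % 13 := by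
  have h : Primrec fun n : ℕ => n % 13 := Primrec.nat_mod.comp Primrec.id (Primrec.const 13)
  refine (primrec_int_cases (primrec_intCast.comp h)
    (primrec_int_sub.comp (Primrec.const 12) (primrec_intCast.comp h))).of_eq fun z => ?_
  cases z with
  | ofNat n => simp
  | negSucc n => simp [Int.negSucc_emod]

theorem primrecRel_hole : PrimrecRel Hole := by
  have hp : Primrec fun x : ℕ × ℤ => placeOf x.1 := primrec_placeOf.comp Primrec.fst
  have hr : Primrec fun x : ℕ × ℤ => runOf x.1 := primrec_runOf.comp Primrec.fst
  have hs : Primrec fun x : ℕ × ℤ => x.2 - 2 := primrec_int_sub.comp Primrec.snd (Primrec.const 2)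
  have hm : PrimrecPred fun z : ℤ => z % 13 = 1 :=
    Primrec.eq.comp primrec_int_mod (Primrec.const 1)
  exact primrecRel_row.or ((primrecRel_row.comp Primrec.fst hs).and
    (((Primrec.eq.comp hp (Primrec.nat_add.comp hr (Primrec.const 1))).and (hm.comp hs)).not)
      |>.or ((Primrec.eq.comp (Primrec.nat_add.comp hp (Primrec.const 1)) hr).and
        (primrecRel_row.comp Primrec.fst (primrec_int_add.comp Primrec.snd (Primrec.const 1)))))

theorem primrecRel_knightAt : PrimrecRel KnightAt :=
  (Primrec.eq.comp (Primrec.nat_add.comp (primrec_placeOf.comp Primrec.fst) (Primrec.const 1))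
    (primrec_runOf.comp Primrec.fst)).and
    (primrecRel_row.comp Primrec.fst (primrec_int_add.comp Primrec.snd (Primrec.const 4)))

open Classical in
theorem primrec_fieldAt : Primrec₂ fieldAt :=
  Primrec.ite ((Primrec.eq.comp Primrec.fst (Primrec.const 0)).and
      (Primrec.eq.comp Primrec.snd (Primrec.const 0))) (Primrec.const bKing)
    (Primrec.ite ((Primrec.nat_le.comp (Primrec.const 1) Primrec.fst).and
      (primrecRel_hole.comp (Primrec.nat_sub.comp Primrec.fst (Primrec.const 1)) Primrec.snd))
      (Primrec.const none)
      (Primrec.ite primrecRel_knightAt (Primrec.const wKnight) (Primrec.const wPawn)))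

theorem primrec_depth : Primrec fun s : Square => (-s.2).toNat :=
  primrec_toNat.comp (primrec_int_neg.comp Primrec.snd)

theorem primrec_field : Primrec field :=
  Primrec.ite (primrec_int_le.comp Primrec.snd (Primrec.const 0)).not (Primrec.const none)
    (primrec_fieldAt.comp primrec_depth (primrec_int_sub.comp Primrec.fst Primrec.snd)) |>.of_eq
    fun s => by simp [field]

theorem primrec_fullBoard {W : Board} (hW : Primrec W) : Primrec (fullBoard W) := by
  have : Finite Color := Finite.of_equiv _ colorEquiv.symm
  have : Finite Kind := Finite.of_equiv _ kindEquiv.symm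
  exact Primrec.ite (primrec_int_le.comp Primrec.snd (Primrec.const 5)) hW
    (Primrec.option_map (hW.comp primrec_flipSquare)
      ((Primrec.dom_finite flipPiece).comp Primrec.snd).to₂)

theorem primrecPred_kindAt (k : Step) : PrimrecPred fun x : ℕ × ℤ => kindAt x.1 x.2 = k := by
  have hp : Primrec fun x : ℕ × ℤ => placeOf x.1 := primrec_placeOf.comp Primrec.fst
  have hp1 := Primrec.nat_add.comp hp (Primrec.const 1)
  have hr : Primrec fun x : ℕ × ℤ => runOf x.1 := primrec_runOf.comp Primrec.fst
  have hm := primrec_int_le.comp (primrec_int_mod.comp (Primrec.snd (α := ℕ) (β := ℤ)))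
    (Primrec.const 1)
  -- Replacing `X` by `X.toNat` does not change the comparison, because the other side is
  -- nonnegative.
  have h6 := Primrec.nat_le.comp
    (Primrec.nat_mul.comp (Primrec.const 6) (primrec_toNat.comp (Primrec.snd (α := ℕ) (β := ℤ))))
    (Primrec.nat_mul.comp (Primrec.const 13) hp)
  cases k
  · refine (((Primrec.nat_lt.comp hr hp).and hm).or
      ((Primrec.nat_lt.comp hp1 hr).and h6)).of_eq fun x => ?_
    rw [kindAt_eq_left]
    omega
  · refine (((Primrec.nat_le.comp hr hp).and hm.not).or
      ((Primrec.nat_lt.comp hp1 hr).and h6.not)).of_eq fun x => ?_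
    rw [kindAt_eq_right]
    omega
  · refine ((Primrec.eq.comp hr hp).and hm).of_eq fun x => ?_
    rw [kindAt_eq_drop]
  · refine (Primrec.eq.comp hp1 hr).of_eq fun x => ?_
    rw [kindAt_eq_fork]

theorem computable_huntStrategy : Computable (huntStrategy trackStep) := by
  have hk : ∀ k, PrimrecPred fun s => trackStep s = k := fun k =>
    (primrecPred_kindAt k).comp (primrec_depth.pair (primrec_int_sub.comp Primrec.fst Primrec.snd))
  have hp : ∀ a b : ℤ, Primrec fun s : Square => ((s.1 + a, s.2 + b) : Square) := fun a b =>
    (primrec_int_add.comp Primrec.fst (Primrec.const a)).pair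
      (primrec_int_add.comp Primrec.snd (Primrec.const b))
  have hd : Primrec (driveMove trackStep) := by
    refine (Primrec.ite (hk .fork) ((hp (-4) 0).pair (hp (-2) (-1))) (Primrec.ite (hk .right)
      ((hp (-1) (-2)).pair (hp (-1) (-1))) ((hp 1 (-2)).pair (hp 1 (-1))))).of_eq fun s => ?_
    cases h : trackStep s <;> simp [driveMove, h, sub_eq_add_neg]
  exact hd.to_comp.comp lastSquare_computable

end InfiniteChess

theorem mainTheorem6 :
    ∃ B : InfiniteChess.Board,
      B.Regular ∧
      Computable B ∧
      (∀ c : InfiniteChess.Color, (InfiniteChess.Position.mk B c).ComputableWin c) ∧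
      (∀ c : InfiniteChess.Color, (InfiniteChess.Position.mk B c).IsDraw) := by
  obtain ⟨X, hX⟩ := InfiniteChess.exists_endless
  exact ⟨InfiniteChess.fullBoard InfiniteChess.field, InfiniteChess.sea_field.full_regular,
    (InfiniteChess.primrec_fullBoard InfiniteChess.primrec_field).to_comp,
    InfiniteChess.full_computableWin InfiniteChess.sea_field
      InfiniteChess.computable_huntStrategy InfiniteChess.no_computable_track,
    InfiniteChess.full_isDraw InfiniteChess.sea_field hX.path⟩
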